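/- **Setting.** Let $\Bbbk$ be a field of characteristic zero and $\nu\in\mathbb N_+\cup\{\infty\}$; let $\mathbb N_\nu=\{1,\dots,\nu\}$, $\mathbb N_\infty=\mathbb N_+$, $\mathbb N^+_\nu=\mathbb N_\nu\cap 2\mathbb N$. Let $\mathcal H=\mathcal H_\nu=\Bbbk\langle \mathbf a_n : n\in\mathbb N_\nu\rangle$ be the graded Hopf algebra (weight $\partial(\mathbf a_n)=n$) of non-commutative polynomials with $$\Delta(\mathbf a_n)=\mathbf a_n\otimes1+1\otimes \mathbf a_n+\sum_{m=1}^{n-1}\mathbf a_m\otimes Q^m_{n-m}(\mathbf a_*),\quad \epsilon(\mathbf a_n)=0,\quad S(\mathbf a_n)=-\mathbf a_n-\sum_{m=1}^{n-1}\mathbf a_m S(Q^m_{n-m}(\mathbf a_*))=-\mathbf a_n-\sum_{m=1}^{n-1}S(\mathbf a_m) Q^m_{n-m}(\mathbf a_*),\qquad(1)$$ where $Q^\ell_t=\sum_{k=1}^t\binom{\ell+1}{k}P^{(k)}_t$ and $P^{(k)}_t=\sum_{j_1+\dots+j_k=t,\ j_i>0}\mathbf a_{j_1}\cdots \mathbf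 a_{j_k}$. Let $F[\mathcal G_\nu]=\Bbbk[a_n: n\in\mathbb N_\nu]$ be the commutative Hopf algebra given by the same formulas: it is the function algebra of the algebraic group $\mathcal G_\nu$ of truncated formal diffeomorphisms $x+\sum_n a_nx^{n+1}$. Let $\mathcal K=\mathcal K_\nu$ be the graded Hopf algebra on generators $\mathbf a_{2n}$ $(2n\in\mathbb N_\nu^+)$ of weight $2n$, with the same formulas in which $\mathbf a_n,\mathbf a_m$ are replaced by $\mathbf a_{2n},\mathbf a_{2m}$ and $Q^\ell_t$ by $\bar Q^\ell_t=\sum_{k=1}^t\binom{2\ell+1}{k}\sum_{j_1+\dots+j_k=t,\ j_i>0}\mathbf a_{2j_1}\cdots \mathbf a_{2j_k}$; let $F[\mathcal G_\nu^+]$ be its commutative version. Let $J=\mathrm{Ker}(\epsilon_{\mathcal H})$, let $\hbar$ be an indeterminate, and $$\mathcal H_\hbar^\vee=\sum_{n\ge0}\Bbbk[\hbar]\,\hbar^{-n}J^n\subset \Bbbk(\hbar)\otimes\mathcal H,\qquad (\mathcal H_\hbar^\vee)'=\{\eta\in\mathcal H_\hbar^\vee : \delta_n(\eta)\in\hbar^n(\mathcal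 H_\hbar^\vee)^{\otimes n}\ \forall n\in\mathbb N\},$$ with $\delta_n=(\mathrm{id}-u\circ\epsilon)^{\otimes n}\circ\Delta^n$, $\Delta^n$ the $n$-fold iterated coproduct ($\Delta^0=\epsilon$, $\Delta^1=\mathrm{id}$) and $u$ the unit map. Let $\mathcal L_\nu$ be the free Lie algebra over $\Bbbk$ on $x_n$ $(n\in\mathbb N_\nu)$, mapped to $\mathcal H_\hbar^\vee$ by the Lie algebra map $x_n\mapsto\hbar^{-1}\mathbf a_n$; for $x\in\mathcal L_\nu$ put $\tilde x=\hbar x\in\mathcal H_\hbar^\vee$. A Lie monomial in $x_{n_1},\dots,x_{n_r}$ has weight $\partial=n_1+\dots+n_r$. Let $B_\nu$ be any $\Bbbk$-basis of $\mathcal L_\nu$. **Theorem 3.1.** (a) $(\mathcal H_\hbar^\vee)'$ is the $\Bbbk[\hbar]$-subalgebra generated by $\{\tilde x : x\in\mathcal L_\nu\}$, and it is presented by the generators $\tilde b$ $(b\in B_\nu)$ and the relations $[\tilde b_1,\tilde b_2]=\hbar\,\widetilde{[b_1,b_2]}$ $(b_1,b_2\in B_\nu)$, where $\widetilde{[b_1,b_2]}$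 is expanded linearly in the $\tilde b$. (b) $(\mathcal H_\hbar^\vee)'$ is a graded Hopf $\Bbbk[\hbar]$-subalgebra of $\mathcal H_\hbar^\vee$ (for the weight), and $\mathbf a_n\mapsto\tilde x_n$ defines an embedding of graded Hopf algebras $\mathcal H\hookrightarrow(\mathcal H_\hbar^\vee)'$. (c) The specialization $F:=(\mathcal H_\hbar^\vee)'/\hbar(\mathcal H_\hbar^\vee)'$, with the bracket $\{\bar a,\bar b\}=\overline{\hbar^{-1}(ab-ba)}$, is a commutative Poisson Hopf algebra, $F=F[G^\star_{\mathcal L_\nu}]$ for a connected Poisson affine algebraic group $G^\star_{\mathcal L_\nu}$, which is infinite dimensional if $\nu\ge2$. Its cotangent Lie bialgebra $\mathfrak m/\mathfrak m^2$, $\mathfrak m=\mathrm{Ker}(\epsilon_F)$ (bracket induced by the Poisson bracket, cobracket by $\Delta-\Delta^{\mathrm{op}}$), is isomorphic, through $x\mapsto \tilde x$, to $\mathcal L_\nu$ with the Lie bialgebra structure, graded by weight, whose cobracket satisfies $\delta(x_n)=\sum_{\ell=1}^{n-1}(\ell+1)(x_\ell\otimes x_{n-\ell}-x_{n-\ell}\otimes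 x_\ell)$. Moreover $F$ is the free Poisson algebra on the classes of the $\tilde x_n$ $(n\in\mathbb N_\nu)$, with Hopf structure given by (1) with $\tilde x_*$ in place of $\mathbf a_*$; it is the polynomial algebra on the classes of the $\tilde b$, $b\in B_\nu$ (so $G^\star_{\mathcal L_\nu}\cong\mathbb A_\Bbbk^{B_\nu}$ as a variety). It has an algebra grading in which the classes of all $\tilde x$ $(x\in\mathcal L_\nu)$ have degree $1$, and a Hopf algebra grading, inherited from $(\mathcal H_\hbar^\vee)'$, in which the class of $\tilde x$ has weight $\partial(x)$ for each Lie monomial $x$. (d) $a_n\mapsto(\tilde x_n\bmod\hbar)$ defines an embedding of graded Hopf algebras $\mu:F[\mathcal G_\nu]\hookrightarrow F[G^\star_{\mathcal L_\nu}]$, and $F[\mathcal G_\nu]$ freely generates $F[G^\star_{\mathcal L_\nu}]$ as a Poisson algebra: each algebra map from $F[\mathcal G_\nu]$ to a commutative Poisson algebra extends uniquely along $\mu$ to a map of Poisson algebras. Thus there is an epimorphism of algebraic groups $\mu_*:G^\star_{\mathcal L_\nu}\to\mathcal G_\nu$ (surjective on $R$-points for every commutative $\Bbbk$-algebra $R$).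 (e) There is an epimorphism of graded Hopf algebras $\pi:F[G^\star_{\mathcal L_\nu}]\to F[\mathcal G_\nu]$ with $\pi(\tilde x_n\bmod\hbar)=a_n$ and $\pi(\{f,g\})=0$ for all $f,g$. Thus there is a monomorphism of algebraic groups $\pi_*:\mathcal G_\nu\to G^\star_{\mathcal L_\nu}$ (injective on $R$-points). (f) $\pi\circ\mu=\mathrm{id}$, hence $\mu_*\circ\pi_*=\mathrm{id}$, and $G^\star_{\mathcal L_\nu}=\mathcal G_\nu\ltimes\mathcal N_\nu$ as algebraic groups, with $\mathcal N_\nu=\mathrm{Ker}(\mu_*)$: for every commutative $\Bbbk$-algebra $R$, the map $(n,g)\mapsto n\cdot\pi_*(g)$ is an isomorphism from a semidirect product of $\mathcal N_\nu(R)$ and $\mathcal G_\nu(R)$ onto $G^\star_{\mathcal L_\nu}(R)$. (g) Statements (a)–(f) hold with $\mathcal K$ in place of $\mathcal H$, $\mathcal G_\nu^+$ in place of $\mathcal G_\nu$, $\mathbb N_\nu^+$ in place of $\mathbb N_\nu$ and the free Lie algebra $\mathcal L_\nu^+$ on $x_{2n}$ $(2n\in\mathbb N_\nu^+)$ in place of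 $\mathcal L_\nu$; here $\delta(x_{2n})=\sum_{\ell=1}^{n-1}(2\ell+1)(x_{2\ell}\otimes x_{2(n-\ell)}-x_{2(n-\ell)}\otimes x_{2\ell})$, and "infinite dimensional" holds if $\nu\ge4$. -/

import Mathlib

open scoped TensorProduct PowerSeries Polynomial
open Finset
universe u v w
namespace FormalDiff

/-- The index set of the generators. For `s = 1` it is `{1, ..., ν}` (all positive integers if
`ν = ∞`), and `n` is the index of the generator `a_n`. For `s = 2` the number `n` stands for the
even number `2 n ≤ ν`, that is, for the generator `a_{2n}`. In both cases the generator with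
index `n` has weight `s * n`. -/
@[ext]
structure Idx (s : ℕ) (ν : ℕ∞) where
  n : ℕ
  pos : 1 ≤ n
  le : ((s * n : ℕ) : ℕ∞) ≤ ν

section formulas
variable {A : Type*} [Semiring A]
open Classical in
/-- A family indexed by `Idx s ν`, extended by zero to a sequence. -/
noncomputable def extend {s : ℕ} {ν : ℕ∞} (f : Idx s ν → A) (n : ℕ) : A :=
  if h : 1 ≤ n ∧ ((s * n : ℕ) : ℕ∞) ≤ ν then f ⟨n, h.1, h.2⟩ else 0

/-- `P_t^{(k)}(a)`: the sum of `a_{j_1} ... a_{j_k}` over all `j_1, ..., j_k > 0` with sum `t`. -/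
def compSum (a : ℕ → A) (k t : ℕ) : A :=
  ∑ j ∈ (Finset.Nat.antidiagonalTuple k t).filter (fun j => ∀ i, 0 < j i),
    (List.ofFn fun i => a (j i)).prod

/-- `Q_t^l(a) = ∑_{k=1}^t binom(s l + 1, k) P_t^{(k)}(a)`; the upper entry of the binomial is `l + 1`
for `s = 1` and `2 l + 1` for `s = 2`. -/
def Qpoly (s : ℕ) (a : ℕ → A) (l t : ℕ) : A :=
  ∑ k ∈ Finset.Icc 1 t, ((s * l + 1).choose k : A) * compSum a k t

/-- The series `1 + ∑_{n ≥ 1} a_n X^n`. -/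
noncomputable def ser (a : ℕ → A) : A⟦X⟧ := PowerSeries.mk fun n => if n = 0 then 1 else a n
/-- The series `∑_{n ≥ 1} a_n X^n`. -/
noncomputable def ser₀ (a : ℕ → A) : A⟦X⟧ := PowerSeries.mk fun n => if n = 0 then 0 else a n
/-- The coefficient of `X^t` in `(1 + ∑ a_n X^n)^N`; this is `Q_t^l(a)` for `N = s l + 1`, `t ≥ 1`. -/
noncomputable def serCoeff (a : ℕ → A) (N t : ℕ) : A := PowerSeries.coeff t (ser a ^ N)

theorem coeff_ser₀_pow (a : ℕ → A) (k t : ℕ) : PowerSeries.coeff t (ser₀ a ^ k) = compSum a k t := by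
  have h1 : compSum a k t = ∑ j ∈ Finset.Nat.antidiagonalTuple k t,
      (List.ofFn fun i => PowerSeries.coeff (j i) (ser₀ a)).prod := by
    rw [compSum, Finset.sum_filter]
    refine Finset.sum_congr rfl fun j _ => ?_
    split_ifs with h
    · congr 2
      funext i
      simp [ser₀, (h i).ne']
    · push Not at h
      obtain ⟨i, hi⟩ := h
      symm
      apply List.prod_eq_zero
      rw [List.mem_ofFn]
      exact ⟨i, by simp [ser₀, Nat.le_zero.mp hi]⟩
  rw [h1]
  clear h1
  induction k generalizing t with
  | zero =>
    cases t <;> simp [PowerSeries.coeff_one]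
  | succ k ih =>
    rw [pow_succ', PowerSeries.coeff_mul]
    simp_rw [ih, Finset.mul_sum]
    rw [Finset.sum_sigma']
    refine Finset.sum_bij' (fun p _ => (Fin.cons p.1.1 p.2 : Fin (k+1) → ℕ))
      (fun x _ => ⟨(x 0, ∑ i, Fin.tail x i), Fin.tail x⟩) ?_ ?_ ?_ ?_ ?_
    · rintro ⟨⟨p, q⟩, x⟩ h
      simp only [Finset.mem_sigma, HasAntidiagonal.mem_antidiagonal, Finset.Nat.mem_antidiagonalTuple] at h ⊢
      rw [Fin.sum_univ_succ]; simp [h.1, h.2]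
    · intro x h
      simp only [Finset.mem_sigma, HasAntidiagonal.mem_antidiagonal, Finset.Nat.mem_antidiagonalTuple] at h ⊢
      rw [Fin.sum_univ_succ] at h
      simp [Fin.tail, h]
    · rintro ⟨⟨p, q⟩, x⟩ h
      simp only [Finset.mem_sigma, HasAntidiagonal.mem_antidiagonal, Finset.Nat.mem_antidiagonalTuple] at h ⊢
      simp [h.2]
    · intro x h
      simp
    · rintro ⟨⟨p, q⟩, x⟩ h
      simp

theorem P_eq_zero (a : ℕ → A) {k t : ℕ} (h : t < k) : compSum a k t = 0 := by
  rw [compSum, Finset.sum_eq_zero]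
  intro j hj
  simp only [Finset.mem_filter, Finset.Nat.mem_antidiagonalTuple] at hj
  have : ∑ i : Fin k, 1 ≤ ∑ i, j i := Finset.sum_le_sum fun i _ => hj.2 i
  simp at this
  omega

theorem c_eq (a : ℕ → A) (N : ℕ) {t : ℕ} (ht : 1 ≤ t) :
    serCoeff a N t = ∑ k ∈ Finset.Icc 1 t, (N.choose k : A) * compSum a k t := by
  have h : ser a = ser₀ a + 1 := by
    ext n
    by_cases hn : n = 0 <;> simp [ser, ser₀, hn, PowerSeries.coeff_one]
  rw [serCoeff, h, (Commute.one_right _).add_pow, map_sum]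
  have hz : ∀ k, compSum a k t ≠ 0 → k ∈ Finset.Icc 1 t := by
    intro k hk
    rw [Finset.mem_Icc]
    constructor
    · rcases k with _ | k
      · exfalso; apply hk
        obtain ⟨t, rfl⟩ : ∃ t', t = t' + 1 := ⟨t - 1, by omega⟩
        simp [compSum]
      · omega
    · by_contra hlt
      exact hk (P_eq_zero a (by omega))
  have key : ∀ k, PowerSeries.coeff t (ser₀ a ^ k * 1 ^ (N - k) * (N.choose k : A⟦X⟧))
      = (N.choose k : A) * compSum a k t := by
    intro k
    rw [one_pow, mul_one, ← Nat.cast_comm, ← nsmul_eq_mul, map_nsmul, coeff_ser₀_pow, nsmul_eq_mul]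
  simp_rw [key]
  trans ∑ k ∈ Finset.range (N + 1) ∪ Finset.Icc 1 t, (N.choose k : A) * compSum a k t
  · refine Finset.sum_subset Finset.subset_union_left fun k _ hk => ?_
    simp only [Finset.mem_range, not_lt] at hk
    rw [Nat.choose_eq_zero_of_lt (by omega)]; simp
  · symm
    refine Finset.sum_subset Finset.subset_union_right fun k _ hk => ?_
    by_contra h0
    exact hk (hz k (right_ne_zero_of_mul h0))

theorem Q_eq (s : ℕ) (a : ℕ → A) (l : ℕ) {t : ℕ} (ht : 1 ≤ t) : Qpoly s a l t = serCoeff a (s*l+1) t := by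
  rw [Qpoly, c_eq a _ ht]

theorem c_zero (a : ℕ → A) (t : ℕ) : serCoeff a 0 t = if t = 0 then 1 else 0 := by
  simp [serCoeff, PowerSeries.coeff_one]

theorem c_one (a : ℕ → A) (t : ℕ) : serCoeff a 1 t = if t = 0 then 1 else a t := by
  simp [serCoeff, ser]

theorem c_coeff_zero (a : ℕ → A) (N : ℕ) : serCoeff a N 0 = 1 := by
  simp [serCoeff, ser]

theorem c_add (a : ℕ → A) (M N t : ℕ) :
    serCoeff a (M + N) t = ∑ p ∈ antidiagonal t, serCoeff a M p.1 * serCoeff a N p.2 := by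
  simp [serCoeff, pow_add, PowerSeries.coeff_mul]

end formulas

theorem sum_anti_assoc {M : Type*} [AddCommMonoid M] (F : ℕ → ℕ → ℕ → M) (n : ℕ) :
    ∑ p ∈ antidiagonal n, ∑ q ∈ antidiagonal p.1, F q.1 q.2 p.2 =
    ∑ p ∈ antidiagonal n, ∑ q ∈ antidiagonal p.2, F p.1 q.1 q.2 := by
  rw [Finset.sum_sigma', Finset.sum_sigma']
  refine Finset.sum_bij' (fun p _ => ⟨(p.2.1, p.2.2 + p.1.2), (p.2.2, p.1.2)⟩)
    (fun p _ => ⟨(p.1.1 + p.2.1, p.2.2), (p.1.1, p.2.1)⟩) ?_ ?_ ?_ ?_ ?_ <;>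
  · rintro ⟨⟨p, q⟩, ⟨x, y⟩⟩ h
    simp only [Finset.mem_sigma, HasAntidiagonal.mem_antidiagonal] at h
    obtain ⟨h1, h2⟩ := h
    subst h2
    first
      | rfl
      | (simp only [Finset.mem_sigma, HasAntidiagonal.mem_antidiagonal, and_true]; omega)

theorem sum_anti_four {M : Type*} [AddCommMonoid M] (F : ℕ → ℕ → ℕ → ℕ → M) (n : ℕ) :
    ∑ p ∈ antidiagonal n, ∑ q ∈ antidiagonal p.1, ∑ r ∈ antidiagonal p.2, F q.1 q.2 r.1 r.2 =
    ∑ p ∈ antidiagonal n, ∑ q ∈ antidiagonal p.1, ∑ r ∈ antidiagonal p.2, F q.1 r.1 q.2 r.2 := by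
  simp_rw [Finset.sum_sigma']
  refine Finset.sum_bij' (fun p _ => ⟨(p.2.1.1 + p.2.2.1, p.2.1.2 + p.2.2.2),
      ⟨(p.2.1.1, p.2.2.1), (p.2.1.2, p.2.2.2)⟩⟩)
    (fun p _ => ⟨(p.2.1.1 + p.2.2.1, p.2.1.2 + p.2.2.2),
      ⟨(p.2.1.1, p.2.2.1), (p.2.1.2, p.2.2.2)⟩⟩) ?_ ?_ ?_ ?_ ?_ <;>
  · rintro ⟨⟨p, q⟩, ⟨⟨x, y⟩, ⟨z, w⟩⟩⟩ h
    simp only [Finset.mem_sigma, HasAntidiagonal.mem_antidiagonal] at h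
    obtain ⟨h1, h2, h3⟩ := h
    subst h2 h3
    first
      | rfl
      | (simp only [Finset.mem_sigma, HasAntidiagonal.mem_antidiagonal, and_true]; omega)

section anti
variable {A : Type*} [Ring A]

/-- The values of the antipode on generators: `S(a_n) = - a_n - ∑_{m=1}^{n-1} S(a_m) Q_{n-m}^m(a)`. -/
def antipodeGen (s : ℕ) (a : ℕ → A) (n : ℕ) : A :=
  - a n - ∑ m ∈ (Finset.Ico 1 n).attach, antipodeGen s a m.1 * Qpoly s a m.1 (n - m.1)
termination_by n
decreasing_by exact (Finset.mem_Ico.mp m.2).2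

theorem anti_eq (s : ℕ) (a : ℕ → A) (n : ℕ) :
    antipodeGen s a n = - a n - ∑ m ∈ Finset.Ico 1 n, antipodeGen s a m * Qpoly s a m (n - m) := by
  rw [antipodeGen, Finset.sum_attach (Finset.Ico 1 n) (fun m => antipodeGen s a m * Qpoly s a m (n - m))]

/-- split of antidiagonal sums -/
theorem sum_anti_split {M : Type*} [AddCommMonoid M] (F : ℕ → ℕ → M) {n : ℕ} (hn : 1 ≤ n) :
    ∑ p ∈ antidiagonal n, F p.1 p.2 = F n 0 + F 0 n + ∑ m ∈ Finset.Ico 1 n, F m (n - m) := by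
  rw [Finset.Nat.sum_antidiagonal_eq_sum_range_succ F, Finset.sum_range_succ, Finset.range_eq_Ico,
    Finset.sum_eq_sum_Ico_succ_bot (by omega)]
  simp
  abel

theorem anti_left (s : ℕ) (a : ℕ → A) (n : ℕ) :
    ∑ p ∈ antidiagonal n, serCoeff (antipodeGen s a) 1 p.1 * serCoeff a (s * p.1 + 1) p.2 = if n = 0 then 1 else 0 := by
  rcases Nat.eq_zero_or_pos n with rfl | hn
  · simp [c_coeff_zero]
  · rw [sum_anti_split (fun i j => serCoeff (antipodeGen s a) 1 i * serCoeff a (s * i + 1) j) hn]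
    simp only [c_coeff_zero, mul_zero, zero_add, mul_one, one_mul]
    have h1 : ∑ m ∈ Finset.Ico 1 n, serCoeff (antipodeGen s a) 1 m * serCoeff a (s * m + 1) (n - m) =
        ∑ m ∈ Finset.Ico 1 n, antipodeGen s a m * Qpoly s a m (n - m) := by
      refine Finset.sum_congr rfl fun m hm => ?_
      rw [Finset.mem_Ico] at hm
      rw [c_one, if_neg (by omega), Q_eq _ _ _ (by omega)]
    rw [h1, c_one, c_one, if_neg hn.ne', if_neg hn.ne', if_neg hn.ne', anti_eq s a n]
    abel

theorem anti_left_pow (s : ℕ) (a : ℕ → A) (N n : ℕ) :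
    ∑ p ∈ antidiagonal n, serCoeff (antipodeGen s a) N p.1 * serCoeff a (s * p.1 + N) p.2 = if n = 0 then 1 else 0 := by
  induction N generalizing n with
  | zero =>
    rcases Nat.eq_zero_or_pos n with rfl | hn
    · simp [c_coeff_zero]
    · rw [if_neg hn.ne']
      refine Finset.sum_eq_zero fun p hp => ?_
      rw [c_zero]
      split_ifs with h
      · rw [HasAntidiagonal.mem_antidiagonal] at hp
        rw [h, mul_zero, add_zero, c_zero, if_neg (by omega), mul_zero]
      · simp
  | succ N ih =>
    have h1 : ∀ p ∈ antidiagonal n, serCoeff (antipodeGen s a) (N+1) p.1 * serCoeff a (s * p.1 + (N+1)) p.2 =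
      ∑ q ∈ antidiagonal p.1, ∑ r ∈ antidiagonal p.2,
        serCoeff (antipodeGen s a) N q.1 * (serCoeff (antipodeGen s a) 1 q.2 * serCoeff a (s * q.2 + 1) r.2) * serCoeff a (s * q.1 + N) r.1 := by
      intro p _
      rw [c_add, Finset.sum_mul]
      refine Finset.sum_congr rfl fun q hq => ?_
      rw [HasAntidiagonal.mem_antidiagonal] at hq
      rw [show s * p.1 + (N+1) = (s * q.2 + 1) + (s * q.1 + N) by rw [← hq]; ring, c_add,
        ← Finset.Nat.sum_antidiagonal_swap, Finset.mul_sum]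
      refine Finset.sum_congr rfl fun r hr => ?_
      simp [mul_assoc]
    rw [Finset.sum_congr rfl h1, ← sum_anti_four
      (fun i j i' j' => serCoeff (antipodeGen s a) N i * (serCoeff (antipodeGen s a) 1 i' * serCoeff a (s * i' + 1) j') * serCoeff a (s * i + N) j)]
    rw [← ih n]
    have h2 : ∀ p ∈ antidiagonal n, (∑ q ∈ antidiagonal p.1, ∑ r ∈ antidiagonal p.2,
        serCoeff (antipodeGen s a) N q.1 * (serCoeff (antipodeGen s a) 1 r.1 * serCoeff a (s * r.1 + 1) r.2) * serCoeff a (s * q.1 + N) q.2)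
        = if p.2 = 0 then ∑ q ∈ antidiagonal p.1, serCoeff (antipodeGen s a) N q.1 * serCoeff a (s * q.1 + N) q.2
          else 0 := by
      intro p _
      simp_rw [← Finset.sum_mul, ← Finset.mul_sum, anti_left]
      split_ifs <;> simp
    rw [Finset.sum_congr rfl h2]
    rw [Finset.sum_eq_single (n, 0)]
    · simp
    · rintro ⟨x, y⟩ h hne
      rw [HasAntidiagonal.mem_antidiagonal] at h
      rw [if_neg]
      rintro rfl
      exact hne (by simp at h ⊢; exact h)
    · simp

theorem anti_right (s : ℕ) (a : ℕ → A) (n : ℕ) :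
    ∑ p ∈ antidiagonal n, serCoeff a 1 p.1 * serCoeff (antipodeGen s a) (s * p.1 + 1) p.2 = if n = 0 then 1 else 0 := by
  set X : ℕ → A := fun n => ∑ p ∈ antidiagonal n, serCoeff a 1 p.1 * serCoeff (antipodeGen s a) (s * p.1 + 1) p.2 with hX
  have hR : ∀ n, ∑ p ∈ antidiagonal n, X p.1 * serCoeff a (s * p.1 + 1) p.2 = serCoeff a 1 n := by
    intro n
    have h1 : ∀ p ∈ antidiagonal n, X p.1 * serCoeff a (s * p.1 + 1) p.2 = ∑ q ∈ antidiagonal p.1,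
        serCoeff a 1 q.1 * (serCoeff (antipodeGen s a) (s * q.1 + 1) q.2 * serCoeff a (s * q.2 + (s * q.1 + 1)) p.2) := by
      intro p _
      rw [hX, Finset.sum_mul]
      refine Finset.sum_congr rfl fun q hq => ?_
      rw [HasAntidiagonal.mem_antidiagonal] at hq
      rw [show s * p.1 + 1 = s * q.2 + (s * q.1 + 1) by rw [← hq]; ring, mul_assoc]
    rw [Finset.sum_congr rfl h1, sum_anti_assoc (fun i j k => serCoeff a 1 i * (serCoeff (antipodeGen s a) (s * i + 1) j *
      serCoeff a (s * j + (s * i + 1)) k))]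
    simp_rw [← Finset.mul_sum, anti_left_pow]
    rw [Finset.sum_eq_single (n, 0)]
    · simp
    · rintro ⟨x, y⟩ h hne
      rw [HasAntidiagonal.mem_antidiagonal] at h
      rw [if_neg, mul_zero]
      rintro rfl
      exact hne (by simp at h ⊢; exact h)
    · simp
  change X n = _
  induction n using Nat.strong_induction_on with
  | _ n ih =>
    rcases Nat.eq_zero_or_pos n with rfl | hn
    · simpa [c_coeff_zero] using hR 0
    · have := hR n
      rw [sum_anti_split (fun i j => X i * serCoeff a (s * i + 1) j) hn, ih 0 hn,
        Finset.sum_eq_zero (s := Finset.Ico 1 n)] at this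
      · simpa [c_coeff_zero, hn.ne'] using this
      · intro m hm
        rw [Finset.mem_Ico] at hm
        rw [ih m hm.2, if_neg (by omega), zero_mul]
end anti


section hopf
variable {R A : Type*} [CommRing R] [Ring A] [Algebra R A]

/-- `a_n ⊗ 1 + 1 ⊗ a_n + ∑_{m=1}^{n-1} a_m ⊗ Q_{n-m}^m(a)`. -/
noncomputable def coprod (R : Type*) {A : Type*} [CommRing R] [Ring A] [Algebra R A]
    (s : ℕ) (a : ℕ → A) (n : ℕ) : A ⊗[R] A :=
  a n ⊗ₜ 1 + 1 ⊗ₜ a n + ∑ m ∈ Finset.Ico 1 n, a m ⊗ₜ Qpoly s a m (n - m)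

theorem coprod_eq (s : ℕ) (a : ℕ → A) {n : ℕ} (hn : 1 ≤ n) : coprod R s a n =
    ∑ p ∈ antidiagonal n, serCoeff a 1 p.1 ⊗ₜ serCoeff a (s * p.1 + 1) p.2 := by
  rw [sum_anti_split (fun i j => serCoeff a 1 i ⊗ₜ[R] serCoeff a (s * i + 1) j) hn, coprod]
  simp only [c_coeff_zero, mul_zero, zero_add, c_one, if_neg (show ¬ n = 0 by omega)]
  congr 1
  refine Finset.sum_congr rfl fun m hm => ?_
  rw [Finset.mem_Ico] at hm
  rw [if_neg (by omega), Q_eq _ _ _ (by omega)]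

variable {s : ℕ} {a : ℕ → A} {M : ℕ}

theorem comul_c (D : A →ₐ[R] A ⊗[R] A) (hD : ∀ n, 1 ≤ n → n ≤ M → D (a n) = coprod R s a n)
    (N : ℕ) {t : ℕ} (ht : t ≤ M) :
    D (serCoeff a N t) = ∑ p ∈ antidiagonal t, serCoeff a N p.1 ⊗ₜ serCoeff a (s * p.1 + N) p.2 := by
  induction N generalizing t with
  | zero =>
    rw [Finset.sum_eq_single (0, t)]
    · simp only [c_zero, if_true, mul_zero, zero_add]
      split_ifs <;> simp [Algebra.TensorProduct.one_def]
    · rintro ⟨x, y⟩ h hne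
      rw [HasAntidiagonal.mem_antidiagonal] at h
      rw [c_zero, if_neg, TensorProduct.zero_tmul]
      rintro rfl
      exact hne (by simp at h ⊢; exact h)
    · simp
  | succ N ih =>
    have h1 : ∀ n, n ≤ M → D (serCoeff a 1 n) =
        ∑ p ∈ antidiagonal n, serCoeff a 1 p.1 ⊗ₜ serCoeff a (s * p.1 + 1) p.2 := by
      intro n hn
      rcases Nat.eq_zero_or_pos n with rfl | h0
      · simp [c_coeff_zero, Algebra.TensorProduct.one_def]
      · rw [← coprod_eq s a h0, ← hD n h0 hn, c_one, if_neg h0.ne']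
    rw [c_add, map_sum]
    have h2 : ∀ p ∈ antidiagonal t, D (serCoeff a N p.1 * serCoeff a 1 p.2) =
        ∑ q ∈ antidiagonal p.1, ∑ r ∈ antidiagonal p.2, (serCoeff a N q.1 * serCoeff a 1 r.1) ⊗ₜ[R]
          (serCoeff a (s * q.1 + N) q.2 * serCoeff a (s * r.1 + 1) r.2) := by
      intro p hp
      rw [HasAntidiagonal.mem_antidiagonal] at hp
      rw [map_mul, ih (by omega), h1 _ (by omega), Finset.sum_mul_sum]
      simp
    rw [Finset.sum_congr rfl h2, sum_anti_four (fun i j i' j' => (serCoeff a N i * serCoeff a 1 i') ⊗ₜ[R]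
          (serCoeff a (s * i + N) j * serCoeff a (s * i' + 1) j'))]
    refine Finset.sum_congr rfl fun p hp => ?_
    rw [c_add, TensorProduct.sum_tmul]
    refine Finset.sum_congr rfl fun q hq => ?_
    rw [HasAntidiagonal.mem_antidiagonal] at hq
    rw [show s * p.1 + (N + 1) = (s * q.1 + N) + (s * q.2 + 1) by rw [← hq]; ring, c_add,
      TensorProduct.tmul_sum]

theorem coassoc_gen (D : A →ₐ[R] A ⊗[R] A)
    (hD : ∀ n, 1 ≤ n → n ≤ M → D (a n) = coprod R s a n) {n : ℕ} (hn : 1 ≤ n) (hM : n ≤ M) :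
    Algebra.TensorProduct.assoc R R R A A A (Algebra.TensorProduct.map D (.id R A) (D (a n)))
      = Algebra.TensorProduct.map (.id R A) D (D (a n)) := by
  rw [hD n hn hM, coprod_eq s a hn]
  simp only [map_sum, Algebra.TensorProduct.map_tmul, AlgHom.coe_id, id_eq]
  have h1 : ∀ p ∈ antidiagonal n, (Algebra.TensorProduct.assoc R R R A A A)
      (D (serCoeff a 1 p.1) ⊗ₜ[R] serCoeff a (s * p.1 + 1) p.2) = ∑ q ∈ antidiagonal p.1,
        serCoeff a 1 q.1 ⊗ₜ (serCoeff a (s * q.1 + 1) q.2 ⊗ₜ serCoeff a (s * q.2 + (s * q.1 + 1)) p.2) := by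
    intro p hp
    rw [HasAntidiagonal.mem_antidiagonal] at hp
    rw [comul_c D hD 1 (by omega), TensorProduct.sum_tmul, map_sum]
    refine Finset.sum_congr rfl fun q hq => ?_
    rw [HasAntidiagonal.mem_antidiagonal] at hq
    rw [Algebra.TensorProduct.assoc_tmul,
      show s * p.1 + 1 = s * q.2 + (s * q.1 + 1) by rw [← hq]; ring]
  rw [Finset.sum_congr rfl h1, sum_anti_assoc (fun i j k =>
    serCoeff a 1 i ⊗ₜ[R] (serCoeff a (s * i + 1) j ⊗ₜ[R] serCoeff a (s * j + (s * i + 1)) k))]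
  refine Finset.sum_congr rfl fun p hp => ?_
  rw [HasAntidiagonal.mem_antidiagonal] at hp
  rw [comul_c D hD _ (by omega), TensorProduct.tmul_sum]

theorem antihom_c (S : A →ₗ[R] A) (h1 : S 1 = 1) (hm : ∀ x y, S (x * y) = S y * S x)
    (hS : ∀ n, 1 ≤ n → n ≤ M → S (a n) = antipodeGen s a n) (N : ℕ) {t : ℕ} (ht : t ≤ M) :
    S (serCoeff a N t) = serCoeff (antipodeGen s a) N t := by
  induction N generalizing t with
  | zero => simp only [c_zero]; split_ifs <;> simp [h1]
  | succ N ih =>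
    have hc : ∀ n, n ≤ M → S (serCoeff a 1 n) = serCoeff (antipodeGen s a) 1 n := by
      intro n hn
      simp only [c_one]
      split_ifs with h
      · exact h1
      · exact hS n (by omega) hn
    rw [c_add, add_comm N 1, c_add, map_sum, ← Finset.Nat.sum_antidiagonal_swap]
    refine Finset.sum_congr rfl fun p hp => ?_
    rw [HasAntidiagonal.mem_antidiagonal] at hp
    rw [hm]
    simp only [Prod.fst_swap, Prod.snd_swap]
    rw [ih (by omega), hc _ (by omega)]

theorem antipode_gen_left (S : A →ₗ[R] A) (h1 : S 1 = 1) (hm : ∀ x y, S (x * y) = S y * S x)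
    (hS : ∀ n, 1 ≤ n → n ≤ M → S (a n) = antipodeGen s a n) {n : ℕ} (hn : 1 ≤ n) (hM : n ≤ M) :
    LinearMap.mul' R A (S.rTensor A (coprod R s a n)) = 0 := by
  rw [coprod_eq s a hn]
  simp only [map_sum, LinearMap.rTensor_tmul, LinearMap.mul'_apply]
  rw [← (anti_left s a n).trans (if_neg (by omega))]
  refine Finset.sum_congr rfl fun p hp => ?_
  rw [HasAntidiagonal.mem_antidiagonal] at hp
  rw [antihom_c S h1 hm hS _ (by omega)]

theorem antipode_gen_right (S : A →ₗ[R] A) (h1 : S 1 = 1) (hm : ∀ x y, S (x * y) = S y * S x)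
    (hS : ∀ n, 1 ≤ n → n ≤ M → S (a n) = antipodeGen s a n) {n : ℕ} (hn : 1 ≤ n) (hM : n ≤ M) :
    LinearMap.mul' R A (S.lTensor A (coprod R s a n)) = 0 := by
  rw [coprod_eq s a hn]
  simp only [map_sum, LinearMap.lTensor_tmul, LinearMap.mul'_apply]
  rw [← (anti_right s a n).trans (if_neg (by omega))]
  refine Finset.sum_congr rfl fun p hp => ?_
  rw [HasAntidiagonal.mem_antidiagonal] at hp
  rw [antihom_c S h1 hm hS _ (by omega)]

/-- The antipode identities propagate from generators to products. -/
theorem antipode_mul_left (S : A →ₗ[R] A) (hm : ∀ x y, S (x * y) = S y * S x)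
    (t t' : A ⊗[R] A) (r : R) (h : LinearMap.mul' R A (S.rTensor A t) = algebraMap R A r) :
    LinearMap.mul' R A (S.rTensor A (t * t')) = r • LinearMap.mul' R A (S.rTensor A t') := by
  induction t' with
  | zero => simp
  | add x y hx hy => simp [mul_add, hx, hy]
  | tmul x y =>
    have : ∀ t : A ⊗[R] A, LinearMap.mul' R A (S.rTensor A (t * (x ⊗ₜ[R] y))) =
        S x * LinearMap.mul' R A (S.rTensor A t) * y := by
      intro t
      induction t with
      | zero => simp
      | add x y hx hy => simp [mul_add, add_mul, hx, hy]
      | tmul u v => simp [hm, mul_assoc]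
    rw [this, h, ← Algebra.commutes, mul_assoc, ← Algebra.smul_def]
    simp

theorem antipode_mul_right (S : A →ₗ[R] A) (hm : ∀ x y, S (x * y) = S y * S x)
    (t t' : A ⊗[R] A) (r : R) (h : LinearMap.mul' R A (S.lTensor A t') = algebraMap R A r) :
    LinearMap.mul' R A (S.lTensor A (t * t')) = r • LinearMap.mul' R A (S.lTensor A t) := by
  induction t with
  | zero => simp
  | add x y hx hy => simp [add_mul, hx, hy]
  | tmul x y =>
    have : ∀ t : A ⊗[R] A, LinearMap.mul' R A (S.lTensor A ((x ⊗ₜ[R] y) * t)) =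
        x * LinearMap.mul' R A (S.lTensor A t) * S y := by
      intro t
      induction t with
      | zero => simp
      | add x y hx hy => simp [mul_add, add_mul, hx, hy]
      | tmul u v => simp [hm, mul_assoc]
    rw [this, h, ← Algebra.commutes, mul_assoc, ← Algebra.smul_def]
    simp
end hopf

theorem Idx.le_of_le {s : ℕ} {ν : ℕ∞} (i : Idx s ν) {m : ℕ} (hm : m ≤ i.n) :
    ((s * m : ℕ) : ℕ∞) ≤ ν :=
  le_trans (by exact_mod_cast Nat.mul_le_mul_left s hm) i.le

theorem extend_of_le {A : Type*} [Semiring A] {s : ℕ} {ν : ℕ∞} (f : Idx s ν → A) (i : Idx s ν)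
    {m : ℕ} (h1 : 1 ≤ m) (hm : m ≤ i.n) : extend f m = f ⟨m, h1, i.le_of_le hm⟩ := by
  rw [extend, dif_pos ⟨h1, i.le_of_le hm⟩]

theorem extend_self {A : Type*} [Semiring A] {s : ℕ} {ν : ℕ∞} (f : Idx s ν → A) (i : Idx s ν) :
    extend f i.n = f i := extend_of_le f i i.pos le_rfl

section noncomm
variable (R : Type*) [CommRing R] (s : ℕ) (ν : ℕ∞)

/-- The algebra of non-commutative polynomials in the `a_n`. With the Hopf structure below it is
`H_ν` for `s = 1` and `K_ν` for `s = 2` (over the ring `R`). -/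
abbrev NCH := FreeAlgebra R (Idx s ν)

noncomputable abbrev gen : Idx s ν → NCH R s ν := FreeAlgebra.ι R

noncomputable def ncComul : NCH R s ν →ₐ[R] NCH R s ν ⊗[R] NCH R s ν :=
  FreeAlgebra.lift R fun i => coprod R s (extend (gen R s ν)) i.n

noncomputable def ncCounit : NCH R s ν →ₐ[R] R := FreeAlgebra.lift R fun _ => 0

noncomputable def ncAntipodeOp : NCH R s ν →ₐ[R] (NCH R s ν)ᵐᵒᵖ :=
  FreeAlgebra.lift R fun i => MulOpposite.op (antipodeGen s (extend (gen R s ν)) i.n)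

noncomputable def ncAntipode : NCH R s ν →ₗ[R] NCH R s ν :=
  (MulOpposite.opLinearEquiv R).symm.toLinearMap ∘ₗ (ncAntipodeOp R s ν).toLinearMap

variable {R s ν}

theorem ncComul_gen (i : Idx s ν) (n : ℕ) (h1 : 1 ≤ n) (hn : n ≤ i.n) :
    ncComul R s ν (extend (gen R s ν) n) = coprod R s (extend (gen R s ν)) n := by
  rw [extend_of_le _ i h1 hn, ncComul, FreeAlgebra.lift_ι_apply]

theorem ncAntipode_gen (i : Idx s ν) (n : ℕ) (h1 : 1 ≤ n) (hn : n ≤ i.n) :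
    ncAntipode R s ν (extend (gen R s ν) n) = antipodeGen s (extend (gen R s ν)) n := by
  rw [extend_of_le _ i h1 hn]
  simp [ncAntipode, ncAntipodeOp]

theorem ncAntipode_one : ncAntipode R s ν 1 = 1 := by simp [ncAntipode]
theorem ncAntipode_mul (x y : NCH R s ν) :
    ncAntipode R s ν (x * y) = ncAntipode R s ν y * ncAntipode R s ν x := by simp [ncAntipode]

theorem counit_extend (n : ℕ) : ncCounit R s ν (extend (gen R s ν) n) = 0 := by
  rw [extend]; split_ifs <;> simp [ncCounit]

theorem map_Q_zero {A B : Type*} [Semiring A] [Semiring B] (f : A →+* B) (s : ℕ) (a : ℕ → A)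
    (h : ∀ n, f (a n) = 0) (l t : ℕ) : f (Qpoly s a l t) = 0 := by
  rw [Qpoly, map_sum]
  refine Finset.sum_eq_zero fun k hk => ?_
  rw [Finset.mem_Icc] at hk
  obtain ⟨k, rfl⟩ : ∃ k', k = k' + 1 := ⟨k - 1, by omega⟩
  rw [map_mul, compSum, map_sum, Finset.sum_eq_zero (s := Finset.filter _ _), mul_zero]
  intro j _
  rw [List.ofFn_succ, List.prod_cons, map_mul, h, zero_mul]

/-- The Hopf algebra structure with `Δ(a_n) = coprod`, `ε(a_n) = 0`, and the antipode given on
generators by the recursion `antipodeGen`. -/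
noncomputable instance : HopfAlgebra R (NCH R s ν) :=
  letI : Bialgebra R (NCH R s ν) := Bialgebra.ofAlgHom (ncComul R s ν) (ncCounit R s ν)
    (by
      ext i
      have := coassoc_gen (ncComul R s ν) (ncComul_gen i) i.pos le_rfl
      simpa [extend_self] using this)
    (by
      ext i
      have h := ncComul_gen (R := R) i i.n i.pos le_rfl
      have hi := counit_extend (R := R) (s := s) (ν := ν) i.n
      rw [extend_self] at h hi
      simp only [Function.comp_apply, AlgHom.coe_comp]
      rw [show FreeAlgebra.ι R i = gen R s ν i from rfl, h, coprod]
      simp [counit_extend, extend_self, hi])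
    (by
      ext i
      have h := ncComul_gen (R := R) i i.n i.pos le_rfl
      rw [extend_self] at h
      simp only [Function.comp_apply, AlgHom.coe_comp]
      rw [show FreeAlgebra.ι R i = gen R s ν i from rfl, h, coprod]
      have hQ := map_Q_zero (ncCounit R s ν : NCH R s ν →+* R) s _ counit_extend
      have hi := counit_extend (R := R) (s := s) (ν := ν) i.n
      rw [extend_self] at hi
      simp only [RingHom.coe_coe] at hQ
      simp [extend_self, hQ, hi])
  { antipode := ncAntipode R s ν
    mul_antipode_rTensor_comul := by
      ext x
      change LinearMap.mul' R _ ((ncAntipode R s ν).rTensor _ (ncComul R s ν x)) =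
        algebraMap R _ (ncCounit R s ν x)
      induction x using FreeAlgebra.induction with
      | grade0 r => simp [Algebra.TensorProduct.algebraMap_apply, ncAntipode]
      | grade1 i =>
        have h := ncComul_gen (R := R) i i.n i.pos le_rfl
        rw [extend_self] at h
        rw [show FreeAlgebra.ι R i = gen R s ν i from rfl, h, antipode_gen_left (M := i.n) _
          ncAntipode_one ncAntipode_mul (ncAntipode_gen i) i.pos le_rfl]
        simp [ncCounit]
      | mul x y hx hy =>
        rw [map_mul, antipode_mul_left _ ncAntipode_mul _ _ _ hx, hy, map_mul, map_mul,
          Algebra.smul_def]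
      | add x y hx hy => simp only [map_add, hx, hy]
    mul_antipode_lTensor_comul := by
      ext x
      change LinearMap.mul' R _ ((ncAntipode R s ν).lTensor _ (ncComul R s ν x)) =
        algebraMap R _ (ncCounit R s ν x)
      induction x using FreeAlgebra.induction with
      | grade0 r => simp [Algebra.TensorProduct.algebraMap_apply, ncAntipode_one]
      | grade1 i =>
        have h := ncComul_gen (R := R) i i.n i.pos le_rfl
        rw [extend_self] at h
        rw [show FreeAlgebra.ι R i = gen R s ν i from rfl, h, antipode_gen_right (M := i.n) _
          ncAntipode_one ncAntipode_mul (ncAntipode_gen i) i.pos le_rfl]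
        simp [ncCounit]
      | mul x y hx hy =>
        rw [map_mul, antipode_mul_right _ ncAntipode_mul _ _ _ hy, hx, map_mul, map_mul,
          Algebra.smul_def, Algebra.commutes]
      | add x y hx hy => simp only [map_add, hx, hy] }
end noncomm

section comm
variable (R : Type*) [CommRing R] (s : ℕ) (ν : ℕ∞)

noncomputable abbrev mvX : Idx s ν → MvPolynomial (Idx s ν) R := MvPolynomial.X

noncomputable def fgComul : MvPolynomial (Idx s ν) R →ₐ[R] MvPolynomial (Idx s ν) R ⊗[R] MvPolynomial (Idx s ν) R :=
  MvPolynomial.aeval fun i => coprod R s (extend (mvX R s ν)) i.n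

noncomputable def fgCounit : MvPolynomial (Idx s ν) R →ₐ[R] R := MvPolynomial.aeval fun _ => 0

noncomputable def fgAntipode : MvPolynomial (Idx s ν) R →ₐ[R] MvPolynomial (Idx s ν) R :=
  MvPolynomial.aeval fun i => antipodeGen s (extend (mvX R s ν)) i.n

variable {R s ν}

theorem fgComul_coord (i : Idx s ν) (n : ℕ) (h1 : 1 ≤ n) (hn : n ≤ i.n) :
    fgComul R s ν (extend (mvX R s ν) n) = coprod R s (extend (mvX R s ν)) n := by
  rw [extend_of_le _ i h1 hn, fgComul, MvPolynomial.aeval_X]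

theorem fgAntipode_coord (i : Idx s ν) (n : ℕ) (h1 : 1 ≤ n) (hn : n ≤ i.n) :
    (fgAntipode R s ν).toLinearMap (extend (mvX R s ν) n) = antipodeGen s (extend (mvX R s ν)) n := by
  rw [extend_of_le _ i h1 hn, AlgHom.toLinearMap_apply, fgAntipode, MvPolynomial.aeval_X]

theorem fgCounit_extend (n : ℕ) : fgCounit R s ν (extend (mvX R s ν) n) = 0 := by
  rw [extend]; split_ifs <;> simp [fgCounit]

/-- The Hopf algebra structure with `Δ(a_n) = coprod`, `ε(a_n) = 0`, and the antipode given on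
generators by the recursion `antipodeGen`. -/
noncomputable abbrev fgHopf : HopfAlgebra R (MvPolynomial (Idx s ν) R) :=
  letI : Bialgebra R (MvPolynomial (Idx s ν) R) := Bialgebra.ofAlgHom (fgComul R s ν) (fgCounit R s ν)
    (by
      ext i : 1
      have := coassoc_gen (fgComul R s ν) (fgComul_coord i) i.pos le_rfl
      simpa [extend_self] using this)
    (by
      ext i : 1
      have h := fgComul_coord (R := R) i i.n i.pos le_rfl
      have hi := fgCounit_extend (R := R) (s := s) (ν := ν) i.n
      rw [extend_self] at h hi
      simp only [AlgHom.coe_comp, Function.comp_apply]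
      rw [show MvPolynomial.X i = mvX R s ν i from rfl, h, coprod]
      simp [fgCounit_extend, extend_self, hi])
    (by
      ext i : 1
      have h := fgComul_coord (R := R) i i.n i.pos le_rfl
      have hQ := map_Q_zero (fgCounit R s ν : MvPolynomial (Idx s ν) R →+* R) s _ fgCounit_extend
      have hi := fgCounit_extend (R := R) (s := s) (ν := ν) i.n
      rw [extend_self] at h hi
      simp only [RingHom.coe_coe] at hQ
      simp only [AlgHom.coe_comp, Function.comp_apply]
      rw [show MvPolynomial.X i = mvX R s ν i from rfl, h, coprod]
      simp [extend_self, hQ, hi])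
  { antipode := (fgAntipode R s ν).toLinearMap
    mul_antipode_rTensor_comul := by
      refine LinearMap.ext fun x => ?_
      change LinearMap.mul' R _ ((fgAntipode R s ν).toLinearMap.rTensor _ (fgComul R s ν x)) =
        algebraMap R _ (fgCounit R s ν x)
      induction x using MvPolynomial.induction_on with
      | C r => 
        rw [← MvPolynomial.algebraMap_eq, AlgHom.commutes, AlgHom.commutes]
        simp [Algebra.TensorProduct.algebraMap_apply]
      | add x y hx hy => simp only [map_add, hx, hy]
      | mul_X x i hx =>
        have h := fgComul_coord (R := R) i i.n i.pos le_rfl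
        have hi := fgCounit_extend (R := R) (s := s) (ν := ν) i.n
        rw [extend_self] at h hi
        rw [map_mul, antipode_mul_left _ (fun x y => by simp [mul_comm]) _ _ _ hx,
          show MvPolynomial.X i = mvX R s ν i from rfl, h, antipode_gen_left (M := i.n) _
          (by simp) (fun x y => by simp [mul_comm]) (fgAntipode_coord i) i.pos le_rfl, map_mul, hi]
        simp
    mul_antipode_lTensor_comul := by
      refine LinearMap.ext fun x => ?_
      change LinearMap.mul' R _ ((fgAntipode R s ν).toLinearMap.lTensor _ (fgComul R s ν x)) =
        algebraMap R _ (fgCounit R s ν x)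
      induction x using MvPolynomial.induction_on with
      | C r =>
        rw [← MvPolynomial.algebraMap_eq, AlgHom.commutes, AlgHom.commutes]
        simp [Algebra.TensorProduct.algebraMap_apply]
      | add x y hx hy => simp only [map_add, hx, hy]
      | mul_X x i hx =>
        have h := fgComul_coord (R := R) i i.n i.pos le_rfl
        have hi := fgCounit_extend (R := R) (s := s) (ν := ν) i.n
        rw [extend_self] at h hi
        rw [mul_comm, map_mul, antipode_mul_right _ (fun x y => by simp [mul_comm]) _ _ _ hx,
          show MvPolynomial.X i = mvX R s ν i from rfl, h, antipode_gen_right (M := i.n) _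
          (by simp) (fun x y => by simp [mul_comm]) (fgAntipode_coord i) i.pos le_rfl, map_mul, hi]
        simp }

variable (R s ν)

/-- The function algebra of the algebraic group of truncated formal diffeomorphisms
`x + ∑ a_n x^{s n + 1}` (odd ones if `s = 2`): commutative polynomials in the coordinates `a_n`. With
the coproduct below, the convolution product of two points is the composition of the series
(modulo the coefficients of weight greater than `ν`). -/
def FG := MvPolynomial (Idx s ν) R

noncomputable instance : CommRing (FG R s ν) := inferInstanceAs (CommRing (MvPolynomial (Idx s ν) R))

noncomputable instance : HopfAlgebra R (FG R s ν) := fgHopf (R := R) (s := s) (ν := ν)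

/-- The coordinate function `a_n`. -/
noncomputable def coord (i : Idx s ν) : FG R s ν := mvX R s ν i

theorem comul_coord (i : Idx s ν) : Coalgebra.comul (R := R) (coord R s ν i) =
    coprod R s (extend (coord R s ν)) i.n := MvPolynomial.aeval_X _ _

theorem comul_gen (i : Idx s ν) : Coalgebra.comul (R := R) (gen R s ν i) =
    coprod R s (extend (gen R s ν)) i.n := FreeAlgebra.lift_ι_apply _ _

/-- The elements of weight `m`. -/
noncomputable def fgWeight (m : ℕ) : Submodule R (FG R s ν) :=
  MvPolynomial.weightedHomogeneousSubmodule R (fun i : Idx s ν => s * i.n) m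
end comm

section drinfeld

/-- The iterated coproduct `Δ^n : H → H^{⊗ n}`, with `Δ^0 = ε`, `Δ^1 = id`. -/
noncomputable def iterComul (R H : Type*) [CommRing R] [Ring H] [HopfAlgebra R H] :
    (n : ℕ) → H →ₗ[R] ⨂[R]^n H
  | 0 => TensorPower.algebraMap₀.toLinearMap ∘ₗ Coalgebra.counit
  | n + 1 => TensorPower.mulEquiv.toLinearMap ∘ₗ
      TensorProduct.map (iterComul R H n)
        (PiTensorProduct.subsingletonEquiv (0 : Fin 1)).symm.toLinearMap ∘ₗ
      Coalgebra.comul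

/-- `δ_n = (id - u ∘ ε)^{⊗ n} ∘ Δ^n`. -/
noncomputable def delta (R H : Type*) [CommRing R] [Ring H] [HopfAlgebra R H] (n : ℕ) :
    H →ₗ[R] ⨂[R]^n H :=
  PiTensorProduct.map (fun _ => LinearMap.id - Algebra.linearMap R H ∘ₗ Coalgebra.counit) ∘ₗ
    iterComul R H n

variable (k : Type u) [Field k] (s : ℕ) (ν : ℕ∞)

/-- `H(ħ) = k(ħ) ⊗ H`, a Hopf algebra over `k(ħ)`. -/
abbrev HK := NCH (RatFunc k) s ν

/-- The deformation parameter `ħ`, as an element of `k(ħ)`. -/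
noncomputable abbrev hbar : RatFunc k := RatFunc.X

/-- The inclusion `H → H(ħ)`. -/
noncomputable def incl : NCH k s ν →ₐ[k] HK k s ν := FreeAlgebra.lift k (gen (RatFunc k) s ν)

/-- The augmentation ideal `J = Ker ε` of `H`. -/
noncomputable def augIdeal : Ideal (NCH k s ν) := RingHom.ker (Bialgebra.counitAlgHom k (NCH k s ν))

/-- `H_ħ^∨ = ∑_{n ≥ 0} k[ħ] ħ^{-n} J^n`, inside `H(ħ)`. -/
noncomputable def rees : Submodule k[X] (HK k s ν) :=
  Submodule.span k[X] {y | ∃ n : ℕ, ∃ j ∈ augIdeal k s ν ^ n, y = ((hbar k) ^ n)⁻¹ • incl k s ν j}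

/-- `M^{⊗ n}` (over `k[ħ]`) for a `k[ħ]`-submodule `M` of `H(ħ)`, realized inside the `n`-th tensor power
of `H(ħ)` over `k(ħ)`. As `M` is torsion free, hence flat over the principal ideal domain `k[ħ]`,
the natural map from the abstract tensor power to `H(ħ)^{⊗ n}` is injective, with this image. -/
noncomputable def tensorOrder {k : Type u} [Field k] {s : ℕ} {ν : ℕ∞}
    (M : Submodule k[X] (HK k s ν)) (n : ℕ) : Submodule k[X] (⨂[RatFunc k]^n (HK k s ν)) :=
  Submodule.span k[X] {t | ∃ v : Fin n → HK k s ν, (∀ i, v i ∈ M) ∧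
    t = PiTensorProduct.tprod (RatFunc k) v}

/-- `(H_ħ^∨)' = {η ∈ H_ħ^∨ | δ_n(η) ∈ ħ^n (H_ħ^∨)^{⊗ n} for all n}`. -/
noncomputable def drinfeld : Submodule k[X] (HK k s ν) where
  carrier := {η | η ∈ rees k s ν ∧ ∀ n : ℕ, ∃ ξ ∈ tensorOrder (rees k s ν) n,
    delta (RatFunc k) (HK k s ν) n η = ((Polynomial.X : k[X]) ^ n) • ξ}
  zero_mem' := ⟨zero_mem _, fun n => ⟨0, zero_mem _, by simp⟩⟩
  add_mem' := by
    rintro a b ⟨ha, ha'⟩ ⟨hb, hb'⟩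
    refine ⟨add_mem ha hb, fun n => ?_⟩
    obtain ⟨x, hx, hx'⟩ := ha' n
    obtain ⟨y, hy, hy'⟩ := hb' n
    exact ⟨x + y, add_mem hx hy, by rw [map_add, hx', hy', smul_add]⟩
  smul_mem' := by
    rintro r a ⟨ha, ha'⟩
    refine ⟨Submodule.smul_mem _ r ha, fun n => ?_⟩
    obtain ⟨x, hx, hx'⟩ := ha' n
    refine ⟨r • x, Submodule.smul_mem _ r hx, ?_⟩
    rw [← algebraMap_smul (RatFunc k) r a, map_smul, hx', algebraMap_smul, smul_comm]

/-- The free Lie algebra `L_ν` on the `x_n`. -/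
abbrev FL := FreeLieAlgebra k (Idx s ν)

open Classical in
/-- The generator `x_n` of `L_ν`, and zero if `n` is not an index. -/
noncomputable def freeGen (n : ℕ) : FL k s ν :=
  if h : 1 ≤ n ∧ ((s * n : ℕ) : ℕ∞) ≤ ν then FreeLieAlgebra.of k ⟨n, h.1, h.2⟩ else 0

attribute [local instance] LieRing.ofAssociativeRing in
/-- The map `L_ν → H_ħ^∨ ⊆ H(ħ)` of Lie algebras with `x_n ↦ ħ^{-1} a_n`. -/
noncomputable def lieIncl : FL k s ν →ₗ[k] HK k s ν :=
  (FreeLieAlgebra.lift k (fun i => (hbar k)⁻¹ • gen (RatFunc k) s ν i) :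
    FL k s ν →ₗ⁅k⁆ HK k s ν).toLinearMap

/-- `IsLieMonomial k w x`: `x` is a Lie monomial in the `x_n`, of weight `w`. -/
inductive IsLieMonomial (k : Type u) [Field k] {s : ℕ} {ν : ℕ∞} : ℕ → FL k s ν → Prop
  | of (i : Idx s ν) : IsLieMonomial k (s * i.n) (FreeLieAlgebra.of k i)
  | lie {p q : ℕ} {x y : FL k s ν} : IsLieMonomial k p x → IsLieMonomial k q y →
      IsLieMonomial k (p + q) ⁅x, y⁆

/-- The relations `[b_i, b_j] = ħ [b_i, b_j]_L`, the bracket of `L_ν` on the right being expanded in the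
basis `b`. -/
inductive PresRel {k : Type u} [Field k] {s : ℕ} {ν : ℕ∞} {ι : Type v}
    (b : Module.Basis ι k (FL k s ν)) : FreeAlgebra k[X] ι → FreeAlgebra k[X] ι → Prop
  | comm (i j : ι) : PresRel b
      (FreeAlgebra.ι k[X] i * FreeAlgebra.ι k[X] j - FreeAlgebra.ι k[X] j * FreeAlgebra.ι k[X] i)
      ((Polynomial.X : k[X]) • (b.repr ⁅b i, b j⁆).sum fun l r => r • FreeAlgebra.ι k[X] l)

variable {k s ν}

/-- The elements of weight `w` of the free algebra: the span of the words of weight `w`. -/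
noncomputable def weightPart (R : Type*) [CommRing R] (s : ℕ) (ν : ℕ∞) (w : ℕ) : Submodule R (NCH R s ν) :=
  Submodule.span R {y | ∃ l : List (Idx s ν), (l.map fun i => s * i.n).sum = w ∧
    y = (l.map (gen R s ν)).prod}

/-- The elements of weight `w` of `A`. -/
noncomputable def orderPart (A : Subalgebra k[X] (HK k s ν)) (w : ℕ) : Submodule k[X] (HK k s ν) :=
  Subalgebra.toSubmodule A ⊓ (weightPart (RatFunc k) s ν w).restrictScalars k[X]

/-- `A` is a graded Hopf `k[ħ]`-subalgebra of `H(ħ)` (with respect to the weight): it is the sum of its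
weight parts, and the counit, the coproduct and the antipode restrict to it, compatibly with the
weights; `A ⊗ A` is seen inside `H(ħ) ⊗ H(ħ)`. -/
structure IsGradedHopfOrder (A : Subalgebra k[X] (HK k s ν)) : Prop where
  graded : ∀ x ∈ A, x ∈ ⨆ w, orderPart A w
  counit : ∀ x ∈ A, ∃ r : k[X], (Coalgebra.counit x : RatFunc k) = algebraMap k[X] (RatFunc k) r
  comul : ∀ w, ∀ x ∈ orderPart A w, Coalgebra.comul (R := RatFunc k) x ∈
    Submodule.span k[X] {t : HK k s ν ⊗[RatFunc k] HK k s ν | ∃ i j, i + j = w ∧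
      ∃ y ∈ orderPart A i, ∃ z ∈ orderPart A j, t = y ⊗ₜ[RatFunc k] z}
  antipode : ∀ w, ∀ x ∈ orderPart A w, HopfAlgebra.antipode (RatFunc k) x ∈ orderPart A w

/-- `j : H → A` is an injective morphism of graded Hopf algebras. The lists write the coproduct of an
element as a sum of pure tensors. -/
structure IsHopfEmbedding (A : Subalgebra k[X] (HK k s ν)) (j : NCH k s ν →ₐ[k] A) : Prop where
  injective : Function.Injective j
  graded : ∀ w, ∀ x ∈ weightPart k s ν w, (j x : HK k s ν) ∈ weightPart (RatFunc k) s ν w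
  counit : ∀ x, (Coalgebra.counit (j x : HK k s ν) : RatFunc k) =
    algebraMap k (RatFunc k) (Coalgebra.counit x)
  comul : ∀ (x : NCH k s ν) (l : List (NCH k s ν × NCH k s ν)),
    Coalgebra.comul (R := k) x = (l.map fun p => p.1 ⊗ₜ[k] p.2).sum →
    Coalgebra.comul (R := RatFunc k) (j x : HK k s ν) =
      (l.map fun p => (j p.1 : HK k s ν) ⊗ₜ[RatFunc k] (j p.2 : HK k s ν)).sum
  antipode : ∀ x, HopfAlgebra.antipode (RatFunc k) (j x : HK k s ν) = j (HopfAlgebra.antipode k x)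

end drinfeld

section poisson

/-- A Poisson bracket on a commutative algebra. -/
structure PoissonBracket (k : Type u) (A : Type v) [CommRing k] [CommRing A] [Algebra k A] where
  br : A →ₗ[k] A →ₗ[k] A
  self : ∀ a, br a a = 0
  jacobi : ∀ a b c, br a (br b c) + br b (br c a) + br c (br a b) = 0
  leibniz : ∀ a b c, br a (b * c) = br a b * c + b * br a c

variable {k : Type u} [CommRing k] {A : Type v} [CommRing A]

/-- The bracket `{a ⊗ b, c ⊗ d} = {a, c} ⊗ b d + a c ⊗ {b, d}` on `A ⊗ A`. -/
noncomputable def PoissonBracket.tensor [Algebra k A] (P : PoissonBracket k A) :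
    A ⊗[k] A →ₗ[k] A ⊗[k] A →ₗ[k] A ⊗[k] A :=
  TensorProduct.map₂ P.br (LinearMap.mul k A) + TensorProduct.map₂ (LinearMap.mul k A) P.br

/-- The coproduct is a morphism of Poisson algebras. -/
def PoissonBracket.IsPoissonHopf [HopfAlgebra k A] (P : PoissonBracket k A) : Prop :=
  ∀ a b, Coalgebra.comul (R := k) (P.br a b) =
    P.tensor (Coalgebra.comul (R := k) a) (Coalgebra.comul (R := k) b)

/-- `A` is the free Poisson algebra on the family `x`. -/
def PoissonBracket.FreelyGeneratedBy [Algebra k A] (P : PoissonBracket k A) {I : Type*} (x : I → A) :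
    Prop :=
  ∀ (B : Type w) [CommRing B] [Algebra k B] (P' : PoissonBracket k B) (f : I → B),
    ∃! φ : A →ₐ[k] B, (∀ a b, φ (P.br a b) = P'.br (φ a) (φ b)) ∧ ∀ i, φ (x i) = f i

/-- `A` is the free Poisson algebra over the commutative algebra `C`: each algebra morphism from `C` to
a Poisson algebra extends uniquely along `μ` to a Poisson morphism. -/
def PoissonBracket.FreelyGeneratedByAlg [Algebra k A] (P : PoissonBracket k A)
    {C : Type*} [CommRing C] [Algebra k C] (μ : C →ₐ[k] A) : Prop :=
  ∀ (B : Type w) [CommRing B] [Algebra k B] (P' : PoissonBracket k B) (g : C →ₐ[k] B),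
    ∃! φ : A →ₐ[k] B, (∀ a b, φ (P.br a b) = P'.br (φ a) (φ b)) ∧ φ.comp μ = g

/-- The counit, coproduct and antipode take the same form on the `x_n` as on the generators `a_n`. -/
structure IsDiffHopf (k : Type u) [CommRing k] {A : Type v} [Ring A] [HopfAlgebra k A]
    {s : ℕ} {ν : ℕ∞} (x : Idx s ν → A) : Prop where
  comul : ∀ i, Coalgebra.comul (R := k) (x i) = coprod k s (extend x) i.n
  counit : ∀ i, (Coalgebra.counit (x i) : k) = 0
  antipode : ∀ i, HopfAlgebra.antipode k (x i) = - x i -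
    ∑ m ∈ Finset.Ico 1 i.n, extend x m * HopfAlgebra.antipode k (Qpoly s (extend x) m (i.n - m))
  antipode' : ∀ i, HopfAlgebra.antipode k (x i) = - x i -
    ∑ m ∈ Finset.Ico 1 i.n, HopfAlgebra.antipode k (extend x m) * Qpoly s (extend x) m (i.n - m)

/-- A Hopf algebra grading. -/
structure IsHopfGrading [HopfAlgebra k A] (W : ℕ → Submodule k A) : Prop where
  mul : SetLike.GradedMonoid W
  internal : DirectSum.IsInternal W
  comul : ∀ w, ∀ a ∈ W w, Coalgebra.comul (R := k) a ∈
    Submodule.span k {t : A ⊗[k] A | ∃ i j, i + j = w ∧ ∃ y ∈ W i, ∃ z ∈ W j, t = y ⊗ₜ[k] z}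
  counit : ∀ w, w ≠ 0 → ∀ a ∈ W w, (Coalgebra.counit a : k) = 0
  antipode : ∀ w, ∀ a ∈ W w, HopfAlgebra.antipode k a ∈ W w

end poisson

/-- `σ` identifies `F` with the specialization `A / ħ A`, as a Hopf algebra, and `P` is the bracket
`{a mod ħ, b mod ħ} = (ħ^{-1} (a b - b a)) mod ħ`. -/
structure IsSpecialization {k : Type u} [Field k] {s : ℕ} {ν : ℕ∞}
    (A : Subalgebra k[X] (HK k s ν)) {F : Type v} [CommRing F] [HopfAlgebra k F]
    (P : PoissonBracket k F) (σ : A →ₐ[k] F) : Prop where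
  surjective : Function.Surjective σ
  ker : ∀ a : A, σ a = 0 ↔ ∃ c : A, a = (Polynomial.X : k[X]) • c
  comul : ∀ (a : A) (l : List (A × A)),
    Coalgebra.comul (R := RatFunc k) (a : HK k s ν) =
      (l.map fun p => (p.1 : HK k s ν) ⊗ₜ[RatFunc k] (p.2 : HK k s ν)).sum →
    Coalgebra.comul (R := k) (σ a) = (l.map fun p => σ p.1 ⊗ₜ[k] σ p.2).sum
  counit : ∀ (a : A) (r : k[X]),
    (Coalgebra.counit (a : HK k s ν) : RatFunc k) = algebraMap k[X] (RatFunc k) r →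
    (Coalgebra.counit (σ a) : k) = r.eval 0
  antipode : ∀ a b : A, HopfAlgebra.antipode (RatFunc k) (a : HK k s ν) = b →
    HopfAlgebra.antipode k (σ a) = σ b
  bracket : ∀ a b c : A, a * b - b * a = (Polynomial.X : k[X]) • c → P.br (σ a) (σ b) = σ c

section lie

/-- `δ` makes the Lie algebra `L` a Lie bialgebra: `δ` is antisymmetric, satisfies the co-Jacobi identity
(`rot` is the cyclic permutation of `L ⊗ L ⊗ L`), and is a cocycle. -/
structure IsLieCobracket {k : Type u} [CommRing k] {L : Type v} [LieRing L] [LieAlgebra k L]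
    (δ : L →ₗ[k] L ⊗[k] L) : Prop where
  skew : ∀ x, TensorProduct.comm k L L (δ x) = - δ x
  coJacobi : ∀ x, let t := TensorProduct.assoc k L L L (TensorProduct.map δ LinearMap.id (δ x))
    let rot := (TensorProduct.assoc k L L L).toLinearMap ∘ₗ
      (TensorProduct.comm k L (L ⊗[k] L)).toLinearMap
    t + rot t + rot (rot t) = 0
  cocycle : ∀ x y, δ ⁅x, y⁆ = ⁅x, δ y⁆ - ⁅y, δ x⁆

/-- The class of `f - ε(f)` in the cotangent space `𝔪 / 𝔪^2` at the unit element, where `𝔪 = Ker ε`. -/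
noncomputable def cotangentClass (k : Type u) [Field k] (F : Type v) [CommRing F] [HopfAlgebra k F] :
    F →ₗ[k] (RingHom.ker (Bialgebra.counitAlgHom k F)).Cotangent where
  toFun f := Ideal.toCotangent _ ⟨f - algebraMap k F (Coalgebra.counit f), by
    simp [RingHom.mem_ker]⟩
  map_add' f g := by
    rw [← map_add]; congr 1; ext; simp; ring
  map_smul' r f := by
    rw [RingHom.id_apply, ← LinearMap.map_smul_of_tower]
    congr 1
    ext
    simp [Algebra.smul_def]
    ring

/-- `Ψ` is an isomorphism from the Lie bialgebra `L` to the cotangent Lie bialgebra `𝔪 / 𝔪^2`, whose bracket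
is induced by the Poisson bracket and whose cobracket is induced by `Δ - Δ^op`. -/
structure IsCotangentIso {k : Type u} [Field k] {F : Type v} [CommRing F] [HopfAlgebra k F]
    (P : PoissonBracket k F) {L : Type w} [LieRing L] [LieAlgebra k L] (δ : L →ₗ[k] L ⊗[k] L)
    (Ψ : L ≃ₗ[k] (RingHom.ker (Bialgebra.counitAlgHom k F)).Cotangent) : Prop where
  bracket : ∀ x y : L, ∀ f g : F, (Coalgebra.counit f : k) = 0 → (Coalgebra.counit g : k) = 0 →
    Ψ x = cotangentClass k F f → Ψ y = cotangentClass k F g →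
    (Coalgebra.counit (P.br f g) : k) = 0 ∧ Ψ ⁅x, y⁆ = cotangentClass k F (P.br f g)
  cobracket : ∀ x : L, ∀ f : F, (Coalgebra.counit f : k) = 0 → Ψ x = cotangentClass k F f →
    TensorProduct.map Ψ.toLinearMap Ψ.toLinearMap (δ x) =
      TensorProduct.map (cotangentClass k F) (cotangentClass k F)
        (Coalgebra.comul (R := k) f - TensorProduct.comm k F F (Coalgebra.comul (R := k) f))

end lie

section points
variable (k : Type u) [Field k] (H : Type v) [CommRing H] [HopfAlgebra k H]
  (R : Type w) [CommRing R] [Algebra k R]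

/-- The `R`-points of the affine group scheme with function algebra `H`, under convolution. -/
def Points : Type (max v w) := WithConv (H →ₐ[k] R)

noncomputable instance : Monoid (Points k H R) := inferInstanceAs (Monoid (WithConv (H →ₐ[k] R)))

theorem antipode_conv (f : H →ₐ[k] R) (h : H) :
    Algebra.TensorProduct.lift (f.comp (HopfAlgebra.antipodeAlgHom k H)) f
      (fun _ _ => Commute.all _ _) (Coalgebra.comul (R := k) h) =
    algebraMap k R (Coalgebra.counit h) := by
  have key : ∀ t : H ⊗[k] H, Algebra.TensorProduct.lift (f.comp (HopfAlgebra.antipodeAlgHom k H)) f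
      (fun _ _ => Commute.all _ _) t =
      f (LinearMap.mul' k H ((HopfAlgebra.antipode k).rTensor H t)) := by
    intro t
    induction t with
    | zero => simp
    | add x y hx hy => simp [hx, hy]
    | tmul x y => simp
  rw [key, HopfAlgebra.mul_antipode_rTensor_comul_apply, AlgHom.commutes]

/-- The inverse of a point is its composite with the antipode. -/
noncomputable instance : Group (Points k H R) :=
  { (inferInstance : Monoid (Points k H R)) with
    inv := fun f => WithConv.toConv ((WithConv.ofConv f).comp (HopfAlgebra.antipodeAlgHom k H))
    inv_mul_cancel := fun f => by
      apply WithConv.ofConv_injective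
      refine AlgHom.ext fun h => ?_
      refine Eq.trans ?_ (antipode_conv k H R (WithConv.ofConv f) h)
      let f' : WithConv (H →ₐ[k] R) := f
      let g' : WithConv (H →ₐ[k] R) := WithConv.toConv ((WithConv.ofConv f').comp
        (HopfAlgebra.antipodeAlgHom k H))
      change (WithConv.ofConv (g' * f')) h = _
      rw [AlgHom.convMul_def]
      simp only [AlgHom.coe_comp, Function.comp_apply, Bialgebra.comulAlgHom_apply]
      generalize Coalgebra.comul (R := k) h = t
      induction t with
      | zero => simp
      | add x y hx hy => simp only [map_add, hx, hy]
      | tmul x y => simp [f', g'] }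

variable {k H}
/-- The morphism on `R`-points induced by a morphism of Hopf algebras. -/
noncomputable def Points.map {H' : Type*} [CommRing H'] [HopfAlgebra k H'] (h : H' →ₐc[k] H) :
    Points k H R →* Points k H' R where
  toFun f := WithConv.toConv ((WithConv.ofConv f).comp (h : H' →ₐ[k] H))
  map_one' := by
    apply WithConv.ofConv_injective
    refine AlgHom.ext fun x => ?_
    change algebraMap k R (Coalgebra.counit (h x)) = algebraMap k R (Coalgebra.counit x)
    rw [CoalgHomClass.counit_comp_apply]
  map_mul' f g := WithConv.ofConv_injective (AlgHom.convMul_comp_bialgHom_distrib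
    (f : WithConv (H →ₐ[k] R)) (g : WithConv (H →ₐ[k] R)) h)
end points

/-- Along the section `q` of `p`, the group `G` is the semidirect product of `K` and the normal
subgroup `Ker p`: the map `(n, g) ↦ n * q g` is an isomorphism of groups. -/
def IsSemidirect {G K : Type*} [Group G] [Group K] (p : G →* K) (q : K →* G) : Prop :=
  ∃ (φ : K →* MulAut p.ker) (e : p.ker ⋊[φ] K ≃* G), ∀ n g, e ⟨n, g⟩ = (n : G) * q g

end FormalDiff

open FormalDiff

/-!
# Drinfeld's functor applied to the Hopf algebra of formal diffeomorphisms

Write `ħ x` for the image in `H(ħ)` of an element `x` of the free Lie algebra `L`, whose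
generators are mapped to the `ħ⁻¹ a_n`. The `k[ħ]`-algebra generated by all `ħ x` is called
`order` here. It is commutative modulo `ħ`, because `[ħ x, ħ y] = ħ (ħ [x, y])`, and everything
else follows from the study of this algebra.

*Hopf structure.* An algebra morphism from `H(ħ)` to an algebra with a family of submodules that
is multiplicative and commutative modulo `ħ` maps the order to this family as soon as it does so
for the generators `a_n` (`map_orderGr_mem`): the image of `ħ [x, y]` is `ħ⁻¹` times a commutator.
Applied to the coproduct and to the antipode this shows that the order is a graded Hopf subalgebra
over `k[ħ]` (`isGradedHopfOrder_order`). Since `k[ħ]` is a Dedekind domain, the tensor powers of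
the order embed in those of `H(ħ)`, so the order is a Hopf algebra in its own right, and its
reduction at `ħ = 0` is a commutative Poisson Hopf algebra (`isSpecialization_orderSpec`,
`specPoisson_isPoissonHopf`).

*The reduction is a polynomial algebra* (`IsSpecialization.bijective_aeval`). Each linear form on
`L` extends to the free associative algebra, in which `L` is embedded
(`freeLieToAssoc_injective`), hence to a `k(ħ)`-linear functional `ψ` on `H(ħ)` with polynomial
values on `H_ħ^∨`; dividing `ψ(a - ε(a))` by `ħ` and putting `ħ = 0` gives a tangent vector `ℓ` at
the unit element of the reduction `F`, with arbitrary values at the `ħ x`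
(`IsSpecialization.exists_tangentLift`). In characteristic zero `ℓ` exponentiates to a
one-parameter subgroup, a point of the group over `k⟦t⟧`. A nonzero polynomial in the classes of a
basis of `L` does not vanish identically along such a curve, if the component of lowest degree is
not zero at `ℓ`. This replaces the Poincaré-Birkhoff-Witt theorem.

*The order is Drinfeld's algebra* (`IsSpecialization.toSubmodule_order`). The order is contained
in `k[ħ] + ħ H_ħ^∨`, which yields one inclusion. If conversely `η` satisfies the conditions on the
`δ_n(η)` and `ħ η` lies in the order, then the convolution powers of the functionals `ψ` show that
all powers of left invariant vector fields annihilate the class of `ħ η` at the unit element. By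
the previous step this class is zero, so that `η` lies in the order. Every `η` in `H_ħ^∨` has a
multiple `ħ^m η` in the order (`exists_X_pow_smul_mem_order`), and descending induction on `m`
applies.

*Consequences.* Ordered monomials span the algebra given by the presentation, and they are
linearly independent in the order since they are so at `ħ = 0`
(`IsSpecialization.bijective_presMap`). The reduction `F` is a polynomial algebra on a basis of
`L` whose bracket restricts to the one of `L`, that is, the symmetric algebra of the free Lie
algebra, and therefore a free Poisson algebra (`IsSpecialization.freelyGeneratedBy`). The
universal property, with the zero bracket on `F[G]`, gives the projection `π`; with the square
zero extension `k ⊕ L` as target, it gives the differential `F → L` at the unit element, and with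
it the cotangent Lie bialgebra (`IsDifferential`). Finally, `μ` is a section of `π`, so that the
groups of points are semidirect products.
-/

namespace FormalDiff

/-! ### The free Lie algebra inside the free associative algebra -/

section freeLie

attribute [local instance 100] LieRing.ofAssociativeRing

variable {k : Type u} [Field k]

/-- Induction for the free Lie algebra: a property that holds for the generators and is preserved
by the operations of a Lie algebra holds for all elements. -/
theorem freeLie_induction {X : Type*} {p : FreeLieAlgebra k X → Prop}
    (of : ∀ i, p (FreeLieAlgebra.of k i)) (zero : p 0) (add : ∀ x y, p x → p y → p (x + y))
    (smul : ∀ (c : k) x, p x → p (c • x)) (lie : ∀ x y, p x → p y → p ⁅x, y⁆)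
    (x : FreeLieAlgebra k X) : p x := by
  let S : LieSubalgebra k (FreeLieAlgebra k X) :=
    { carrier := {x | p x}
      zero_mem' := zero
      add_mem' := fun {x y} => add x y
      smul_mem' := smul
      lie_mem' := fun {x y} => lie x y }
  let f : FreeLieAlgebra k X →ₗ⁅k⁆ S := FreeLieAlgebra.lift k fun i => ⟨_, of i⟩
  have h : S.incl.comp f = LieHom.id := FreeLieAlgebra.hom_ext fun i => by
    simp only [LieHom.comp_apply, f, FreeLieAlgebra.lift_of_apply]; rfl
  have h' : (f x : FreeLieAlgebra k X) = x := LieHom.congr_fun h x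
  exact h' ▸ (f x).2

/-- The canonical map of the free Lie algebra on `X` to the free associative algebra on `X`. -/
noncomputable def freeLieToAssoc (k : Type u) [Field k] (X : Type*) :
    FreeLieAlgebra k X →ₗ⁅k⁆ FreeAlgebra k X :=
  FreeLieAlgebra.lift k (FreeAlgebra.ι k)

variable {X : Type*}

/-- The representation of the free associative algebra on `L × k`, in which a generator `x` sends
`(y, c)` to `([x, y] + c d(x) x, 0)`. It extends the adjoint representation of `L` by a cocycle,
which is the derivation of `L` multiplying each generator `x` by `d(x)`. -/
noncomputable def eulerRep (d : X → k) :
    FreeAlgebra k X →ₐ[k] Module.End k (FreeLieAlgebra k X × k) :=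
  FreeAlgebra.lift k fun i =>
    (LinearMap.inl k (FreeLieAlgebra k X) k) ∘ₗ
      ((LieAlgebra.ad k (FreeLieAlgebra k X) (FreeLieAlgebra.of k i)).coprod
        (LinearMap.toSpanSingleton k _ (d i • FreeLieAlgebra.of k i)))

/-- The derivation of the free Lie algebra that multiplies each generator `x` by `d(x)`. It is
built so as to factor through the free associative algebra. -/
noncomputable def euler (d : X → k) : FreeLieAlgebra k X →ₗ[k] FreeLieAlgebra k X :=
  (LinearMap.fst k _ k) ∘ₗ (LinearMap.applyₗ (0, 1)) ∘ₗ (eulerRep d).toLinearMap ∘ₗ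
    (freeLieToAssoc k X).toLinearMap

theorem euler_apply (d : X → k) (x) :
    euler d x = (eulerRep d (freeLieToAssoc k X x) (0, 1)).1 := rfl

theorem eulerRep_lie (d : X → k) (x : FreeLieAlgebra k X) :
    ∀ y c, eulerRep d (freeLieToAssoc k X x) (y, c) = (⁅x, y⁆ + c • euler d x, 0) := by
  induction x using freeLie_induction with
  | of i =>
    intro y c
    simp [eulerRep, freeLieToAssoc, euler]
  | zero => intro y c; rw [map_zero, map_zero, map_zero, zero_lie, smul_zero, add_zero]; rfl
  | add x y hx hy =>
    intro z c
    rw [map_add, map_add, LinearMap.add_apply, hx, hy]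
    simp [add_add_add_comm]
  | smul a x hx =>
    intro z c
    rw [map_smul, map_smul, LinearMap.smul_apply, hx]
    simp [smul_comm a c]
  | lie x y hx hy =>
    have key : ∀ z c, eulerRep d (freeLieToAssoc k X ⁅x, y⁆) (z, c) =
        (⁅⁅x, y⁆, z⁆ + c • (⁅x, euler d y⁆ - ⁅y, euler d x⁆), 0) := by
      intro z c
      rw [LieHom.map_lie, LieRing.of_associative_ring_bracket, map_sub, map_mul, map_mul,
        LinearMap.sub_apply, Module.End.mul_apply, Module.End.mul_apply, hx, hy, hx, hy]
      simp only [zero_smul, add_zero, lie_add, lie_smul, Prod.mk_sub_mk, sub_zero, lie_lie,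
        smul_sub]
      congr 1
      abel
    intro z c
    rw [key, euler_apply d ⁅x, y⁆, key]
    simp

theorem euler_of (d : X → k) (i : X) :
    euler d (FreeLieAlgebra.of k i) = d i • FreeLieAlgebra.of k i := by
  simp [euler_apply, eulerRep, freeLieToAssoc]

theorem euler_lie (d : X → k) (x y : FreeLieAlgebra k X) :
    euler d ⁅x, y⁆ = ⁅x, euler d y⁆ + ⁅euler d x, y⁆ := by
  rw [euler_apply, LieHom.map_lie, LieRing.of_associative_ring_bracket, map_sub, map_mul, map_mul,
    LinearMap.sub_apply, Module.End.mul_apply, Module.End.mul_apply]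
  simp only [eulerRep_lie]
  simp [sub_eq_add_neg]

variable {s : ℕ} {ν : ℕ∞}

theorem span_isLieMonomial :
    Submodule.span k {x : FL k s ν | ∃ m, IsLieMonomial k m x} = ⊤ := by
  refine eq_top_iff.2 fun x _ => ?_
  induction x using freeLie_induction with
  | of i => exact Submodule.subset_span ⟨_, .of i⟩
  | zero => exact zero_mem _
  | add x y hx hy => exact add_mem (hx trivial) (hy trivial)
  | smul c x hx => exact Submodule.smul_mem _ c (hx trivial)
  | lie x y hx hy =>
    refine Submodule.span_induction₂ (p := fun x y _ _ => ⁅x, y⁆ ∈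
      Submodule.span k {x : FL k s ν | ∃ m, IsLieMonomial k m x}) ?_ ?_ ?_ ?_ ?_ ?_ ?_
      (hx trivial) (hy trivial)
    · rintro x y ⟨m, hm⟩ ⟨n, hn⟩
      exact Submodule.subset_span ⟨_, hm.lie hn⟩
    · intro y _; simp
    · intro y _; simp
    · intro x y z _ _ _ h1 h2; rw [add_lie]; exact add_mem h1 h2
    · intro x y z _ _ _ h1 h2; rw [lie_add]; exact add_mem h1 h2
    · intro c x y _ _ h; rw [smul_lie]; exact Submodule.smul_mem _ _ h
    · intro c x y _ _ h; rw [lie_smul]; exact Submodule.smul_mem _ _ h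

theorem IsLieMonomial.pos (hs : 0 < s) {m : ℕ} {x : FL k s ν} (h : IsLieMonomial k m x) :
    0 < m := by
  induction h with
  | of i => exact Nat.mul_pos hs i.pos
  | lie _ _ h1 h2 => omega

/-- With the weights of the generators as multipliers, Lie monomials are eigenvectors. -/
theorem euler_isLieMonomial {m : ℕ} {x : FL k s ν} (h : IsLieMonomial k m x) :
    euler (fun i : Idx s ν => ((s * i.n : ℕ) : k)) x = (m : k) • x := by
  induction h with
  | of i => rw [euler_of]
  | lie _ _ h1 h2 => rw [euler_lie, h1, h2, lie_smul, smul_lie, ← add_smul]; push_cast; ring_nf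

/-- The free Lie algebra embeds into the free associative algebra (Dynkin, Specht and Wever): the
Euler derivation, which is injective in characteristic zero since Lie monomials are eigenvectors
with positive eigenvalues, factors through this map. -/
theorem freeLieToAssoc_injective [CharZero k] (hs : 0 < s) :
    Function.Injective (freeLieToAssoc k (Idx s ν)) := by
  -- the span of the eigenvectors with nonzero eigenvalues is everything, so the kernel is zero
  set E : Module.End k (FL k s ν) := euler (fun i : Idx s ν => ((s * i.n : ℕ) : k)) with hE
  have hker : ∀ x, E x = 0 → x = 0 := by
    intro x hx
    have h0 : x ∈ E.eigenspace 0 := by rwa [Module.End.mem_eigenspace_iff, zero_smul]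
    have htop : x ∈ ⨆ μ ≠ (0 : k), E.eigenspace μ := by
      have : Submodule.span k {x : FL k s ν | ∃ m, IsLieMonomial k m x} ≤
          ⨆ μ ≠ (0 : k), E.eigenspace μ := by
        rw [Submodule.span_le]
        rintro y ⟨m, hm⟩
        refine Submodule.mem_iSup_of_mem (m : k) (Submodule.mem_iSup_of_mem ?_ ?_)
        · exact_mod_cast (hm.pos hs).ne'
        · rw [Module.End.mem_eigenspace_iff, hE, euler_isLieMonomial hm]
      exact this (by rw [span_isLieMonomial]; trivial)
    exact (Submodule.disjoint_def.1 (E.eigenspaces_iSupIndep 0)) x h0 htop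
  rw [injective_iff_map_eq_zero]
  intro x hx
  refine hker x ?_
  rw [hE, euler_apply, hx]
  simp

/-- If there are two generators `x_1, x_2`, then the `ad(x_1)^n x_2` are linearly independent. -/
theorem not_finite_freeLie [CharZero k] (hs : 0 < s) (hν : ((2 * s : ℕ) : ℕ∞) ≤ ν) :
    ¬ Module.Finite k (FL k s ν) := by
  intro hfin
  have hν1 : ((s * 1 : ℕ) : ℕ∞) ≤ ν := le_trans (by exact_mod_cast (by omega)) hν
  have hν2 : ((s * 2 : ℕ) : ℕ∞) ≤ ν := by rwa [mul_comm]
  let i₁ : Idx s ν := ⟨1, le_rfl, hν1⟩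
  let i₂ : Idx s ν := ⟨2, by norm_num, hν2⟩
  let e : ℕ → FL k s ν := fun n =>
    Nat.rec (FreeLieAlgebra.of k i₂) (fun _ y => ⁅FreeLieAlgebra.of k i₁, y⁆) n
  have he : ∀ n, e (n + 1) = ⁅FreeLieAlgebra.of k i₁, e n⁆ := fun n => rfl
  have hmon : ∀ n, IsLieMonomial k (s * (n + 2)) (e n) := by
    intro n
    induction n with
    | zero => exact .of i₂
    | succ n ih =>
      rw [he, show s * (n + 1 + 2) = s * i₁.n + s * (n + 2) by simp [i₁]; ring]
      exact .lie (.of i₁) ih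
  -- `x_1` and `x_2` act on `k²` as the elementary matrices `E₁₁` and `E₁₂`, with `[E₁₁, E₁₂] = E₁₂`
  classical
  let ρ : FL k s ν →ₗ⁅k⁆ Matrix (Fin 2) (Fin 2) k := FreeLieAlgebra.lift k fun i =>
    if i = i₁ then Matrix.single 0 0 1 else Matrix.single 0 1 1
  have hρ : ∀ n, ρ (e n) = Matrix.single 0 1 1 := by
    intro n
    induction n with
    | zero =>
      change ρ (FreeLieAlgebra.of k i₂) = _
      rw [FreeLieAlgebra.lift_of_apply, if_neg]
      simp [i₁, i₂]
    | succ n ih =>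
      rw [he, LieHom.map_lie, ih, FreeLieAlgebra.lift_of_apply, if_pos rfl,
        LieRing.of_associative_ring_bracket]
      simp
  have hne : ∀ n, e n ≠ 0 := by
    intro n h
    have := hρ n
    rw [h, map_zero] at this
    simpa using congr_fun (congr_fun this 0) 1
  -- the `e n` are nonzero eigenvectors of the Euler derivation with distinct eigenvalues
  have hli := Module.End.eigenvectors_linearIndependent'
    (euler (fun i : Idx s ν => ((s * i.n : ℕ) : k))) (fun n : ℕ => ((s * (n + 2) : ℕ) : k))
    (fun m n h => by
      have h' : s * (m + 2) = s * (n + 2) := Nat.cast_injective (R := k) h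
      have := Nat.eq_of_mul_eq_mul_left hs h'
      omega) e
    (fun n => ⟨Module.End.mem_eigenspace_iff.2 (euler_isLieMonomial (hmon n)), hne n⟩)
  exact not_finite_iff_infinite.2 inferInstance (hli.finite)

end freeLie

/-! ### Graded families and the structure constants -/

section graded

theorem compSum_mem {R B : Type*} [CommSemiring R] [Semiring B] [Algebra R B]
    (G : ℕ → Submodule R B)
    [SetLike.GradedMonoid G] {s : ℕ} {a : ℕ → B} (ha : ∀ n, a n ∈ G (s * n)) (m t : ℕ) :
    compSum a m t ∈ G (s * t) := by
  refine Submodule.sum_mem _ fun j hj => ?_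
  rw [Finset.mem_filter, Finset.Nat.mem_antidiagonalTuple] at hj
  have := SetLike.list_prod_ofFn_mem_graded (A := G) (fun i => s * j i) (fun i => a (j i))
    fun i => ha (j i)
  rwa [List.sum_ofFn, ← Finset.mul_sum, hj.1] at this

theorem Qpoly_mem {R B : Type*} [CommSemiring R] [Semiring B] [Algebra R B] (G : ℕ → Submodule R B)
    [SetLike.GradedMonoid G] {s : ℕ} {a : ℕ → B} (ha : ∀ n, a n ∈ G (s * n)) (l t : ℕ) :
    Qpoly s a l t ∈ G (s * t) := by
  refine Submodule.sum_mem _ fun m _ => ?_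
  rw [← nsmul_eq_mul]
  exact Submodule.smul_of_tower_mem _ _ (compSum_mem G ha m t)

theorem antipodeGen_mem {R B : Type*} [CommRing R] [Ring B] [Algebra R B] (G : ℕ → Submodule R B)
    [SetLike.GradedMonoid G] {s : ℕ} {a : ℕ → B} (ha : ∀ n, a n ∈ G (s * n)) (n : ℕ) :
    antipodeGen s a n ∈ G (s * n) := by
  induction n using Nat.strong_induction_on with
  | _ n ih =>
    rw [anti_eq]
    refine sub_mem (neg_mem (ha n)) (Submodule.sum_mem _ fun m hm => ?_)
    rw [Finset.mem_Ico] at hm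
    have := SetLike.GradedMul.mul_mem (ih m hm.2) (Qpoly_mem G ha m (n - m))
    rwa [← Nat.mul_add, Nat.add_sub_cancel' hm.2.le] at this

theorem map_compSum {B C : Type*} [Semiring B] [Semiring C] (f : B →+* C) (a : ℕ → B) (m t : ℕ) :
    f (compSum a m t) = compSum (fun n => f (a n)) m t := by
  simp only [compSum, map_sum, map_list_prod, List.map_ofFn]
  rfl

theorem map_Qpoly {B C : Type*} [Semiring B] [Semiring C] (f : B →+* C) (s : ℕ) (a : ℕ → B)
    (l t : ℕ) :
    f (Qpoly s a l t) = Qpoly s (fun n => f (a n)) l t := by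
  simp [Qpoly, map_compSum]

theorem map_antipodeGen {B C : Type*} [Ring B] [Ring C] (f : B →+* C) (s : ℕ) (a : ℕ → B) (n : ℕ) :
    f (antipodeGen s a n) = antipodeGen s (fun n => f (a n)) n := by
  induction n using Nat.strong_induction_on with
  | _ n ih =>
    rw [anti_eq, anti_eq, map_sub, map_neg, map_sum]
    congr 1
    refine Finset.sum_congr rfl fun m hm => ?_
    rw [map_mul, ih m (Finset.mem_Ico.1 hm).2, map_Qpoly]

theorem map_extend {B C : Type*} [Semiring B] [Semiring C] {s : ℕ} {ν : ℕ∞} (f : B →+* C)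
    (a : Idx s ν → B) (n : ℕ) : f (extend a n) = extend (fun i => f (a i)) n := by
  rw [extend, extend]; split_ifs <;> simp

theorem extend_mem {R B : Type*} [CommSemiring R] [Semiring B] [Module R B] (G : ℕ → Submodule R B)
    {s : ℕ} {ν : ℕ∞} {a : Idx s ν → B} (ha : ∀ i, a i ∈ G (s * i.n)) (n : ℕ) :
    extend a n ∈ G (s * n) := by
  rw [extend]
  split_ifs with h
  · exact ha ⟨n, h.1, h.2⟩
  · exact zero_mem _

/-- A family of `k[ħ]`-submodules that is multiplicative, and commutative modulo `ħ`: commutators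
are multiples of `ħ` by elements of the submodule of the right weight. -/
structure IsAlmostComm {k : Type u} [Field k] {B : Type*} [Ring B] [Algebra k[X] B]
    (G : ℕ → Submodule k[X] B) : Prop extends SetLike.GradedMonoid G where
  comm : ∀ i j x y, x ∈ G i → y ∈ G j → ∃ c ∈ G (i + j), x * y - y * x = (Polynomial.X : k[X]) • c

end graded

/-! ### The order generated by the elements `ħ x` -/

section order
variable {k : Type u} [Field k] {s : ℕ} {ν : ℕ∞}

theorem X_smul_eq {B : Type*} [AddCommGroup B] [Module k[X] B] [Module (RatFunc k) B]
    [IsScalarTower k[X] (RatFunc k) B] (x : B) : (Polynomial.X : k[X]) • x = hbar k • x := by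
  rw [← algebraMap_smul (RatFunc k) (Polynomial.X : k[X]) x, RatFunc.algebraMap_X]

theorem X_smul_cancel {B : Type*} [AddCommGroup B] [Module k[X] B] [Module (RatFunc k) B]
    [IsScalarTower k[X] (RatFunc k) B] {x y : B}
    (h : (Polynomial.X : k[X]) • x = (Polynomial.X : k[X]) • y) : x = y := by
  rw [X_smul_eq, X_smul_eq] at h
  exact smul_right_injective B RatFunc.X_ne_zero h

attribute [local instance] LieRing.ofAssociativeRing in
theorem lieIncl_lie (x y : FL k s ν) :
    lieIncl k s ν ⁅x, y⁆ =
      lieIncl k s ν x * lieIncl k s ν y - lieIncl k s ν y * lieIncl k s ν x := by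
  exact (FreeLieAlgebra.lift k (fun i => (hbar k)⁻¹ • gen (RatFunc k) s ν i) :
    FL k s ν →ₗ⁅k⁆ HK k s ν).map_lie x y

attribute [local instance] LieRing.ofAssociativeRing in
theorem lieIncl_of (i : Idx s ν) :
    lieIncl k s ν (FreeLieAlgebra.of k i) = (hbar k)⁻¹ • gen (RatFunc k) s ν i := by
  exact FreeLieAlgebra.lift_of_apply (fun i => (hbar k)⁻¹ • gen (RatFunc k) s ν i) i

/-- The map `x ↦ ħ x` from the free Lie algebra to `H(ħ)`. -/
noncomputable def hlie (k : Type u) [Field k] (s : ℕ) (ν : ℕ∞) : FL k s ν →ₗ[k] HK k s ν :=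
  ((hbar k • LinearMap.id : HK k s ν →ₗ[RatFunc k] HK k s ν).restrictScalars k) ∘ₗ lieIncl k s ν

theorem hlie_apply (x : FL k s ν) : hlie k s ν x = hbar k • lieIncl k s ν x := rfl

theorem hlie_of (i : Idx s ν) : hlie k s ν (FreeLieAlgebra.of k i) = gen (RatFunc k) s ν i := by
  rw [hlie_apply, lieIncl_of, smul_inv_smul₀ RatFunc.X_ne_zero]

theorem hlie_lie (x y : FL k s ν) : hlie k s ν x * hlie k s ν y - hlie k s ν y * hlie k s ν x =
    (Polynomial.X : k[X]) • hlie k s ν ⁅x, y⁆ := by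
  rw [X_smul_eq]
  simp only [hlie_apply, lieIncl_lie]
  simp [smul_sub]

/-- The `k[ħ]`-algebra generated by the elements `ħ x`, `x` in the free Lie algebra. -/
noncomputable def order (k : Type u) [Field k] (s : ℕ) (ν : ℕ∞) : Subalgebra k[X] (HK k s ν) :=
  Algebra.adjoin k[X] (Set.range (hlie k s ν))

/-- The `k[ħ]`-span of the products of elements `ħ x`, where the `x` are Lie monomials of total
weight `w`. -/
noncomputable def orderGr (k : Type u) [Field k] (s : ℕ) (ν : ℕ∞) (w : ℕ) :
    Submodule k[X] (HK k s ν) :=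
  Submodule.span k[X] {y | ∃ l : List (ℕ × FL k s ν), (∀ p ∈ l, IsLieMonomial k p.1 p.2) ∧
    (l.map Prod.fst).sum = w ∧ y = (l.map fun p => hlie k s ν p.2).prod}

/-- Induction for `orderGr`, by multiplication with elements `ħ x` from the left. -/
theorem orderGr_induction {p : ℕ → HK k s ν → Prop} (zero : ∀ w, p w 0) (one : p 0 1)
    (add : ∀ w x y, p w x → p w y → p w (x + y)) (smul : ∀ w (c : k[X]) x, p w x → p w (c • x))
    (mul : ∀ m x w y, IsLieMonomial k m x → y ∈ orderGr k s ν w → p w y →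
      p (m + w) (hlie k s ν x * y)) (w : ℕ) (y : HK k s ν) (hy : y ∈ orderGr k s ν w) : p w y := by
  refine Submodule.span_induction ?_ (zero w) (fun x y _ _ => add w x y)
    (fun c x _ => smul w c x) hy
  rintro _ ⟨l, hl, rfl, rfl⟩
  clear hy
  induction l with
  | nil => simpa using one
  | cons a l ih =>
    simp only [List.map_cons, List.sum_cons, List.prod_cons]
    have hl' : ∀ p ∈ l, IsLieMonomial k p.1 p.2 := fun p hp => hl p (List.mem_cons_of_mem _ hp)
    exact mul _ _ _ _ (hl a List.mem_cons_self) (Submodule.subset_span ⟨l, hl', rfl, rfl⟩) (ih hl')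

theorem one_mem_orderGr : (1 : HK k s ν) ∈ orderGr k s ν 0 :=
  Submodule.subset_span ⟨[], by simp, rfl, rfl⟩

theorem hlie_mem_orderGr {m : ℕ} {x : FL k s ν} (h : IsLieMonomial k m x) :
    hlie k s ν x ∈ orderGr k s ν m :=
  Submodule.subset_span ⟨[(m, x)], by simpa using h, by simp, by simp⟩

theorem mul_mem_orderGr {i j : ℕ} {x y : HK k s ν} (hx : x ∈ orderGr k s ν i)
    (hy : y ∈ orderGr k s ν j) : x * y ∈ orderGr k s ν (i + j) := by
  refine Submodule.span_induction₂ (p := fun x y _ _ => x * y ∈ orderGr k s ν (i + j))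
    ?_ ?_ ?_ ?_ ?_ ?_ ?_ hx hy
  · rintro _ _ ⟨l, hl, rfl, rfl⟩ ⟨l', hl', rfl, rfl⟩
    refine Submodule.subset_span ⟨l ++ l', ?_, by simp, by simp⟩
    intro p hp
    rcases List.mem_append.1 hp with h | h
    exacts [hl p h, hl' p h]
  · intro y _; simp
  · intro y _; simp
  · intro x y z _ _ _ h1 h2; rw [add_mul]; exact add_mem h1 h2
  · intro x y z _ _ _ h1 h2; rw [mul_add]; exact add_mem h1 h2
  · intro c x y _ _ h; rw [smul_mul_assoc]; exact Submodule.smul_mem _ _ h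
  · intro c x y _ _ h; rw [mul_smul_comm]; exact Submodule.smul_mem _ _ h

/-- The commutator of `ħ x` with a product of elements `ħ y` replaces one factor `ħ y` by `ħ (ħ
[x, y])`. -/
theorem hlie_orderGr_comm {m : ℕ} {x : FL k s ν} (hx : IsLieMonomial k m x) (w : ℕ) (y : HK k s ν)
    (hy : y ∈ orderGr k s ν w) : ∃ c ∈ orderGr k s ν (m + w),
      hlie k s ν x * y - y * hlie k s ν x = (Polynomial.X : k[X]) • c := by
  refine orderGr_induction (p := fun w y => ∃ c ∈ orderGr k s ν (m + w),
    hlie k s ν x * y - y * hlie k s ν x = (Polynomial.X : k[X]) • c) ?_ ?_ ?_ ?_ ?_ w y hy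
  · exact fun w => ⟨0, zero_mem _, by simp⟩
  · exact ⟨0, zero_mem _, by simp⟩
  · rintro w y z ⟨c, hc, h⟩ ⟨d, hd, h'⟩
    exact ⟨c + d, add_mem hc hd, by rw [smul_add, ← h, ← h', mul_add, add_mul]; abel⟩
  · rintro w a y ⟨c, hc, h⟩
    exact ⟨a • c, Submodule.smul_mem _ _ hc, by
      rw [smul_comm, ← h, mul_smul_comm, smul_mul_assoc, smul_sub]⟩
  · rintro n y w z hy hz ⟨c, hc, h⟩
    refine ⟨hlie k s ν ⁅x, y⁆ * z + hlie k s ν y * c, add_mem ?_ ?_, ?_⟩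
    · rw [← add_assoc]
      exact mul_mem_orderGr (hlie_mem_orderGr (hx.lie hy)) hz
    · rw [add_left_comm]
      exact mul_mem_orderGr (hlie_mem_orderGr hy) hc
    · rw [smul_add, ← smul_mul_assoc, ← mul_smul_comm, ← hlie_lie, ← h]
      noncomm_ring

theorem orderGr_comm (i : ℕ) (j : ℕ) (x y : HK k s ν) (hx : x ∈ orderGr k s ν i)
    (hy : y ∈ orderGr k s ν j) : ∃ c ∈ orderGr k s ν (i + j), x * y - y * x =
      (Polynomial.X : k[X]) • c := by
  refine orderGr_induction (p := fun i x => ∃ c ∈ orderGr k s ν (i + j),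
    x * y - y * x = (Polynomial.X : k[X]) • c) ?_ ?_ ?_ ?_ ?_ i x hx
  · exact fun w => ⟨0, zero_mem _, by simp⟩
  · exact ⟨0, zero_mem _, by simp⟩
  · rintro w z z' ⟨c, hc, h⟩ ⟨d, hd, h'⟩
    exact ⟨c + d, add_mem hc hd, by rw [smul_add, ← h, ← h', mul_add, add_mul]; abel⟩
  · rintro w a z ⟨c, hc, h⟩
    exact ⟨a • c, Submodule.smul_mem _ _ hc, by
      rw [smul_comm, ← h, mul_smul_comm, smul_mul_assoc, smul_sub]⟩
  · rintro n z w z' hz hz' ⟨c, hc, h⟩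
    obtain ⟨d, hd, h'⟩ := hlie_orderGr_comm hz j y hy
    refine ⟨hlie k s ν z * c + d * z', add_mem ?_ ?_, ?_⟩
    · rw [add_assoc]
      exact mul_mem_orderGr (hlie_mem_orderGr hz) hc
    · rw [add_right_comm]
      exact mul_mem_orderGr hd hz'
    · rw [smul_add, ← mul_smul_comm, ← smul_mul_assoc, ← h, ← h']
      noncomm_ring

instance : SetLike.GradedMonoid (orderGr k s ν) where
  one_mem := one_mem_orderGr
  mul_mem _ _ _ _ := mul_mem_orderGr

theorem isAlmostComm_orderGr : IsAlmostComm (orderGr k s ν) where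
  comm := orderGr_comm

theorem gen_mem_orderGr (i : Idx s ν) : gen (RatFunc k) s ν i ∈ orderGr k s ν (s * i.n) := by
  rw [← hlie_of]
  exact hlie_mem_orderGr (.of i)

/-- An algebra morphism out of `H(ħ)` that maps the generators to a family which is commutative
modulo `ħ` maps all elements `ħ x` to it: the value at `ħ [x, y]` is `ħ⁻¹` times a commutator. -/
theorem map_orderGr_mem {B : Type*} [Ring B] [Algebra k[X] B] [Algebra (RatFunc k) B]
    [IsScalarTower k[X] (RatFunc k) B] {G : ℕ → Submodule k[X] B} (hG : IsAlmostComm G)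
    (f : HK k s ν →ₐ[RatFunc k] B) (hf : ∀ i, f (gen (RatFunc k) s ν i) ∈ G (s * i.n))
    (w : ℕ) (x : HK k s ν) (hx : x ∈ orderGr k s ν w) : f x ∈ G w := by
  have hf' : ∀ (c : k[X]) x, f (c • x) = c • f x := fun c x => by
    rw [← algebraMap_smul (RatFunc k) c x, map_smul, algebraMap_smul]
  refine orderGr_induction (p := fun w x => f x ∈ G w) ?_ ?_ ?_ ?_ ?_ w x hx
  · intro w; rw [map_zero]; exact zero_mem _
  · rw [map_one]; exact hG.one_mem
  · intro w x y h1 h2; rw [map_add]; exact add_mem h1 h2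
  · intro w c x h; rw [hf']; exact Submodule.smul_mem _ _ h
  · intro m x w y hx _ h2
    rw [map_mul]
    refine hG.mul_mem ?_ h2
    clear h2
    induction hx with
    | of i => rw [hlie_of]; exact hf i
    | @lie p q x y _ _ h1 h2 =>
      obtain ⟨c, hc, h⟩ := hG.comm _ _ _ _ h1 h2
      rw [← map_mul f, ← map_mul f, ← map_sub f, hlie_lie, hf'] at h
      rwa [X_smul_cancel h]

section tensor
variable {B : Type*} [Ring B] [Algebra k[X] B] [Algebra (RatFunc k) B]
  [IsScalarTower k[X] (RatFunc k) B]

/-- The `k[ħ]`-span of the tensors `y ⊗ z` with `y` and `z` in the parts of weights of sum `w`. -/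
noncomputable def tensorGr (G : ℕ → Submodule k[X] B) (w : ℕ) : Submodule k[X] (B ⊗[RatFunc k] B) :=
  Submodule.span k[X] {t | ∃ i j, i + j = w ∧ ∃ y ∈ G i, ∃ z ∈ G j, t = y ⊗ₜ[RatFunc k] z}

theorem tmul_mem_tensorGr {G : ℕ → Submodule k[X] B} {i j : ℕ} {y z : B} (hy : y ∈ G i)
    (hz : z ∈ G j) : y ⊗ₜ[RatFunc k] z ∈ tensorGr G (i + j) :=
  Submodule.subset_span ⟨i, j, rfl, y, hy, z, hz, rfl⟩

theorem X_smul_tmul (y z : B) : (Polynomial.X : k[X]) • (y ⊗ₜ[RatFunc k] z) =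
    ((Polynomial.X : k[X]) • y) ⊗ₜ[RatFunc k] z := rfl

theorem X_smul_tmul' (y z : B) : (Polynomial.X : k[X]) • (y ⊗ₜ[RatFunc k] z) =
    y ⊗ₜ[RatFunc k] ((Polynomial.X : k[X]) • z) := by
  rw [X_smul_tmul, X_smul_eq y, X_smul_eq z, TensorProduct.smul_tmul]

theorem mul_mem_tensorGr {G : ℕ → Submodule k[X] B} (hG : IsAlmostComm G) {i j : ℕ}
    {x y : B ⊗[RatFunc k] B} (hx : x ∈ tensorGr G i) (hy : y ∈ tensorGr G j) :
    x * y ∈ tensorGr G (i + j) := by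
  refine Submodule.span_induction₂ (p := fun x y _ _ => x * y ∈ tensorGr G (i + j))
    ?_ ?_ ?_ ?_ ?_ ?_ ?_ hx hy
  · rintro _ _ ⟨a, b, rfl, y, hu, z, hz, rfl⟩ ⟨a', b', rfl, y', hy', z', hz', rfl⟩
    rw [Algebra.TensorProduct.tmul_mul_tmul, add_add_add_comm]
    exact tmul_mem_tensorGr (hG.mul_mem hu hy') (hG.mul_mem hz hz')
  · intro y _; rw [zero_mul]; exact zero_mem _
  · intro y _; rw [mul_zero]; exact zero_mem _
  · intro x y z _ _ _ h1 h2; rw [add_mul]; exact add_mem h1 h2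
  · intro x y z _ _ _ h1 h2; rw [mul_add]; exact add_mem h1 h2
  · intro c x y _ _ h; rw [smul_mul_assoc]; exact Submodule.smul_mem _ _ h
  · intro c x y _ _ h; rw [mul_smul_comm]; exact Submodule.smul_mem _ _ h

theorem comm_tensorGr {G : ℕ → Submodule k[X] B} (hG : IsAlmostComm G) (i j : ℕ)
    (x y : B ⊗[RatFunc k] B) (hx : x ∈ tensorGr G i) (hy : y ∈ tensorGr G j) :
    ∃ c ∈ tensorGr G (i + j), x * y - y * x = (Polynomial.X : k[X]) • c := by
  refine Submodule.span_induction₂ (p := fun x y _ _ => ∃ c ∈ tensorGr G (i + j),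
    x * y - y * x = (Polynomial.X : k[X]) • c) ?_ ?_ ?_ ?_ ?_ ?_ ?_ hx hy
  · rintro _ _ ⟨a, b, rfl, y, hu, z, hz, rfl⟩ ⟨a', b', rfl, y', hy', z', hz', rfl⟩
    obtain ⟨c, hc, h⟩ := hG.comm _ _ _ _ hu hy'
    obtain ⟨d, hd, h'⟩ := hG.comm _ _ _ _ hz hz'
    refine ⟨c ⊗ₜ (z * z') + (y' * y) ⊗ₜ d, ?_, ?_⟩
    · rw [add_add_add_comm]
      refine add_mem (tmul_mem_tensorGr hc (hG.mul_mem hz hz')) (tmul_mem_tensorGr ?_ hd)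
      rw [add_comm]
      exact hG.mul_mem hy' hu
    · rw [smul_add, X_smul_tmul, X_smul_tmul', ← h, ← h',
        Algebra.TensorProduct.tmul_mul_tmul, Algebra.TensorProduct.tmul_mul_tmul,
        TensorProduct.sub_tmul, TensorProduct.tmul_sub, sub_add_sub_cancel]
  · exact fun y _ => ⟨0, zero_mem _, by rw [zero_mul, mul_zero, sub_zero, smul_zero]⟩
  · exact fun y _ => ⟨0, zero_mem _, by rw [zero_mul, mul_zero, sub_zero, smul_zero]⟩
  · rintro w y z _ _ _ ⟨c, hc, h⟩ ⟨d, hd, h'⟩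
    exact ⟨c + d, add_mem hc hd, by
      rw [smul_add, ← h, ← h', mul_add, add_mul, add_sub_add_comm]⟩
  · rintro w y z _ _ _ ⟨c, hc, h⟩ ⟨d, hd, h'⟩
    exact ⟨c + d, add_mem hc hd, by
      rw [smul_add, ← h, ← h', mul_add, add_mul, add_sub_add_comm]⟩
  · rintro a y z _ _ ⟨c, hc, h⟩
    exact ⟨a • c, Submodule.smul_mem _ _ hc, by
      rw [smul_comm, ← h, mul_smul_comm, smul_mul_assoc, smul_sub]⟩
  · rintro a y z _ _ ⟨c, hc, h⟩
    exact ⟨a • c, Submodule.smul_mem _ _ hc, by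
      rw [smul_comm, ← h, mul_smul_comm, smul_mul_assoc, smul_sub]⟩

theorem isAlmostComm_tensorGr {G : ℕ → Submodule k[X] B} (hG : IsAlmostComm G) :
    IsAlmostComm (tensorGr G) where
  one_mem := tmul_mem_tensorGr (i := 0) (j := 0) hG.one_mem hG.one_mem
  mul_mem _ _ _ _ := mul_mem_tensorGr hG
  comm := comm_tensorGr hG

end tensor

/-- The coproducts of the `a_n` lie in the tensor square of the order, which is commutative modulo
`ħ`. -/
theorem comul_mem_orderGr (w : ℕ) (x : HK k s ν) (hx : x ∈ orderGr k s ν w) :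
    Coalgebra.comul (R := RatFunc k) x ∈ tensorGr (orderGr k s ν) w := by
  have ha : ∀ n, extend (gen (RatFunc k) s ν) n ∈ orderGr k s ν (s * n) :=
    extend_mem _ gen_mem_orderGr
  refine map_orderGr_mem (isAlmostComm_tensorGr (k := k) (B := HK k s ν) isAlmostComm_orderGr)
    (ncComul (RatFunc k) s ν)
    (fun i => ?_) w x hx
  rw [ncComul, FreeAlgebra.lift_ι_apply, coprod]
  refine add_mem (add_mem ?_ ?_) (Submodule.sum_mem _ fun m hm => ?_)
  · have := tmul_mem_tensorGr (k := k) (ha i.n) one_mem_orderGr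
    rwa [add_zero] at this
  · have := tmul_mem_tensorGr (k := k) one_mem_orderGr (ha i.n)
    rwa [zero_add] at this
  · rw [Finset.mem_Ico] at hm
    have := tmul_mem_tensorGr (k := k) (ha m) (Qpoly_mem _ ha m (i.n - m))
    rwa [← Nat.mul_add, Nat.add_sub_cancel' hm.2.le] at this

/-- The antipode is an algebra morphism to the opposite algebra, where the order is again
commutative modulo `ħ`. -/
theorem antipode_mem_orderGr (w : ℕ) (x : HK k s ν) (hx : x ∈ orderGr k s ν w) :
    HopfAlgebra.antipode (RatFunc k) x ∈ orderGr k s ν w := by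
  -- the order, as a family of submodules of the opposite algebra
  let G : ℕ → Submodule k[X] (HK k s ν)ᵐᵒᵖ := fun w =>
    (orderGr k s ν w).map (MulOpposite.opLinearEquiv k[X]).toLinearMap
  have hmem : ∀ w (y : HK k s ν), MulOpposite.op y ∈ G w ↔ y ∈ orderGr k s ν w := by
    intro w y
    constructor
    · rintro ⟨z, hz, h⟩
      obtain rfl : z = y := MulOpposite.op_injective h
      exact hz
    · exact fun h => ⟨y, h, rfl⟩
  have hG : IsAlmostComm G :=
    { one_mem := (hmem 0 1).2 one_mem_orderGr
      mul_mem := by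
        rintro i j _ _ ⟨x, hx, rfl⟩ ⟨y, hy, rfl⟩
        refine (hmem _ (y * x)).2 ?_
        rw [add_comm]
        exact mul_mem_orderGr hy hx
      comm := by
        rintro i j _ _ ⟨x, hx, rfl⟩ ⟨y, hy, rfl⟩
        obtain ⟨c, hc, h⟩ := orderGr_comm _ _ _ _ hy hx
        rw [add_comm] at hc
        exact ⟨MulOpposite.op c, (hmem _ _).2 hc, congr_arg MulOpposite.op h⟩ }
  refine (hmem w _).1 (map_orderGr_mem hG (ncAntipodeOp (RatFunc k) s ν) (fun i => ?_) w x hx)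
  rw [ncAntipodeOp, FreeAlgebra.lift_ι_apply, hmem]
  exact antipodeGen_mem _ (extend_mem _ gen_mem_orderGr) _

end order

/-! ### Weights -/

section weight
variable {k : Type u} [Field k] {s : ℕ} {ν : ℕ∞}

theorem mul_mem_weightPart {R : Type*} [CommRing R] {i j : ℕ} {x y : NCH R s ν}
    (hx : x ∈ weightPart R s ν i) (hy : y ∈ weightPart R s ν j) :
      x * y ∈ weightPart R s ν (i + j) := by
  refine Submodule.span_induction₂ (p := fun x y _ _ => x * y ∈ weightPart R s ν (i + j))
    ?_ ?_ ?_ ?_ ?_ ?_ ?_ hx hy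
  · rintro _ _ ⟨l, rfl, rfl⟩ ⟨l', rfl, rfl⟩
    exact Submodule.subset_span ⟨l ++ l', by simp, by simp⟩
  · intro y _; rw [zero_mul]; exact zero_mem _
  · intro y _; rw [mul_zero]; exact zero_mem _
  · intro x y z _ _ _ h1 h2; rw [add_mul]; exact add_mem h1 h2
  · intro x y z _ _ _ h1 h2; rw [mul_add]; exact add_mem h1 h2
  · intro c x y _ _ h; rw [smul_mul_assoc]; exact Submodule.smul_mem _ _ h
  · intro c x y _ _ h; rw [mul_smul_comm]; exact Submodule.smul_mem _ _ h

theorem one_mem_weightPart {R : Type*} [CommRing R] : (1 : NCH R s ν) ∈ weightPart R s ν 0 :=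
  Submodule.subset_span ⟨[], rfl, rfl⟩

theorem gen_mem_weightPart {R : Type*} [CommRing R] (i : Idx s ν) :
    gen R s ν i ∈ weightPart R s ν (s * i.n) :=
  Submodule.subset_span ⟨[i], by simp, by simp⟩

theorem lieIncl_mem_weightPart {m : ℕ} {x : FL k s ν} (hx : IsLieMonomial k m x) :
    lieIncl k s ν x ∈ weightPart (RatFunc k) s ν m := by
  induction hx with
  | of i => rw [lieIncl_of]; exact Submodule.smul_mem _ _ (gen_mem_weightPart i)
  | @lie p q x y _ _ h1 h2 =>
    rw [lieIncl_lie]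
    refine sub_mem (mul_mem_weightPart h1 h2) ?_
    rw [add_comm]
    exact mul_mem_weightPart h2 h1

theorem orderGr_le_weightPart (w : ℕ) (x : HK k s ν) (hx : x ∈ orderGr k s ν w) :
    x ∈ weightPart (RatFunc k) s ν w := by
  refine orderGr_induction (p := fun w x => x ∈ weightPart (RatFunc k) s ν w) ?_ ?_ ?_ ?_ ?_ w x hx
  · exact fun w => zero_mem _
  · exact one_mem_weightPart
  · exact fun w x y => add_mem
  · intro w c x h
    rw [← algebraMap_smul (RatFunc k) c x]
    exact Submodule.smul_mem _ _ h
  · intro m x w y hx _ hy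
    exact mul_mem_weightPart (Submodule.smul_mem _ _ (lieIncl_mem_weightPart hx)) hy

/-- The algebra morphism `H(ħ) → H(ħ)[t]` that multiplies the elements of weight `w` by `t^w`. -/
noncomputable def weightHom (k : Type u) [Field k] (s : ℕ) (ν : ℕ∞) :
    HK k s ν →ₐ[RatFunc k] Polynomial (HK k s ν) :=
  FreeAlgebra.lift (RatFunc k) fun i => Polynomial.monomial (s * i.n) (gen (RatFunc k) s ν i)

/-- The projection to the part of weight `w`. -/
noncomputable def weightProj (k : Type u) [Field k] (s : ℕ) (ν : ℕ∞) (w : ℕ) :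
    HK k s ν →ₗ[RatFunc k] HK k s ν :=
  ((Polynomial.lcoeff (HK k s ν) w).restrictScalars (RatFunc k)) ∘ₗ (weightHom k s ν).toLinearMap

theorem weightHom_of_mem {w : ℕ} {x : HK k s ν} (hx : x ∈ weightPart (RatFunc k) s ν w) :
    weightHom k s ν x = Polynomial.monomial w x := by
  refine Submodule.span_induction ?_ ?_ ?_ ?_ hx
  · rintro _ ⟨l, rfl, rfl⟩
    clear hx
    induction l with
    | nil => simp
    | cons i l ih =>
      simp only [List.map_cons, List.prod_cons, List.sum_cons, map_mul, ih]
      rw [weightHom, FreeAlgebra.lift_ι_apply, Polynomial.monomial_mul_monomial]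
  · simp
  · intro x y _ _ h1 h2; rw [map_add, h1, h2, map_add]
  · intro c x _ h; rw [map_smul, h, Polynomial.smul_monomial]

theorem weightProj_of_mem {w : ℕ} {x : HK k s ν} (hx : x ∈ weightPart (RatFunc k) s ν w) (m : ℕ) :
    weightProj k s ν m x = if w = m then x else 0 := by
  change Polynomial.coeff (weightHom k s ν x) m = _
  rw [weightHom_of_mem hx, Polynomial.coeff_monomial]

theorem hlie_mem_order (x : FL k s ν) : hlie k s ν x ∈ order k s ν :=
  Algebra.subset_adjoin ⟨x, rfl⟩

theorem orderGr_le_order (w : ℕ) (x : HK k s ν) (hx : x ∈ orderGr k s ν w) : x ∈ order k s ν := by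
  refine orderGr_induction (p := fun _ x => x ∈ order k s ν) ?_ ?_ ?_ ?_ ?_ w x hx
  · exact fun w => zero_mem _
  · exact one_mem _
  · exact fun w x y => add_mem
  · exact fun w c x h => Subalgebra.smul_mem _ h c
  · exact fun m x w y _ _ hy => mul_mem (hlie_mem_order x) hy

theorem mem_iSup_orderGr {x : HK k s ν} (hx : x ∈ order k s ν) : x ∈ ⨆ w, orderGr k s ν w := by
  induction hx using Algebra.adjoin_induction with
  | mem x hx =>
    obtain ⟨x, rfl⟩ := hx
    have : x ∈ Submodule.span k {x : FL k s ν | ∃ m, IsLieMonomial k m x} := by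
      rw [span_isLieMonomial]; trivial
    induction this using Submodule.span_induction with
    | mem x hx =>
      obtain ⟨m, hm⟩ := hx
      exact Submodule.mem_iSup_of_mem m (hlie_mem_orderGr hm)
    | zero => rw [map_zero]; exact zero_mem _
    | add x y _ _ h1 h2 => rw [map_add]; exact add_mem h1 h2
    | smul c x _ h =>
      rw [map_smul, ← algebraMap_smul k[X] c]
      exact Submodule.smul_mem _ _ h
  | algebraMap r =>
    rw [Algebra.algebraMap_eq_smul_one]
    exact Submodule.smul_mem _ _ (Submodule.mem_iSup_of_mem 0 one_mem_orderGr)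
  | add x y _ _ h1 h2 => exact add_mem h1 h2
  | mul x y hx hy h1 h2 =>
    clear hx hy
    induction h1 using Submodule.iSup_induction' with
    | zero => rw [zero_mul]; exact zero_mem _
    | add x x' _ _ h h' => rw [add_mul]; exact add_mem h h'
    | mem i x hx =>
      induction h2 using Submodule.iSup_induction' with
      | zero => rw [mul_zero]; exact zero_mem _
      | add x x' _ _ h h' => rw [mul_add]; exact add_mem h h'
      | mem j y hy => exact Submodule.mem_iSup_of_mem (i + j) (mul_mem_orderGr hx hy)

theorem weightProj_mem_orderGr {x : HK k s ν} (hx : x ∈ order k s ν) (w : ℕ) :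
    weightProj k s ν w x ∈ orderGr k s ν w := by
  have h := mem_iSup_orderGr hx
  clear hx
  induction h using Submodule.iSup_induction' with
  | zero => rw [map_zero]; exact zero_mem _
  | add x x' _ _ h h' => rw [map_add]; exact add_mem h h'
  | mem i x hx =>
    rw [weightProj_of_mem (orderGr_le_weightPart i x hx)]
    split_ifs with h
    · exact h ▸ hx
    · exact zero_mem _

/-- The homogeneous elements of the order are combinations of products of Lie monomials of the
same weight. -/
theorem orderPart_order (w : ℕ) : orderPart (order k s ν) w = orderGr k s ν w := by
  ext x
  constructor
  · rintro ⟨h1, h2⟩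
    have := weightProj_mem_orderGr h1 w
    rwa [weightProj_of_mem h2, if_pos rfl] at this
  · exact fun h => ⟨orderGr_le_order w x h, orderGr_le_weightPart w x h⟩

theorem counit_gen {R : Type*} [CommRing R] (i : Idx s ν) :
    (Coalgebra.counit (gen R s ν i) : R) = 0 :=
  FreeAlgebra.lift_ι_apply _ _

theorem counit_lieIncl (x : FL k s ν) :
    (Coalgebra.counit (lieIncl k s ν x) : RatFunc k) = 0 := by
  have hm : ∀ x y : HK k s ν, (Coalgebra.counit (x * y) : RatFunc k) =
      Coalgebra.counit x * Coalgebra.counit y := Bialgebra.counit_mul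
  induction x using freeLie_induction with
  | of i => rw [lieIncl_of, map_smul, counit_gen, smul_zero]
  | zero => rw [map_zero, map_zero]
  | add x y h1 h2 => rw [map_add, map_add, h1, h2, add_zero]
  | smul c x h =>
    rw [map_smul, ← algebraMap_smul (RatFunc k) c (lieIncl k s ν x), map_smul, h, smul_zero]
  | lie x y h1 h2 => rw [lieIncl_lie, map_sub, hm, hm, h1, h2]; simp

theorem counit_hlie (x : FL k s ν) : (Coalgebra.counit (hlie k s ν x) : RatFunc k) = 0 := by
  rw [hlie_apply, map_smul, counit_lieIncl, smul_zero]

theorem counit_order {x : HK k s ν} (hx : x ∈ order k s ν) :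
    ∃ r : k[X], (Coalgebra.counit x : RatFunc k) = algebraMap k[X] (RatFunc k) r := by
  induction hx using Algebra.adjoin_induction with
  | mem x hx =>
    obtain ⟨x, rfl⟩ := hx
    exact ⟨0, by rw [counit_hlie, map_zero]⟩
  | algebraMap r =>
    refine ⟨r, ?_⟩
    rw [IsScalarTower.algebraMap_apply k[X] (RatFunc k) (HK k s ν), Bialgebra.counit_algebraMap]
  | add x y _ _ h1 h2 =>
    obtain ⟨a, ha⟩ := h1
    obtain ⟨b, hb⟩ := h2
    exact ⟨a + b, by rw [map_add, map_add, ha, hb]⟩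
  | mul x y _ _ h1 h2 =>
    obtain ⟨a, ha⟩ := h1
    obtain ⟨b, hb⟩ := h2
    exact ⟨a * b, by rw [Bialgebra.counit_mul, map_mul, ha, hb]⟩

theorem isGradedHopfOrder_order : IsGradedHopfOrder (order k s ν) where
  graded x hx := by simpa only [orderPart_order] using mem_iSup_orderGr hx
  counit x hx := counit_order hx
  comul w x hx := by
    simp only [orderPart_order] at hx ⊢
    exact comul_mem_orderGr w x hx
  antipode w x hx := by
    rw [orderPart_order] at hx ⊢
    exact antipode_mem_orderGr w x hx

end weight

/-! ### The Rees algebra `H_ħ^∨` -/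

section rees
variable {k : Type u} [Field k] {s : ℕ} {ν : ℕ∞}

/-- The `k[ħ]`-algebra generated by the elements `ħ⁻¹ a_n`. -/
noncomputable def reesAlg (k : Type u) [Field k] (s : ℕ) (ν : ℕ∞) : Subalgebra k[X] (HK k s ν) :=
  Algebra.adjoin k[X] (Set.range fun i => (hbar k)⁻¹ • gen (RatFunc k) s ν i)

theorem gen_mem_reesAlg (i : Idx s ν) : (hbar k)⁻¹ • gen (RatFunc k) s ν i ∈ reesAlg k s ν :=
  Algebra.subset_adjoin ⟨i, rfl⟩

theorem incl_gen (i : Idx s ν) : incl k s ν (gen k s ν i) = gen (RatFunc k) s ν i :=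
  FreeAlgebra.lift_ι_apply _ _

/-- The elements of `H` lie in `k + ħ H_ħ^∨`. -/
theorem incl_eq_counit_add (t : NCH k s ν) : ∃ r ∈ reesAlg k s ν,
    incl k s ν t = algebraMap k (HK k s ν) (Coalgebra.counit t) + (Polynomial.X : k[X]) • r := by
  induction t using FreeAlgebra.induction with
  | grade0 c => exact ⟨0, zero_mem _, by rw [AlgHom.commutes, Bialgebra.counit_algebraMap]; simp⟩
  | grade1 i =>
    refine ⟨_, gen_mem_reesAlg i, ?_⟩
    have := incl_gen (k := k) i
    have h0 := counit_gen (R := k) i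
    rw [this, h0, map_zero, zero_add, X_smul_eq, smul_inv_smul₀ RatFunc.X_ne_zero]
  | mul x y h1 h2 =>
    obtain ⟨r, hr, h⟩ := h1
    obtain ⟨r', hr', h'⟩ := h2
    refine ⟨(Coalgebra.counit x : k) • r' + (Coalgebra.counit y : k) • r +
      (Polynomial.X : k[X]) • (r * r'), ?_, ?_⟩
    · refine add_mem (add_mem ?_ ?_) (Subalgebra.smul_mem _ (mul_mem hr hr') _)
      · rw [← algebraMap_smul k[X]]
        exact Subalgebra.smul_mem _ hr' _
      · rw [← algebraMap_smul k[X]]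
        exact Subalgebra.smul_mem _ hr _
    · rw [map_mul, h, h', Bialgebra.counit_mul, map_mul, add_mul, mul_add, mul_add]
      simp only [smul_add, Algebra.algebraMap_eq_smul_one, smul_mul_assoc, mul_smul_comm, one_mul,
        mul_one]
      rw [smul_comm (Coalgebra.counit y : k) (Polynomial.X : k[X])]
      abel
  | add x y h1 h2 =>
    obtain ⟨r, hr, h⟩ := h1
    obtain ⟨r', hr', h'⟩ := h2
    exact ⟨r + r', add_mem hr hr', by rw [map_add, h, h', map_add, map_add, smul_add]; abel⟩

theorem incl_augIdeal_pow (n : ℕ) (j : NCH k s ν) (hj : j ∈ augIdeal k s ν ^ n) :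
    ∃ r ∈ reesAlg k s ν, incl k s ν j = hbar k ^ n • r := by
  induction n generalizing j with
  | zero =>
    obtain ⟨r, hr, h⟩ := incl_eq_counit_add j
    refine ⟨_, ?_, by rw [pow_zero, one_smul]⟩
    rw [h, IsScalarTower.algebraMap_apply k k[X] (HK k s ν)]
    exact add_mem (Subalgebra.algebraMap_mem _ _) (Subalgebra.smul_mem _ hr _)
  | succ n ih =>
    rw [Submodule.pow_succ] at hj
    refine Submodule.smul_induction_on hj ?_ ?_
    · intro x hx y hy
      obtain ⟨r, hr, h⟩ := ih x hx
      obtain ⟨r', hr', h'⟩ := incl_eq_counit_add y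
      have hy' : (Coalgebra.counit y : k) = 0 := hy
      rw [hy', map_zero, zero_add, X_smul_eq] at h'
      exact ⟨r * r', mul_mem hr hr', by
        rw [smul_eq_mul, map_mul, h, h', smul_mul_smul_comm, pow_succ]⟩
    · rintro x y ⟨r, hr, h⟩ ⟨r', hr', h'⟩
      exact ⟨r + r', add_mem hr hr', by rw [map_add, h, h', smul_add]⟩

/-- The submodule `H_ħ^∨` is the algebra generated by the `ħ⁻¹ a_n`. -/
theorem rees_eq : rees k s ν = Subalgebra.toSubmodule (reesAlg k s ν) := by
  refine le_antisymm ?_ ?_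
  · refine Submodule.span_le.2 ?_
    rintro _ ⟨n, j, hj, rfl⟩
    obtain ⟨r, hr, h⟩ := incl_augIdeal_pow n j hj
    rw [h, inv_smul_smul₀ (pow_ne_zero n RatFunc.X_ne_zero)]
    exact hr
  · rw [reesAlg, Algebra.adjoin_eq_span]
    refine Submodule.span_mono ?_
    intro y hy
    induction hy using Submonoid.closure_induction_right with
    | one => exact ⟨0, 1, Submodule.one_le.1 le_rfl, by rw [map_one, pow_zero, inv_one, one_smul]⟩
    | mul_right x _ y hy h =>
      obtain ⟨i, rfl⟩ := hy
      obtain ⟨n, j, hj, rfl⟩ := h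
      refine ⟨n + 1, j * gen k s ν i, ?_, ?_⟩
      · rw [Submodule.pow_succ]
        exact Submodule.smul_mem_smul hj (counit_gen i)
      · rw [map_mul, smul_mul_smul_comm, pow_succ, mul_inv, incl_gen]

theorem lieIncl_mem_reesAlg (x : FL k s ν) : lieIncl k s ν x ∈ reesAlg k s ν := by
  induction x using freeLie_induction with
  | of i => rw [lieIncl_of]; exact gen_mem_reesAlg i
  | zero => rw [map_zero]; exact zero_mem _
  | add x y h1 h2 => rw [map_add]; exact add_mem h1 h2
  | smul c x h =>
    rw [map_smul, ← algebraMap_smul k[X]]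
    exact Subalgebra.smul_mem _ h _
  | lie x y h1 h2 =>
    rw [lieIncl_lie]
    exact sub_mem (mul_mem h1 h2) (mul_mem h2 h1)

/-- The order is contained in `k[ħ] + ħ H_ħ^∨`. -/
theorem order_eq_counit_add {a : HK k s ν} (ha : a ∈ order k s ν) : ∃ r ∈ reesAlg k s ν,
    a = algebraMap (RatFunc k) (HK k s ν) (Coalgebra.counit a) + (Polynomial.X : k[X]) • r := by
  induction ha using Algebra.adjoin_induction with
  | mem x hx =>
    obtain ⟨x, rfl⟩ := hx
    exact ⟨_, lieIncl_mem_reesAlg x, by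
      rw [counit_hlie, map_zero, zero_add, X_smul_eq, hlie_apply]⟩
  | algebraMap r =>
    refine ⟨0, zero_mem _, ?_⟩
    rw [IsScalarTower.algebraMap_apply k[X] (RatFunc k) (HK k s ν), Bialgebra.counit_algebraMap,
      smul_zero, add_zero]
  | add x y _ _ h1 h2 =>
    obtain ⟨r, hr, h⟩ := h1
    obtain ⟨r', hr', h'⟩ := h2
    refine ⟨r + r', add_mem hr hr', ?_⟩
    rw [map_add, map_add, smul_add, add_add_add_comm, ← h, ← h']
  | mul x y hx hy h1 h2 =>
    obtain ⟨r, hr, h⟩ := h1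
    obtain ⟨r', hr', h'⟩ := h2
    obtain ⟨p, hp⟩ := counit_order hx
    obtain ⟨q, hq⟩ := counit_order hy
    refine ⟨p • r' + q • r + (Polynomial.X : k[X]) • (r * r'), ?_, ?_⟩
    · exact add_mem (add_mem (Subalgebra.smul_mem _ hr' _) (Subalgebra.smul_mem _ hr _))
        (Subalgebra.smul_mem _ (mul_mem hr hr') _)
    · have hx' : algebraMap (RatFunc k) (HK k s ν) (Coalgebra.counit x) = p • 1 := by
        rw [hp, ← IsScalarTower.algebraMap_apply, Algebra.algebraMap_eq_smul_one]
      have hy' : algebraMap (RatFunc k) (HK k s ν) (Coalgebra.counit y) = q • 1 := by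
        rw [hq, ← IsScalarTower.algebraMap_apply, Algebra.algebraMap_eq_smul_one]
      rw [Bialgebra.counit_mul, map_mul]
      rw [hx'] at h ⊢
      rw [hy'] at h' ⊢
      nth_rewrite 1 [h, h']
      simp only [add_mul, mul_add, smul_add, smul_mul_assoc, mul_smul_comm, one_mul, mul_one]
      rw [smul_comm q (Polynomial.X : k[X])]
      abel

theorem order_le_reesAlg : order k s ν ≤ reesAlg k s ν := by
  refine Algebra.adjoin_le ?_
  rintro _ ⟨x, rfl⟩
  rw [hlie_apply, ← X_smul_eq]
  exact Subalgebra.smul_mem _ (lieIncl_mem_reesAlg x) _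

/-- The order and `H_ħ^∨` agree after inverting `ħ`. -/
theorem exists_X_pow_smul_mem_order {η : HK k s ν} (hη : η ∈ reesAlg k s ν) :
    ∃ m : ℕ, (Polynomial.X : k[X]) ^ m • η ∈ order k s ν := by
  induction hη using Algebra.adjoin_induction with
  | mem x hx =>
    obtain ⟨i, rfl⟩ := hx
    refine ⟨1, ?_⟩
    dsimp only
    rw [pow_one, X_smul_eq, smul_inv_smul₀ RatFunc.X_ne_zero, ← hlie_of]
    exact hlie_mem_order _
  | algebraMap r => exact ⟨0, by rw [pow_zero, one_smul]; exact Subalgebra.algebraMap_mem _ r⟩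
  | add x y _ _ h1 h2 =>
    obtain ⟨m, hm⟩ := h1
    obtain ⟨n, hn⟩ := h2
    refine ⟨m + n, ?_⟩
    rw [smul_add]
    refine add_mem ?_ ?_
    · rw [add_comm, pow_add, mul_smul]
      exact Subalgebra.smul_mem _ hm _
    · rw [pow_add, mul_smul]
      exact Subalgebra.smul_mem _ hn _
  | mul x y _ _ h1 h2 =>
    obtain ⟨m, hm⟩ := h1
    obtain ⟨n, hn⟩ := h2
    exact ⟨m + n, by rw [pow_add, ← smul_mul_smul_comm]; exact mul_mem hm hn⟩

/-- The embedding of the free associative algebra in `H(ħ)` that sends the generators to the `ħ⁻¹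
a_n`. -/
noncomputable def scaledIncl (k : Type u) [Field k] (s : ℕ) (ν : ℕ∞) :
    FreeAlgebra k (Idx s ν) →ₐ[k] HK k s ν :=
  FreeAlgebra.lift k fun i => (hbar k)⁻¹ • gen (RatFunc k) s ν i

attribute [local instance] LieRing.ofAssociativeRing in
theorem scaledIncl_freeLieToAssoc (x : FL k s ν) :
    scaledIncl k s ν (freeLieToAssoc k (Idx s ν) x) = lieIncl k s ν x := by
  have : (scaledIncl k s ν : FreeAlgebra k (Idx s ν) →ₗ⁅k⁆ HK k s ν).comp
      (freeLieToAssoc k (Idx s ν)) =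
      FreeLieAlgebra.lift k (fun i => (hbar k)⁻¹ • gen (RatFunc k) s ν i) :=
    FreeLieAlgebra.hom_ext fun i => by
      simp [freeLieToAssoc, scaledIncl]
  exact LieHom.congr_fun this x

/-- The morphism from `H(ħ)` to `k(ħ) ⊗ T`, `T` the free associative algebra, which undoes the
scaling of the generators in `scaledIncl`. -/
noncomputable def unscale (k : Type u) [Field k] (s : ℕ) (ν : ℕ∞) :
    HK k s ν →ₐ[RatFunc k] RatFunc k ⊗[k] FreeAlgebra k (Idx s ν) :=
  FreeAlgebra.lift (RatFunc k) fun i => hbar k ⊗ₜ FreeAlgebra.ι k i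

theorem unscale_scaledIncl (t : FreeAlgebra k (Idx s ν)) :
    unscale k s ν (scaledIncl k s ν t) = 1 ⊗ₜ t := by
  have : ((unscale k s ν).restrictScalars k).comp (scaledIncl k s ν) =
      Algebra.TensorProduct.includeRight := by
    refine FreeAlgebra.hom_ext (funext fun i => ?_)
    simp only [Function.comp_apply, AlgHom.comp_apply, AlgHom.restrictScalars_apply, scaledIncl,
      FreeAlgebra.lift_ι_apply, map_smul, unscale, Algebra.TensorProduct.includeRight_apply]
    rw [TensorProduct.smul_tmul', smul_eq_mul, inv_mul_cancel₀ RatFunc.X_ne_zero]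
  exact DFunLike.congr_fun this t

/-- The extension of a functional `χ` on the free associative algebra to `H(ħ)`. -/
noncomputable def extendFunctional (χ : FreeAlgebra k (Idx s ν) →ₗ[k] k) :
    HK k s ν →ₗ[RatFunc k] RatFunc k :=
  (TensorProduct.AlgebraTensorModule.rid k (RatFunc k) (RatFunc k)).toLinearMap ∘ₗ
    χ.baseChange (RatFunc k) ∘ₗ (unscale k s ν).toLinearMap

theorem extendFunctional_scaledIncl (χ : FreeAlgebra k (Idx s ν) →ₗ[k] k) (t) :
    extendFunctional χ (scaledIncl k s ν t) = algebraMap k (RatFunc k) (χ t) := by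
  simp only [extendFunctional, LinearMap.comp_apply, AlgHom.toLinearMap_apply, unscale_scaledIncl,
    LinearMap.baseChange_tmul, LinearEquiv.coe_coe,
    TensorProduct.AlgebraTensorModule.rid_tmul, Algebra.algebraMap_eq_smul_one]

/-- The algebra `H_ħ^∨` is the `k[ħ]`-span of the image of the free associative algebra under
`scaledIncl`, on which the extended functional takes values in `k`. -/
theorem extendFunctional_reesAlg (χ : FreeAlgebra k (Idx s ν) →ₗ[k] k) {r : HK k s ν}
    (hr : r ∈ reesAlg k s ν) : ∃ p : k[X], extendFunctional χ r =
      algebraMap k[X] (RatFunc k) p := by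
  have hr' : r ∈ Subalgebra.toSubmodule (reesAlg k s ν) := hr
  clear hr
  rw [reesAlg, Algebra.adjoin_eq_span] at hr'
  induction hr' using Submodule.span_induction with
  | mem x hx =>
    have : x ∈ (scaledIncl k s ν).range := by
      induction hx using Submonoid.closure_induction with
      | mem x hx =>
        obtain ⟨i, rfl⟩ := hx
        exact ⟨FreeAlgebra.ι k i, FreeAlgebra.lift_ι_apply _ _⟩
      | one => exact one_mem _
      | mul x y _ _ h1 h2 => exact mul_mem h1 h2
    obtain ⟨t, rfl⟩ := this
    exact ⟨Polynomial.C (χ t), by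
      rw [AlgHom.toRingHom_eq_coe, RingHom.coe_coe, extendFunctional_scaledIncl,
        RatFunc.algebraMap_C]
      rfl⟩
  | zero => exact ⟨0, by rw [map_zero, map_zero]⟩
  | add x y _ _ h1 h2 =>
    obtain ⟨p, hp⟩ := h1
    obtain ⟨q, hq⟩ := h2
    exact ⟨p + q, by rw [map_add, map_add, hp, hq]⟩
  | smul c x _ h =>
    obtain ⟨p, hp⟩ := h
    exact ⟨c * p, by
      rw [← algebraMap_smul (RatFunc k) c x, map_smul, hp, smul_eq_mul, map_mul]⟩

end rees

/-! ### Hopf orders over a Dedekind domain -/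

section compare
variable {R : Type*} {K : Type*} [CommRing R] [Field K] [Algebra R K]
  [IsFractionRing R K]

/-- Let `V` and `W` be vector spaces over the fraction field `K` of `R`, and `M → V` and `N → W`
linear maps of `R`-modules. This is the map `M ⊗_R N → V ⊗_K W`. -/
noncomputable def tensorCompare {M N V W : Type*} [AddCommGroup M] [AddCommGroup N] [AddCommGroup V]
    [AddCommGroup W] [Module R M] [Module R N] [Module R V] [Module R W] [Module K V] [Module K W]
    [IsScalarTower R K V] [IsScalarTower R K W] (f : M →ₗ[R] V) (g : N →ₗ[R] W) :
    M ⊗[R] N →ₗ[R] V ⊗[K] W :=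
  ((IsLocalization.moduleTensorEquiv (nonZeroDivisors R)
    K V W).symm.toLinearMap.restrictScalars R) ∘ₗ
    TensorProduct.map f g

variable {M N V W : Type*} [AddCommGroup M] [AddCommGroup N] [AddCommGroup V]
    [AddCommGroup W] [Module R M] [Module R N] [Module R V] [Module R W] [Module K V] [Module K W]
    [IsScalarTower R K V] [IsScalarTower R K W]

@[simp]
theorem tensorCompare_tmul (f : M →ₗ[R] V) (g : N →ₗ[R] W) (m : M) (n : N) :
    tensorCompare (K := K) f g (m ⊗ₜ n) = f m ⊗ₜ g n := rfl

/-- As `R` is a Dedekind domain, torsion free modules are flat. -/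
theorem tensorCompare_injective [IsDedekindDomain R] (f : M →ₗ[R] V) (g : N →ₗ[R] W)
    (hf : Function.Injective f)
    (hg : Function.Injective g) : Function.Injective (tensorCompare (K := K) f g) := by
  have h0 : Function.Injective (algebraMap R K) := IsFractionRing.injective R K
  have hV : Module.IsTorsionFree R V := Module.IsTorsionFree.trans_faithfulSMul R K V
  have hW : Module.IsTorsionFree R W := Module.IsTorsionFree.trans_faithfulSMul R K W
  have hN : Module.IsTorsionFree R N := hg.moduleIsTorsionFree g (map_smul g)
  refine (LinearEquiv.injective
    (IsLocalization.moduleTensorEquiv (nonZeroDivisors R) K V W).symm).comp ?_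
  have : TensorProduct.map f g = (LinearMap.lTensor V g) ∘ₗ (LinearMap.rTensor N f) := by
    rw [LinearMap.lTensor_comp_rTensor]
  rw [this]
  exact (Module.Flat.lTensor_preserves_injective_linearMap g hg).comp
    (Module.Flat.rTensor_preserves_injective_linearMap f hf)

end compare

section hopfOrder
variable {R : Type*} {K : Type*} [CommRing R] [Field K] [Algebra R K]
  {H : Type*} [Ring H] [HopfAlgebra K H] [Algebra R H] [IsScalarTower R K H]

/-- The map `A ⊗_R A → H ⊗_K H`. -/
noncomputable def orderTensor (K : Type*) [Field K] [Algebra R K] {H : Type*} [Ring H] [Algebra K H]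
    [Algebra R H] [IsScalarTower R K H] (A : Subalgebra R H) : A ⊗[R] A →ₐ[R] H ⊗[K] H :=
  Algebra.TensorProduct.lift
    (((Algebra.TensorProduct.includeLeft : H →ₐ[K] H ⊗[K] H).restrictScalars R).comp A.val)
    (((Algebra.TensorProduct.includeRight : H →ₐ[K] H ⊗[K] H).restrictScalars R).comp A.val)
    (fun x y => by
      rw [commute_iff_eq]
      simp [Algebra.TensorProduct.tmul_mul_tmul])

@[simp]
theorem orderTensor_tmul (A : Subalgebra R H) (a b : A) :
    orderTensor K A (a ⊗ₜ b) = (a : H) ⊗ₜ (b : H) := by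
  rw [orderTensor, Algebra.TensorProduct.lift_tmul]
  simp

variable [IsFractionRing R K]

theorem orderTensor_injective [IsDedekindDomain R] (A : Subalgebra R H) :
    Function.Injective (orderTensor K A) := by
  have : (orderTensor K A).toLinearMap =
      tensorCompare (K := K) A.val.toLinearMap A.val.toLinearMap := by
    ext a b; simp
  have h2 := tensorCompare_injective (K := K) A.val.toLinearMap A.val.toLinearMap
    Subtype.val_injective Subtype.val_injective
  rw [← this] at h2
  exact h2

/-- The subalgebra `A` of the Hopf algebra `H` is closed under the structure maps, over `R`. -/
structure IsHopfOrder (K : Type*) [Field K] [Algebra R K] {H : Type*} [Ring H] [HopfAlgebra K H]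
    [Algebra R H] [IsScalarTower R K H] (A : Subalgebra R H) : Prop where
  comul : ∀ x ∈ A, Coalgebra.comul (R := K) x ∈ (orderTensor K A).range
  counit : ∀ x ∈ A, ∃ r : R, (Coalgebra.counit x : K) = algebraMap R K r
  antipode : ∀ x ∈ A, HopfAlgebra.antipode K x ∈ A

namespace IsHopfOrder
variable {A : Subalgebra R H} (h : IsHopfOrder K A)

/-- The counit of a Hopf order. -/
noncomputable def counitHom : A →ₐ[R] R :=
  ((AlgEquiv.ofInjective (Algebra.ofId R K) (IsFractionRing.injective R K)).symm : _ →ₐ[R] R).comp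
    ((((Bialgebra.counitAlgHom K H).restrictScalars R).comp A.val).codRestrict
      (Algebra.ofId R K).range
      fun x => by
        obtain ⟨r, hr⟩ := h.counit x x.2
        exact ⟨r, hr.symm⟩)

theorem algebraMap_counitHom (a : A) : algebraMap R K (h.counitHom a) =
    Coalgebra.counit (a : H) := by
  have := AlgEquiv.apply_symm_apply (AlgEquiv.ofInjective (Algebra.ofId R K)
    (IsFractionRing.injective R K))
    ((((Bialgebra.counitAlgHom K H).restrictScalars R).comp A.val).codRestrict
      (Algebra.ofId R K).range
      (fun x => by
        obtain ⟨r, hr⟩ := h.counit x x.2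
        exact ⟨r, hr.symm⟩) a)
  exact congr_arg Subtype.val this

/-- The antipode of a Hopf order. -/
noncomputable def antipodeMap : A →ₗ[R] A :=
  ((HopfAlgebra.antipode K (A := H)).restrictScalars R).restrict (p := Subalgebra.toSubmodule A)
    (q := Subalgebra.toSubmodule A) h.antipode

theorem coe_antipodeMap (a : A) : (h.antipodeMap a : H) = HopfAlgebra.antipode K (a : H) := rfl

/-- The map `A ⊗_R (A ⊗_R A) → H ⊗_K (H ⊗_K H)`. -/
noncomputable def tensor₃ (K : Type*) [Field K] [Algebra R K]
    [IsFractionRing R K] {H : Type*} [Ring H] [HopfAlgebra K H] [Algebra R H] [IsScalarTower R K H]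
    (A : Subalgebra R H) : A ⊗[R] (A ⊗[R] A) →ₗ[R] H ⊗[K] (H ⊗[K] H) :=
  tensorCompare (K := K) A.val.toLinearMap (orderTensor K A).toLinearMap

theorem tensor₃_assoc (u : A ⊗[R] A) (b : A) :
    tensor₃ K A (TensorProduct.assoc R A A A (u ⊗ₜ b)) =
      TensorProduct.assoc K H H H (orderTensor K A u ⊗ₜ (b : H)) := by
  induction u with
  | zero =>
    rw [TensorProduct.zero_tmul, LinearEquiv.map_zero, LinearMap.map_zero,
      map_zero (orderTensor K A),
      TensorProduct.zero_tmul, LinearEquiv.map_zero]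
  | add x y hx hy => rw [TensorProduct.add_tmul, map_add, map_add, hx, hy, map_add,
      TensorProduct.add_tmul, map_add]
  | tmul x y => simp [tensor₃]

variable [IsDedekindDomain R]

/-- The coproduct of a Hopf order. -/
noncomputable def comulHom : A →ₐ[R] A ⊗[R] A :=
  ((AlgEquiv.ofInjective (orderTensor K A) (orderTensor_injective A)).symm : _ →ₐ[R] A ⊗[R] A).comp
    ((((Bialgebra.comulAlgHom K H).restrictScalars R).comp A.val).codRestrict
      (orderTensor K A).range
      fun x => h.comul x x.2)

theorem orderTensor_comulHom (a : A) :
    orderTensor K A (h.comulHom a) = Coalgebra.comul (R := K) (a : H) := by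
  have := AlgEquiv.apply_symm_apply (AlgEquiv.ofInjective (orderTensor K A)
    (orderTensor_injective A))
    ((((Bialgebra.comulAlgHom K H).restrictScalars R).comp A.val).codRestrict
      (orderTensor K A).range
      (fun x => h.comul x x.2) a)
  exact congr_arg Subtype.val this

theorem tensor₃_injective (A : Subalgebra R H) : Function.Injective (tensor₃ K A) :=
  tensorCompare_injective _ _ Subtype.val_injective (orderTensor_injective A)

theorem coassoc (a : A) :
    TensorProduct.assoc R A A A (TensorProduct.map h.comulHom.toLinearMap .id (h.comulHom a)) =
      TensorProduct.map .id h.comulHom.toLinearMap (h.comulHom a) := by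
  have h1 : ∀ u : A ⊗[R] A, tensor₃ K A (TensorProduct.assoc R A A A
      (TensorProduct.map h.comulHom.toLinearMap .id u)) =
      TensorProduct.assoc K H H H ((Coalgebra.comul (R := K) (A := H)).rTensor H
        (orderTensor K A u)) := by
    intro u
    induction u with
    | zero => simp only [LinearEquiv.map_zero, LinearMap.map_zero, map_zero (orderTensor K A)]
    | add x y hx hy => simp only [map_add, hx, hy]
    | tmul x y =>
      rw [TensorProduct.map_tmul, LinearMap.id_apply, tensor₃_assoc, AlgHom.toLinearMap_apply,
        orderTensor_comulHom, orderTensor_tmul, LinearMap.rTensor_tmul]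
  have h2 : ∀ u : A ⊗[R] A, tensor₃ K A (TensorProduct.map .id h.comulHom.toLinearMap u) =
      (Coalgebra.comul (R := K) (A := H)).lTensor H (orderTensor K A u) := by
    intro u
    induction u with
    | zero => simp only [LinearMap.map_zero, map_zero (orderTensor K A)]
    | add x y hx hy => simp only [map_add, hx, hy]
    | tmul x y =>
      rw [TensorProduct.map_tmul, LinearMap.id_apply, tensor₃, tensorCompare_tmul,
        AlgHom.toLinearMap_apply, AlgHom.toLinearMap_apply, AlgHom.toLinearMap_apply,
        orderTensor_comulHom, orderTensor_tmul, LinearMap.lTensor_tmul]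
      rfl
  apply tensor₃_injective (K := K)
  rw [h1, h2, orderTensor_comulHom, Coalgebra.coassoc_apply]

theorem counit_rTensor (a : A) :
    TensorProduct.map h.counitHom.toLinearMap .id (h.comulHom a) = 1 ⊗ₜ a := by
  have h1 : ∀ u : A ⊗[R] A, ((TensorProduct.lid R A
      (TensorProduct.map h.counitHom.toLinearMap .id u) : A) : H) =
      TensorProduct.lid K H
        ((Coalgebra.counit (R := K) (A := H)).rTensor H (orderTensor K A u)) := by
    intro u
    induction u with
    | zero => simp
    | add x y hx hy => simp only [map_add, ← hx, ← hy, AddMemClass.coe_add]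
    | tmul x y =>
      rw [TensorProduct.map_tmul, LinearMap.id_apply, orderTensor_tmul, LinearMap.rTensor_tmul,
        TensorProduct.lid_tmul, TensorProduct.lid_tmul, ← algebraMap_counitHom h x, algebraMap_smul]
      rfl
  apply (TensorProduct.lid R A).injective
  apply Subtype.val_injective
  rw [h1, orderTensor_comulHom, Coalgebra.rTensor_counit_comul]
  simp

theorem counit_lTensor (a : A) :
    TensorProduct.map .id h.counitHom.toLinearMap (h.comulHom a) = a ⊗ₜ 1 := by
  have h1 : ∀ u : A ⊗[R] A, ((TensorProduct.rid R A
      (TensorProduct.map .id h.counitHom.toLinearMap u) : A) : H) =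
      TensorProduct.rid K H
        ((Coalgebra.counit (R := K) (A := H)).lTensor H (orderTensor K A u)) := by
    intro u
    induction u with
    | zero => simp
    | add x y hx hy => simp only [map_add, ← hx, ← hy, AddMemClass.coe_add]
    | tmul x y =>
      rw [TensorProduct.map_tmul, LinearMap.id_apply, orderTensor_tmul, LinearMap.lTensor_tmul,
        TensorProduct.rid_tmul, TensorProduct.rid_tmul, ← algebraMap_counitHom h y, algebraMap_smul]
      rfl
  apply (TensorProduct.rid R A).injective
  apply Subtype.val_injective
  rw [h1, orderTensor_comulHom, Coalgebra.lTensor_counit_comul]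
  simp

theorem antipode_rTensor (a : A) :
    LinearMap.mul' R A (h.antipodeMap.rTensor A (h.comulHom a)) =
      algebraMap R A (h.counitHom a) := by
  have h1 : ∀ u : A ⊗[R] A, (LinearMap.mul' R A (h.antipodeMap.rTensor A u) : H) =
      LinearMap.mul' K H ((HopfAlgebra.antipode K (A := H)).rTensor H (orderTensor K A u)) := by
    intro u
    induction u with
    | zero => simp
    | add x y hx hy => simp only [map_add, ← hx, ← hy, AddMemClass.coe_add]
    | tmul x y => simp [coe_antipodeMap]
  apply Subtype.val_injective
  rw [h1, orderTensor_comulHom, HopfAlgebra.mul_antipode_rTensor_comul_apply,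
    ← algebraMap_counitHom h, ← IsScalarTower.algebraMap_apply]
  rfl

theorem antipode_lTensor (a : A) :
    LinearMap.mul' R A (h.antipodeMap.lTensor A (h.comulHom a)) =
      algebraMap R A (h.counitHom a) := by
  have h1 : ∀ u : A ⊗[R] A, (LinearMap.mul' R A (h.antipodeMap.lTensor A u) : H) =
      LinearMap.mul' K H ((HopfAlgebra.antipode K (A := H)).lTensor H (orderTensor K A u)) := by
    intro u
    induction u with
    | zero => simp
    | add x y hx hy => simp only [map_add, ← hx, ← hy, AddMemClass.coe_add]
    | tmul x y => simp [coe_antipodeMap]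
  apply Subtype.val_injective
  rw [h1, orderTensor_comulHom, HopfAlgebra.mul_antipode_lTensor_comul_apply,
    ← algebraMap_counitHom h, ← IsScalarTower.algebraMap_apply]
  rfl

/-- The Hopf algebra structure of a Hopf order. -/
noncomputable abbrev hopfAlgebra : HopfAlgebra R A :=
  letI : Bialgebra R A := Bialgebra.ofAlgHom h.comulHom h.counitHom
    (AlgHom.ext fun a => h.coassoc a) (AlgHom.ext fun a => h.counit_rTensor a)
    (AlgHom.ext fun a => h.counit_lTensor a)
  { antipode := h.antipodeMap
    mul_antipode_rTensor_comul := LinearMap.ext fun a => h.antipode_rTensor a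
    mul_antipode_lTensor_comul := LinearMap.ext fun a => h.antipode_lTensor a }

end IsHopfOrder
end hopfOrder

/-! ### Specialization at `ħ = 0` -/

section specialize

/-- The `k[ħ]`-Hopf algebra `A` is torsion free and commutative modulo `ħ`. -/
class IsQuantization (k : Type*) [Field k] (A : Type*) [Ring A] [Algebra k[X] A] : Prop where
  comm : ∀ a b : A, ∃ c : A, a * b - b * a = (Polynomial.X : k[X]) • c
  torsionFree : Module.IsTorsionFree k[X] A

variable {k : Type*} [Field k]

/-- The ground field as a `k[ħ]`-algebra, with `ħ` acting by zero. -/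
noncomputable abbrev evalAlgebra (k : Type*) [Field k] : Algebra k[X] k :=
  (Polynomial.evalRingHom 0).toAlgebra

attribute [local instance] evalAlgebra

theorem eval_smul (p : k[X]) (c : k) : p • c = p.eval 0 * c := rfl

instance : IsScalarTower k k[X] k := ⟨fun a p c => by
  rw [eval_smul, eval_smul, Polynomial.eval_smul, smul_eq_mul, smul_eq_mul, mul_assoc]⟩

/-- The specialization `A / ħ A`, as the base change of `A` along `k[ħ] → k`, `ħ ↦ 0`. -/
def Specialization (k : Type*) [Field k] (A : Type*) [Ring A] [Algebra k[X] A] :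
    Type _ := k ⊗[k[X]] A

variable {A : Type*} [Ring A]

section alg
variable [Algebra k[X] A]

noncomputable instance : Ring (Specialization k A) := inferInstanceAs (Ring (k ⊗[k[X]] A))

noncomputable instance : Algebra k (Specialization k A) := inferInstanceAs (Algebra k (k ⊗[k[X]] A))

/-- The specialization map `A → A / ħ A`. -/
noncomputable def spec (k : Type*) [Field k] (A : Type*) [Ring A] [Algebra k[X] A] :
    A →+* Specialization k A :=
  ((Algebra.TensorProduct.includeRight : A →ₐ[k[X]] k ⊗[k[X]] A) : A →+* k ⊗[k[X]] A)

theorem spec_apply (a : A) : spec k A a = ((1 : k) ⊗ₜ[k[X]] a : k ⊗[k[X]] A) := rfl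

theorem spec_smul (p : k[X]) (a : A) : spec k A (p • a) = p.eval 0 • spec k A a := by
  have h : (1 : k) ⊗ₜ[k[X]] (p • a) = p.eval 0 • ((1 : k) ⊗ₜ[k[X]] a) := by
    rw [← TensorProduct.smul_tmul, TensorProduct.smul_tmul', eval_smul, smul_eq_mul]
  exact h

theorem spec_X_smul (a : A) : spec k A ((Polynomial.X : k[X]) • a) = 0 := by
  rw [spec_smul, Polynomial.eval_X, zero_smul]

theorem spec_surjective : Function.Surjective (spec k A) := by
  intro f
  change k ⊗[k[X]] A at f
  induction f with
  | zero => exact ⟨0, map_zero _⟩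
  | add x y hx hy =>
    obtain ⟨a, rfl⟩ := hx
    obtain ⟨b, rfl⟩ := hy
    exact ⟨a + b, map_add _ _ _⟩
  | tmul c a =>
    refine ⟨Polynomial.C c • a, ?_⟩
    rw [spec_apply, ← TensorProduct.smul_tmul, eval_smul, Polynomial.eval_C, mul_one]

theorem spec_eq_zero_iff (a : A) : spec k A a = 0 ↔ ∃ c : A, a = (Polynomial.X : k[X]) • c := by
  constructor
  · intro h
    set N : Submodule k[X] A := LinearMap.range (LinearMap.lsmul k[X] A Polynomial.X)
    have hN : ∀ (p : k[X]) (b : A), N.mkQ (p • b) = N.mkQ (Polynomial.C (p.eval 0) • b) := by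
      intro p b
      rw [← sub_eq_zero, ← map_sub, ← sub_smul, Submodule.mkQ_apply, Submodule.Quotient.mk_eq_zero]
      have : Polynomial.X ∣ p - Polynomial.C (p.eval 0) := by
        rw [Polynomial.X_dvd_iff, Polynomial.coeff_sub, Polynomial.coeff_C_zero,
          Polynomial.coeff_zero_eq_eval_zero, sub_self]
      obtain ⟨q, hq⟩ := this
      exact ⟨q • b, by rw [hq, mul_smul]; rfl⟩
    let f : k →ₗ[k[X]] A →ₗ[k[X]] (A ⧸ N) := LinearMap.mk₂ k[X]
      (fun c b => N.mkQ (Polynomial.C c • b))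
      (fun c d b => by rw [map_add, add_smul, map_add])
      (fun p c b => by
        rw [eval_smul, map_mul, mul_smul, ← map_smul, hN p])
      (fun c b d => by rw [smul_add, map_add])
      (fun p c b => by rw [smul_comm, map_smul])
    have h1 : TensorProduct.lift f ((1 : k) ⊗ₜ[k[X]] a) = 0 := by
      have h' : (1 : k) ⊗ₜ[k[X]] a = 0 := h
      rw [h', map_zero]
    rw [TensorProduct.lift.tmul, LinearMap.mk₂_apply, map_one, one_smul, Submodule.mkQ_apply,
      Submodule.Quotient.mk_eq_zero] at h1
    obtain ⟨c, hc⟩ := h1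
    exact ⟨c, hc.symm⟩
  · rintro ⟨c, rfl⟩
    exact spec_X_smul c

variable [IsQuantization k A]

theorem X_smul_injective {M : Type*} [AddCommGroup M] [Module k[X] M] [Module.IsTorsionFree k[X] M]
    {x y : M} (h : (Polynomial.X : k[X]) • x = (Polynomial.X : k[X]) • y) : x = y :=
  smul_right_injective M Polynomial.X_ne_zero h

noncomputable instance : CommRing (Specialization k A) where
  mul_comm f g := by
    obtain ⟨a, rfl⟩ := spec_surjective f
    obtain ⟨b, rfl⟩ := spec_surjective g
    obtain ⟨c, hc⟩ := IsQuantization.comm (k := k) a b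
    rw [← sub_eq_zero, ← map_mul, ← map_mul, ← map_sub, hc, spec_X_smul]

/-- The bracket `ħ⁻¹ (a b - b a)` on `A`. -/
noncomputable def quantumBr (k : Type*) [Field k] (A : Type*) [Ring A] [Algebra k[X] A]
    [IsQuantization k A] : A →ₗ[k[X]] A →ₗ[k[X]] A :=
  have : Module.IsTorsionFree k[X] A := IsQuantization.torsionFree
  LinearMap.mk₂ k[X] (fun a b => (IsQuantization.comm (k := k) a b).choose)
    (fun a b c => X_smul_injective (k := k) (by
      rw [smul_add, ← (IsQuantization.comm (k := k) _ _).choose_spec,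
        ← (IsQuantization.comm (k := k) _ _).choose_spec,
        ← (IsQuantization.comm (k := k) _ _).choose_spec]
      noncomm_ring))
    (fun p a b => X_smul_injective (k := k) (by
      rw [smul_comm (Polynomial.X : k[X]) p, ← (IsQuantization.comm (k := k) _ _).choose_spec,
        ← (IsQuantization.comm (k := k) _ _).choose_spec, smul_sub, smul_mul_assoc, mul_smul_comm]))
    (fun a b c => X_smul_injective (k := k) (by
      rw [smul_add, ← (IsQuantization.comm (k := k) _ _).choose_spec,
        ← (IsQuantization.comm (k := k) _ _).choose_spec,
        ← (IsQuantization.comm (k := k) _ _).choose_spec]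
      noncomm_ring))
    (fun p a b => X_smul_injective (k := k) (by
      rw [smul_comm (Polynomial.X : k[X]) p, ← (IsQuantization.comm (k := k) _ _).choose_spec,
        ← (IsQuantization.comm (k := k) _ _).choose_spec, smul_sub, smul_mul_assoc, mul_smul_comm]))

theorem X_smul_quantumBr (a b : A) : (Polynomial.X : k[X]) • quantumBr k A a b = a * b - b * a :=
  (IsQuantization.comm (k := k) a b).choose_spec.symm

theorem quantumBr_eq {a b c : A} (h : a * b - b * a = (Polynomial.X : k[X]) • c) :
    quantumBr k A a b = c := by
  have : Module.IsTorsionFree k[X] A := IsQuantization.torsionFree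
  exact X_smul_injective (by rw [X_smul_quantumBr, h])

/-- The bracket on the specialization. -/
noncomputable def specBr (k : Type*) [Field k] (A : Type*) [Ring A] [Algebra k[X] A]
    [IsQuantization k A] :
    Specialization k A →ₗ[k] Specialization k A →ₗ[k] Specialization k A :=
  LinearMap.BilinMap.baseChange k (quantumBr k A)

theorem specBr_spec (a b : A) :
    specBr k A (spec k A a) (spec k A b) = spec k A (quantumBr k A a b) := by
  have h : LinearMap.BilinMap.baseChange k (quantumBr k A) ((1 : k) ⊗ₜ[k[X]] a)
      ((1 : k) ⊗ₜ[k[X]] b) = (1 : k) ⊗ₜ[k[X]] (quantumBr k A a b) := by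
    rw [LinearMap.BilinMap.baseChange_tmul, mul_one]
  exact h

/-- The Poisson bracket on the specialization. -/
noncomputable def specPoisson (k : Type*) [Field k] (A : Type*) [Ring A] [Algebra k[X] A]
    [IsQuantization k A] : PoissonBracket k (Specialization k A) where
  br := specBr k A
  self f := by
    obtain ⟨a, rfl⟩ := spec_surjective f
    rw [specBr_spec, quantumBr_eq (c := 0) (by rw [sub_self, smul_zero]), map_zero]
  jacobi f g h := by
    have : Module.IsTorsionFree k[X] A := IsQuantization.torsionFree
    obtain ⟨a, rfl⟩ := spec_surjective f
    obtain ⟨b, rfl⟩ := spec_surjective g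
    obtain ⟨c, rfl⟩ := spec_surjective h
    simp only [specBr_spec, ← map_add]
    convert map_zero (spec k A)
    have h2 : ∀ a b c : A, (Polynomial.X : k[X]) • (Polynomial.X : k[X]) •
        quantumBr k A a (quantumBr k A b c) = a * (b * c - c * b) - (b * c - c * b) * a := by
      intro a b c
      rw [X_smul_quantumBr, smul_sub, ← mul_smul_comm, ← smul_mul_assoc, X_smul_quantumBr]
    refine X_smul_injective (k := k) (X_smul_injective (k := k) ?_)
    simp only [smul_add, h2, smul_zero]
    noncomm_ring
  leibniz f g h := by
    have : Module.IsTorsionFree k[X] A := IsQuantization.torsionFree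
    obtain ⟨a, rfl⟩ := spec_surjective f
    obtain ⟨b, rfl⟩ := spec_surjective g
    obtain ⟨c, rfl⟩ := spec_surjective h
    rw [← map_mul, specBr_spec, specBr_spec, specBr_spec, ← map_mul, ← map_mul, ← map_add]
    congr 1
    refine quantumBr_eq ?_
    rw [smul_add, ← smul_mul_assoc, ← mul_smul_comm, X_smul_quantumBr, X_smul_quantumBr]
    noncomm_ring

theorem specPoisson_spec (a b : A) :
    (specPoisson k A).br (spec k A a) (spec k A b) = spec k A (quantumBr k A a b) :=
  specBr_spec a b

end alg

section hopf
variable [HopfAlgebra k[X] A]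

/-- The tensor square of the specialization map. -/
noncomputable def spec₂ (k : Type*) [Field k] (A : Type*) [Ring A] [Algebra k[X] A] :
    A ⊗[k[X]] A →+ Specialization k A ⊗[k] Specialization k A :=
  TensorProduct.liftAddHom
    { toFun := fun a =>
        { toFun := fun b => spec k A a ⊗ₜ[k] spec k A b
          map_zero' := by rw [map_zero, TensorProduct.tmul_zero]
          map_add' := fun b c => by rw [map_add, TensorProduct.tmul_add] }
      map_zero' := by ext; simp
      map_add' := fun a b => by ext; simp [TensorProduct.add_tmul] }
    (fun p a b => by simp [spec_smul, TensorProduct.smul_tmul])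

theorem spec₂_tmul (a b : A) : spec₂ k A (a ⊗ₜ b) = spec k A a ⊗ₜ spec k A b := rfl

variable [IsQuantization k A]

noncomputable instance : HopfAlgebra k (Specialization k A) :=
  inferInstanceAs (HopfAlgebra k (k ⊗[k[X]] A))

theorem comul_spec (a : A) :
    Coalgebra.comul (R := k) (spec k A a) = spec₂ k A (Coalgebra.comul (R := k[X]) a) := by
  have h : ∀ u : A ⊗[k[X]] A, TensorProduct.AlgebraTensorModule.tensorTensorTensorComm k[X] k k[X] k
      k k A A (((1 : k) ⊗ₜ[k] (1 : k)) ⊗ₜ[k[X]] u) = spec₂ k A u := by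
    intro u
    induction u with
    | zero => rw [TensorProduct.tmul_zero, map_zero, map_zero]; rfl
    | add x y hx hy => rw [TensorProduct.tmul_add, map_add, map_add, hx, hy]; rfl
    | tmul x y => rfl
  rw [← h]
  exact TensorProduct.comul_tmul (1 : k) a

theorem counit_spec (a : A) :
    (Coalgebra.counit (spec k A a) : k) = (Coalgebra.counit a : k[X]).eval 0 := by
  have h : (Coalgebra.counit ((1 : k) ⊗ₜ[k[X]] a) : k) = (Coalgebra.counit a : k[X]) • (1 : k) := by
    rw [TensorProduct.counit_tmul]; simp
  rw [eval_smul, mul_one] at h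
  exact h

theorem antipode_spec (a : A) :
    HopfAlgebra.antipode k (spec k A a) = spec k A (HopfAlgebra.antipode k[X] a) := by
  have h : HopfAlgebra.antipode k ((1 : k) ⊗ₜ[k[X]] a) =
      (1 : k) ⊗ₜ[k[X]] (HopfAlgebra.antipode k[X] a) := by
    rw [TensorProduct.antipode_def]
    simp
  exact h

/-- The bracket on `F ⊗ F` is the one induced by the commutator on `A ⊗ A`. -/
theorem exists_spec₂_eq_tensor (u v : A ⊗[k[X]] A) : ∃ w : A ⊗[k[X]] A,
    u * v - v * u = (Polynomial.X : k[X]) • w ∧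
      spec₂ k A w = (specPoisson k A).tensor (spec₂ k A u) (spec₂ k A v) := by
  induction u with
  | zero => exact ⟨0, by rw [zero_mul, mul_zero, sub_zero, smul_zero], by
      rw [map_zero, map_zero, LinearMap.zero_apply]⟩
  | add x y hx hy =>
    obtain ⟨a, ha, ha'⟩ := hx
    obtain ⟨b, hb, hb'⟩ := hy
    exact ⟨a + b, by rw [smul_add, ← ha, ← hb, add_mul, mul_add, add_sub_add_comm], by
      rw [map_add, map_add, map_add, LinearMap.add_apply, ha', hb']⟩
  | tmul a b =>
    induction v with
    | zero => exact ⟨0, by rw [zero_mul, mul_zero, sub_zero, smul_zero], by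
        rw [map_zero, map_zero]⟩
    | add x y hx hy =>
      obtain ⟨a, ha, ha'⟩ := hx
      obtain ⟨b, hb, hb'⟩ := hy
      exact ⟨a + b, by rw [smul_add, ← ha, ← hb, add_mul, mul_add, add_sub_add_comm], by
        rw [map_add, map_add, map_add, ha', hb']⟩
    | tmul c d =>
      refine ⟨quantumBr k A a c ⊗ₜ (b * d) + (c * a) ⊗ₜ quantumBr k A b d, ?_, ?_⟩
      · rw [smul_add, TensorProduct.smul_tmul', ← TensorProduct.tmul_smul, X_smul_quantumBr,
          X_smul_quantumBr, Algebra.TensorProduct.tmul_mul_tmul,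
            Algebra.TensorProduct.tmul_mul_tmul,
          TensorProduct.sub_tmul, TensorProduct.tmul_sub, sub_add_sub_cancel]
      · rw [map_add, spec₂_tmul, spec₂_tmul, spec₂_tmul, spec₂_tmul, PoissonBracket.tensor,
          LinearMap.add_apply, LinearMap.add_apply, TensorProduct.map₂_apply_tmul,
          TensorProduct.map₂_apply_tmul, TensorProduct.map_tmul, TensorProduct.map_tmul,
          specPoisson_spec, specPoisson_spec, LinearMap.mul_apply',
          LinearMap.mul_apply', map_mul, map_mul, mul_comm (spec k A c)]

/-- The coproduct of `A` is multiplicative, hence commutes with `ħ⁻¹` times the commutator. -/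
theorem specPoisson_isPoissonHopf : (specPoisson k A).IsPoissonHopf := by
  have : Module.IsTorsionFree k[X] A := IsQuantization.torsionFree
  intro f g
  obtain ⟨a, rfl⟩ := spec_surjective f
  obtain ⟨b, rfl⟩ := spec_surjective g
  obtain ⟨w, hw, hw'⟩ := exists_spec₂_eq_tensor (k := k) (Coalgebra.comul (R := k[X]) a)
    (Coalgebra.comul (R := k[X]) b)
  rw [specPoisson_spec, comul_spec, comul_spec, comul_spec, ← hw']
  congr 1
  refine X_smul_injective (k := k) ?_
  rw [← hw, ← map_smul, X_smul_quantumBr, map_sub, Bialgebra.comul_mul, Bialgebra.comul_mul]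

end hopf

end specialize

/-! ### The specialization of the order -/

section specOrder
variable {k : Type u} [Field k] {s : ℕ} {ν : ℕ∞}

/-- Induction for elements of the order by reduction to homogeneous elements. -/
theorem order_induction {p : (x : HK k s ν) → x ∈ order k s ν → Prop}
    (mem : ∀ w x (hx : x ∈ orderGr k s ν w), p x (orderGr_le_order w x hx))
    (add : ∀ x y hx hy, p x hx → p y hy → p (x + y) (add_mem hx hy)) {x : HK k s ν}
    (hx : x ∈ order k s ν) : p x hx := by
  suffices h : ∃ h, p x h from h.2
  have h := mem_iSup_orderGr hx
  clear hx
  induction h using Submodule.iSup_induction' with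
  | zero => exact ⟨_, mem 0 0 (zero_mem _)⟩
  | add x x' _ _ h h' => exact ⟨_, add _ _ _ _ h.2 h'.2⟩
  | mem i x hx => exact ⟨_, mem i x hx⟩

theorem isHopfOrder_order : IsHopfOrder (RatFunc k) (order k s ν) where
  comul x hx := by
    induction hx using order_induction with
    | mem w x hx =>
      have h : tensorGr (orderGr k s ν) w ≤
          Subalgebra.toSubmodule (orderTensor (RatFunc k) (order k s ν)).range := by
        refine Submodule.span_le.2 ?_
        rintro _ ⟨i, j, -, y, hy, z, hz, rfl⟩
        exact ⟨(⟨y, orderGr_le_order _ _ hy⟩ : order k s ν) ⊗ₜ ⟨z, orderGr_le_order _ _ hz⟩,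
          orderTensor_tmul _ _ _⟩
      exact h (comul_mem_orderGr w x hx)
    | add x y _ _ hx hy => rw [map_add]; exact add_mem hx hy
  counit x hx := counit_order hx
  antipode x hx := by
    induction hx using order_induction with
    | mem w x hx => exact orderGr_le_order w _ (antipode_mem_orderGr w x hx)
    | add x y _ _ hx hy => rw [map_add]; exact add_mem hx hy

noncomputable instance : HopfAlgebra k[X] (order k s ν) := isHopfOrder_order.hopfAlgebra

theorem order_comm {x y : HK k s ν} (hx : x ∈ order k s ν) (hy : y ∈ order k s ν) :
    ∃ c ∈ order k s ν, x * y - y * x = (Polynomial.X : k[X]) • c := by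
  induction hx using order_induction with
  | mem i x hx =>
    induction hy using order_induction with
    | mem j y hy =>
      obtain ⟨c, hc, h⟩ := orderGr_comm i j x y hx hy
      exact ⟨c, orderGr_le_order _ c hc, h⟩
    | add y z _ _ hy hz =>
      obtain ⟨c, hc, h⟩ := hy
      obtain ⟨d, hd, h'⟩ := hz
      exact ⟨c + d, add_mem hc hd, by rw [smul_add, ← h, ← h', mul_add, add_mul, add_sub_add_comm]⟩
  | add x z _ _ hx hz =>
    obtain ⟨c, hc, h⟩ := hx
    obtain ⟨d, hd, h'⟩ := hz
    exact ⟨c + d, add_mem hc hd, by rw [smul_add, ← h, ← h', mul_add, add_mul, add_sub_add_comm]⟩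

instance : Module.IsTorsionFree k[X] (HK k s ν) :=
  Module.IsTorsionFree.trans_faithfulSMul k[X] (RatFunc k) (HK k s ν)

instance : IsQuantization k (order k s ν) where
  comm a b := by
    obtain ⟨c, hc, h⟩ := order_comm a.2 b.2
    exact ⟨⟨c, hc⟩, Subtype.ext h⟩
  torsionFree := Subtype.val_injective.moduleIsTorsionFree (order k s ν).val
    (map_smul (order k s ν).val)

/-- The specialization map of the order, as a morphism of `k`-algebras. -/
noncomputable def orderSpec (k : Type u) [Field k] (s : ℕ) (ν : ℕ∞) :
    order k s ν →ₐ[k] Specialization k (order k s ν) :=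
  { spec k (order k s ν) with
    commutes' := fun c => by
      change spec k (order k s ν) (algebraMap k (order k s ν) c) = _
      rw [IsScalarTower.algebraMap_apply k k[X] (order k s ν), Algebra.algebraMap_eq_smul_one,
        spec_smul, map_one, Algebra.algebraMap_eq_smul_one]
      rw [Polynomial.eval_smul, Polynomial.eval_one, smul_eq_mul, mul_one]
      exact (Algebra.algebraMap_eq_smul_one c).symm }

theorem orderSpec_apply (a : order k s ν) : orderSpec k s ν a = spec k (order k s ν) a := rfl

/-- The reduction of the order is a specialization in the sense of the elementwise conditions,
which refer to the structure maps of `H(ħ)`. -/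
theorem isSpecialization_orderSpec :
    IsSpecialization (order k s ν) (specPoisson k (order k s ν)) (orderSpec k s ν) where
  surjective := spec_surjective
  ker := spec_eq_zero_iff
  comul a l h := by
    have h' : Coalgebra.comul (R := k[X]) a = (l.map fun p => p.1 ⊗ₜ[k[X]] p.2).sum := by
      apply orderTensor_injective (K := RatFunc k)
      refine (isHopfOrder_order.orderTensor_comulHom a).trans ?_
      rw [h, map_list_sum, List.map_map]
      congr 1
      refine List.map_congr_left fun p _ => ?_
      exact (orderTensor_tmul _ _ _).symm
    rw [orderSpec_apply, comul_spec, h', map_list_sum, List.map_map]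
    rfl
  counit a r h := by
    rw [orderSpec_apply, counit_spec]
    congr 1
    apply IsFractionRing.injective k[X] (RatFunc k)
    rw [← h]
    exact isHopfOrder_order.algebraMap_counitHom a
  antipode a b h := by
    rw [orderSpec_apply, antipode_spec]
    exact congr_arg (spec k (order k s ν)) (Subtype.ext h)
  bracket a b c h := by
    rw [orderSpec_apply, orderSpec_apply, specPoisson_spec, quantumBr_eq h]
    rfl

/-- The coproduct of an element of the order, as a sum of pure tensors of elements of the order.
-/
theorem exists_comul_eq (a : order k s ν) : ∃ l : List (order k s ν × order k s ν),
    Coalgebra.comul (R := RatFunc k) (a : HK k s ν) =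
      (l.map fun p => (p.1 : HK k s ν) ⊗ₜ[RatFunc k] (p.2 : HK k s ν)).sum := by
  obtain ⟨u, hu⟩ := (isHopfOrder_order (k := k) (s := s) (ν := ν)).comul a a.2
  have h : ∀ u : order k s ν ⊗[k[X]] order k s ν, ∃ l : List (order k s ν × order k s ν),
      orderTensor (RatFunc k) (order k s ν) u =
        (l.map fun p => (p.1 : HK k s ν) ⊗ₜ[RatFunc k] (p.2 : HK k s ν)).sum := by
    intro u
    induction u with
    | zero => exact ⟨[], by rw [map_zero]; rfl⟩
    | tmul x y => exact ⟨[(x, y)], by rw [orderTensor_tmul]; simp⟩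
    | add x y hx hy =>
      obtain ⟨l, hl⟩ := hx
      obtain ⟨l', hl'⟩ := hy
      exact ⟨l ++ l', by rw [map_add, hl, hl', List.map_append, List.sum_append]⟩
  obtain ⟨l, hl⟩ := h u
  exact ⟨l, hu ▸ hl⟩

/-- The map `x ↦ ħ x` from the free Lie algebra to the order. -/
noncomputable def tau (k : Type u) [Field k] (s : ℕ) (ν : ℕ∞) : FL k s ν →ₗ[k] order k s ν :=
  (hlie k s ν).codRestrict ((Subalgebra.toSubmodule (order k s ν)).restrictScalars k) hlie_mem_order

theorem coe_tau (x : FL k s ν) : (tau k s ν x : HK k s ν) = hlie k s ν x := rfl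

theorem tau_lie (x y : FL k s ν) : tau k s ν x * tau k s ν y - tau k s ν y * tau k s ν x =
    (Polynomial.X : k[X]) • tau k s ν ⁅x, y⁆ := Subtype.ext (hlie_lie x y)

theorem adjoin_tau : Algebra.adjoin k[X] (Set.range (tau k s ν)) = ⊤ := by
  have h := Algebra.adjoin_adjoin_coe_preimage (R := k[X]) (s := Set.range (hlie k s ν))
  refine Eq.trans ?_ h
  congr 1
  ext x
  constructor
  · rintro ⟨y, rfl⟩; exact ⟨y, rfl⟩
  · rintro ⟨y, hy⟩; exact ⟨y, Subtype.ext hy⟩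

end specOrder

/-! ### Exponentials of tangent vectors -/

section exponential
variable {k : Type*} [Field k] {F : Type*} [CommRing F] [HopfAlgebra k F]

/-- The functional `ℓ` on the Hopf algebra `F` is a tangent vector at the unit element. -/
structure IsTangent (ℓ : F →ₗ[k] k) : Prop where
  leibniz : ∀ f g, ℓ (f * g) = Coalgebra.counit f * ℓ g + ℓ f * Coalgebra.counit g

/-- The left invariant vector field with value `ℓ` at the unit element. -/
noncomputable def leftField (ℓ : F →ₗ[k] k) : Module.End k F :=
  (TensorProduct.rid k F).toLinearMap ∘ₗ ℓ.lTensor F ∘ₗ Coalgebra.comul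

theorem counit_leftField (ℓ : F →ₗ[k] k) (f : F) :
    (Coalgebra.counit (leftField ℓ f) : k) = ℓ f := by
  have h : ∀ u : F ⊗[k] F, (Coalgebra.counit (TensorProduct.rid k F (ℓ.lTensor F u)) : k) =
      ℓ (TensorProduct.lid k F ((Coalgebra.counit (R := k) (A := F)).rTensor F u)) := by
    intro u
    induction u with
    | zero => simp
    | add x y hx hy => simp only [map_add, hx, hy]
    | tmul x y => simp [mul_comm]
  refine (h _).trans ?_
  rw [Coalgebra.rTensor_counit_comul, TensorProduct.lid_tmul, one_smul]

theorem leftField_mul {ℓ : F →ₗ[k] k} (hℓ : IsTangent ℓ) (f g : F) :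
    leftField ℓ (f * g) = leftField ℓ f * g + f * leftField ℓ g := by
  have h : ∀ u v : F ⊗[k] F, TensorProduct.rid k F (ℓ.lTensor F (u * v)) =
      TensorProduct.rid k F (ℓ.lTensor F u) *
        TensorProduct.rid k F ((Coalgebra.counit (R := k) (A := F)).lTensor F v) +
      TensorProduct.rid k F ((Coalgebra.counit (R := k) (A := F)).lTensor F u) *
        TensorProduct.rid k F (ℓ.lTensor F v) := by
    intro u v
    induction u with
    | zero => simp
    | add x y hx hy => rw [add_mul]; simp only [map_add, hx, hy]; ring
    | tmul a b =>
      induction v with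
      | zero => simp
      | add x y hx hy => rw [mul_add]; simp only [map_add, hx, hy]; ring
      | tmul c d =>
        simp only [Algebra.TensorProduct.tmul_mul_tmul, LinearMap.lTensor_tmul,
          TensorProduct.rid_tmul, hℓ.leibniz, add_smul, mul_smul]
        simp only [Algebra.smul_def]
        ring
  have h' := h (Coalgebra.comul f) (Coalgebra.comul g)
  rw [Coalgebra.lTensor_counit_comul, Coalgebra.lTensor_counit_comul, TensorProduct.rid_tmul,
    TensorProduct.rid_tmul, one_smul, one_smul, ← Bialgebra.comul_mul] at h'
  exact h'

/-- The Leibniz rule for the powers of a left invariant vector field. -/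
theorem leftField_pow_mul {ℓ : F →ₗ[k] k} (hℓ : IsTangent ℓ) (n : ℕ) (f g : F) :
    (leftField ℓ ^ n) (f * g) = ∑ p ∈ antidiagonal n,
      n.choose p.1 • ((leftField ℓ ^ p.1) f * (leftField ℓ ^ p.2) g) := by
  induction n with
  | zero => simp
  | succ n ih =>
    rw [pow_succ', Module.End.mul_apply, ih, map_sum,
      Finset.sum_antidiagonal_choose_succ_nsmul
        (fun i j => (leftField ℓ ^ i) f * (leftField ℓ ^ j) g), ← Finset.sum_add_distrib]
    refine Finset.sum_congr rfl fun p hp => ?_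
    rw [map_nsmul, leftField_mul hℓ, ← Module.End.mul_apply, ← Module.End.mul_apply, ← pow_succ',
      ← pow_succ', smul_add, add_comm]
    congr 2
    rw [HasAntidiagonal.mem_antidiagonal] at hp
    rw [← hp, Nat.choose_symm_add]

theorem leftField_one {ℓ : F →ₗ[k] k} (hℓ : IsTangent ℓ) : leftField ℓ 1 = 0 := by
  have := leftField_mul hℓ 1 1
  simpa using this

/-- The functional `f ↦ ε(exp(t D) f)`, where `D` is the left invariant vector field of `ℓ`. -/
noncomputable def expLin (ℓ : F →ₗ[k] k) : F →ₗ[k] k⟦X⟧ where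
  toFun f := PowerSeries.mk fun n => (n.factorial : k)⁻¹ * Coalgebra.counit ((leftField ℓ ^ n) f)
  map_add' f g := by ext n; simp [mul_add]
  map_smul' c f := by ext n; simp; ring

theorem coeff_expLin (ℓ : F →ₗ[k] k) (f : F) (n : ℕ) : PowerSeries.coeff n (expLin ℓ f) =
    (n.factorial : k)⁻¹ * Coalgebra.counit ((leftField ℓ ^ n) f) :=
  PowerSeries.coeff_mk n fun n => (n.factorial : k)⁻¹ * Coalgebra.counit ((leftField ℓ ^ n) f)

/-- The one-parameter subgroup `t ↦ exp(t ℓ)` with tangent vector `ℓ`, as a point of the group over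
the ring of power series in `t`. -/
noncomputable def expHom [CharZero k] {ℓ : F →ₗ[k] k} (hℓ : IsTangent ℓ) : F →ₐ[k] k⟦X⟧ :=
  AlgHom.ofLinearMap (expLin ℓ)
    (by
      refine PowerSeries.ext fun n => ?_
      rw [coeff_expLin, PowerSeries.coeff_one]
      rcases n with _ | n
      · simp
      · rw [pow_succ, Module.End.mul_apply, leftField_one hℓ]; simp)
    (fun f g => by
      refine PowerSeries.ext fun n => ?_
      rw [coeff_expLin, PowerSeries.coeff_mul, leftField_pow_mul hℓ, map_sum, Finset.mul_sum]
      refine Finset.sum_congr rfl fun p hp => ?_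
      rw [HasAntidiagonal.mem_antidiagonal] at hp
      rw [coeff_expLin, coeff_expLin, map_nsmul, Bialgebra.counit_mul, nsmul_eq_mul, ← hp,
        Nat.cast_add_choose]
      have h1 : ((p.1 + p.2).factorial : k) ≠ 0 := by exact_mod_cast Nat.factorial_ne_zero _
      field_simp)

theorem coeff_expHom [CharZero k] {ℓ : F →ₗ[k] k} (hℓ : IsTangent ℓ) (f : F) (n : ℕ) :
    PowerSeries.coeff n (expHom hℓ f) =
      (n.factorial : k)⁻¹ * Coalgebra.counit ((leftField ℓ ^ n) f) :=
  coeff_expLin ℓ f n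

theorem aeval_mul_of_isHomogeneous {ι B : Type*} [CommRing B] [Algebra k B] (c : B)
    (g : ι → B) {n : ℕ}
    {p : MvPolynomial ι k} (hp : p.IsHomogeneous n) :
    MvPolynomial.aeval (fun i => c * g i) p = c ^ n * MvPolynomial.aeval g p := by
  rw [MvPolynomial.aeval_def, MvPolynomial.aeval_def, MvPolynomial.eval₂_eq, MvPolynomial.eval₂_eq,
    Finset.mul_sum]
  refine Finset.sum_congr rfl fun d hd => ?_
  have := hp (MvPolynomial.mem_support_iff.1 hd)
  simp_rw [mul_pow]
  rw [Finset.prod_mul_distrib, Finset.prod_pow_eq_pow_sum]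
  rw [show ∑ i ∈ d.support, d i = n by rw [← this, Finsupp.weight_apply]; simp [Finsupp.sum]]
  ring

/-- If the coordinates of the tangent vector `ℓ` at the `y_i` do not annihilate the component of
lowest degree of the polynomial `p`, then the function `p(y)` does not vanish to infinite order
along `exp(t ℓ)`. -/
theorem exists_leftField_pow_ne_zero [CharZero k] {ι : Type*} {y : ι → F}
    (hy : ∀ i, (Coalgebra.counit (y i) : k) = 0) {ℓ : F →ₗ[k] k} (hℓ : IsTangent ℓ)
    {p : MvPolynomial ι k} {d : ℕ} (hd : ∀ j < d, MvPolynomial.homogeneousComponent j p = 0)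
    (hp : MvPolynomial.eval (fun i => ℓ (y i)) (MvPolynomial.homogeneousComponent d p) ≠ 0) :
    (Coalgebra.counit ((leftField ℓ ^ d) (MvPolynomial.aeval y p)) : k) ≠ 0 := by
  -- the functions `y i` vanish at the unit element, so along the curve `y i = t (ℓ (y i) + ...)`
  have hX : ∀ i, ∃ g : k⟦X⟧, expHom hℓ (y i) = PowerSeries.X * g := by
    intro i
    refine PowerSeries.X_dvd_iff.2 ?_
    rw [← PowerSeries.coeff_zero_eq_constantCoeff_apply, coeff_expHom]
    simp [hy]
  choose g hg using hX
  have hg0 : ∀ i, PowerSeries.constantCoeff (g i) = ℓ (y i) := by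
    intro i
    have h1 := coeff_expHom hℓ (y i) 1
    rw [hg, pow_one, counit_leftField, Nat.factorial_one, Nat.cast_one, inv_one, one_mul,
      show (1 : ℕ) = 0 + 1 from rfl, PowerSeries.coeff_succ_X_mul,
      PowerSeries.coeff_zero_eq_constantCoeff_apply] at h1
    exact h1
  have h1 : expHom hℓ (MvPolynomial.aeval y p) = ∑ j ∈ range (p.totalDegree + 1),
      PowerSeries.X ^ j * MvPolynomial.aeval g (MvPolynomial.homogeneousComponent j p) := by
    rw [← AlgHom.comp_apply, MvPolynomial.comp_aeval]
    simp_rw [hg]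
    conv_lhs => rw [← MvPolynomial.sum_homogeneousComponent p]
    rw [map_sum]
    exact Finset.sum_congr rfl fun j _ =>
      aeval_mul_of_isHomogeneous _ _ (MvPolynomial.homogeneousComponent_isHomogeneous j p)
  have hd' : d ∈ range (p.totalDegree + 1) := by
    by_contra h
    rw [Finset.mem_range, not_lt] at h
    rw [MvPolynomial.homogeneousComponent_eq_zero _ _ (by omega), map_zero] at hp
    exact hp rfl
  have h2 := coeff_expHom hℓ (MvPolynomial.aeval y p) d
  rw [h1, map_sum, Finset.sum_eq_single_of_mem d hd'] at h2
  · intro h0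
    rw [h0, mul_zero, PowerSeries.coeff_X_pow_mul', if_pos le_rfl, Nat.sub_self,
      PowerSeries.coeff_zero_eq_constantCoeff_apply] at h2
    apply hp
    rw [← h2]
    have : (MvPolynomial.eval fun i => ℓ (y i)) =
        (PowerSeries.constantCoeff (R := k)).comp (MvPolynomial.aeval g : _ →ₐ[k]
          k⟦X⟧).toRingHom := by
      refine MvPolynomial.ringHom_ext (fun c => ?_) (fun i => ?_)
      · simp
      · simp [hg0]
    rw [this]
    rfl
  · intro j _ hj
    rw [PowerSeries.coeff_X_pow_mul']
    split_ifs with h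
    · rw [hd j (by omega), map_zero, map_zero]
    · rfl

end exponential

/-! ### Convolution powers of functionals and the maps `δ_n` -/

section convPow
variable {K : Type*} [Field K] {H : Type*} [Ring H] [HopfAlgebra K H]

/-- The functional `a ↦ ψ(a - ε(a))`. -/
noncomputable def redFun (ψ : H →ₗ[K] K) : H →ₗ[K] K :=
  ψ ∘ₗ (LinearMap.id - Algebra.linearMap K H ∘ₗ Coalgebra.counit)

theorem redFun_apply (ψ : H →ₗ[K] K) (a : H) :
    redFun ψ a = ψ (a - algebraMap K H (Coalgebra.counit a)) := rfl

/-- The `n`-th convolution power of the functional `redFun ψ`. -/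
noncomputable def convPow (ψ : H →ₗ[K] K) : ℕ → H →ₗ[K] K
  | 0 => Coalgebra.counit
  | n + 1 => LinearMap.mul' K K ∘ₗ TensorProduct.map (convPow ψ n) (redFun ψ) ∘ₗ Coalgebra.comul

/-- The functional `ψ ⊗ ... ⊗ ψ` on the tensor power. -/
noncomputable def powFun (ψ : H →ₗ[K] K) (n : ℕ) : (⨂[K]^n H) →ₗ[K] K :=
  PiTensorProduct.lift ((MultilinearMap.mkPiAlgebra K (Fin n) K).compLinearMap fun _ => ψ)

theorem powFun_tprod (ψ : H →ₗ[K] K) (n : ℕ) (v : Fin n → H) :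
    powFun ψ n (PiTensorProduct.tprod K v) = ∏ i, ψ (v i) := by
  rw [powFun, PiTensorProduct.lift.tprod]
  simp

theorem powFun_mulEquiv (ψ : H →ₗ[K] K) (n : ℕ) (t : ⨂[K]^n H) (h : H) :
    powFun ψ (n + 1) (TensorPower.mulEquiv (t ⊗ₜ[K]
      (PiTensorProduct.subsingletonEquiv (R := K) (s := fun _ => H) (0 : Fin 1)).symm h)) =
      powFun ψ n t * ψ h := by
  induction t using PiTensorProduct.induction_on with
  | smul_tprod r v =>
    rw [PiTensorProduct.subsingletonEquiv_symm_apply', ← TensorProduct.smul_tmul', map_smul,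
      ← TensorPower.gMul_def, TensorPower.tprod_mul_tprod, map_smul, powFun_tprod, map_smul,
      powFun_tprod, smul_mul_assoc, Fin.prod_univ_add]
    simp
  | add x y hx hy => rw [TensorProduct.add_tmul, map_add, map_add, hx, hy, map_add, add_mul]

theorem powFun_iterComul (ψ : H →ₗ[K] K) (n : ℕ) (a : H) :
    powFun (redFun ψ) n (iterComul K H n a) = convPow (K := K) ψ n a := by
  induction n generalizing a with
  | zero =>
    simp only [iterComul, convPow, LinearMap.comp_apply, LinearEquiv.coe_coe]
    rw [TensorPower.algebraMap₀_eq_smul_one, map_smul, TensorPower.gOne_def, powFun_tprod]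
    simp
  | succ n ih =>
    simp only [iterComul, convPow, LinearMap.comp_apply, LinearEquiv.coe_coe]
    generalize Coalgebra.comul (R := K) a = t
    induction t with
    | zero => simp
    | add x y hx hy => simp only [map_add, hx, hy]
    | tmul x y =>
      rw [TensorProduct.map_tmul, LinearEquiv.coe_coe, powFun_mulEquiv, ih, TensorProduct.map_tmul,
        LinearMap.mul'_apply]

/-- The functional `ψ ⊗ ... ⊗ ψ` composed with `δ_n` is a convolution power. -/
theorem powFun_delta (ψ : H →ₗ[K] K) (n : ℕ) (a : H) :
    powFun ψ n (delta K H n a) = convPow ψ n a := by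
  rw [← powFun_iterComul, delta, LinearMap.comp_apply]
  generalize iterComul K H n a = t
  induction t using PiTensorProduct.induction_on with
  | smul_tprod r v =>
    simp only [map_smul, PiTensorProduct.map_tprod, powFun_tprod]
    rfl
  | add x y hx hy => simp only [map_add, hx, hy]

end convPow

/-! ### Tangent vectors of the specialization -/

section special
variable {k : Type u} [Field k] {s : ℕ} {ν : ℕ∞} {F : Type v} [CommRing F] [HopfAlgebra k F]
  {P : PoissonBracket k F} {σ : order k s ν →ₐ[k] F}

theorem IsSpecialization.X_smul (hσ : IsSpecialization (order k s ν) P σ) (a : order k s ν) :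
    σ ((Polynomial.X : k[X]) • a) = 0 := (hσ.ker _).2 ⟨a, rfl⟩

theorem IsSpecialization.smul (hσ : IsSpecialization (order k s ν) P σ) (p : k[X])
    (a : order k s ν) : σ (p • a) = p.eval 0 • σ a := by
  conv_lhs => rw [← Polynomial.divX_mul_X_add p, add_smul, mul_comm, mul_smul]
  rw [map_add, hσ.X_smul, zero_add, Polynomial.coeff_zero_eq_eval_zero, ← map_smul]
  exact congr_arg σ (algebraMap_smul k[X] (p.eval 0) a)

theorem IsSpecialization.counit_tau (hσ : IsSpecialization (order k s ν) P σ) (x : FL k s ν) :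
    (Coalgebra.counit (σ (tau k s ν x)) : k) = 0 := by
  rw [hσ.counit _ 0 (by rw [coe_tau, counit_hlie, map_zero]), Polynomial.eval_zero]

theorem IsSpecialization.adjoin_tau (hσ : IsSpecialization (order k s ν) P σ) :
    Algebra.adjoin k (Set.range fun x => σ (tau k s ν x)) = ⊤ := by
  rw [eq_top_iff]
  rintro f -
  obtain ⟨a, rfl⟩ := hσ.surjective f
  have ha : a ∈ Algebra.adjoin k[X] (Set.range (tau k s ν)) := by
    rw [FormalDiff.adjoin_tau]; trivial
  induction ha using Algebra.adjoin_induction with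
  | mem x hx =>
    obtain ⟨x, rfl⟩ := hx
    exact Algebra.subset_adjoin ⟨x, rfl⟩
  | algebraMap r =>
    rw [Algebra.algebraMap_eq_smul_one, hσ.smul, map_one]
    exact Subalgebra.smul_mem _ (one_mem _) _
  | add x y _ _ hx hy => rw [map_add]; exact add_mem hx hy
  | mul x y _ _ hx hy => rw [map_mul]; exact mul_mem hx hy

/-- The functional `ψ` on `H(ħ)` takes polynomial values on the Rees algebra, and induces on the
specialization the tangent vector `ℓ = (ħ⁻¹ ψ(a - ε(a)))|_{ħ = 0}`. -/
structure IsTangentLift (σ : order k s ν →ₐ[k] F) (ψ : HK k s ν →ₗ[RatFunc k] RatFunc k)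
    (ℓ : F →ₗ[k] k) : Prop where
  tangent : IsTangent ℓ
  rees : ∀ r ∈ reesAlg k s ν, ∃ p : k[X], ψ r = algebraMap k[X] (RatFunc k) p
  lift : ∀ a : order k s ν, ∃ p : k[X],
    redFun ψ (a : HK k s ν) = algebraMap k[X] (RatFunc k) (Polynomial.X * p) ∧ p.eval 0 = ℓ (σ a)

theorem map_X_smul (ψ : HK k s ν →ₗ[RatFunc k] RatFunc k) (r : HK k s ν) :
    ψ ((Polynomial.X : k[X]) • r) = algebraMap k[X] (RatFunc k) Polynomial.X * ψ r := by
  rw [X_smul_eq, map_smul, smul_eq_mul, RatFunc.algebraMap_X]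

theorem exists_redFun_eq {ψ : HK k s ν →ₗ[RatFunc k] RatFunc k}
    (hψ : ∀ r ∈ reesAlg k s ν, ∃ p : k[X], ψ r = algebraMap k[X] (RatFunc k) p)
    {a : HK k s ν} (ha : a ∈ order k s ν) :
    ∃ p : k[X], redFun ψ a = algebraMap k[X] (RatFunc k) (Polynomial.X * p) := by
  obtain ⟨r, hr, h⟩ := order_eq_counit_add ha
  obtain ⟨p, hp⟩ := hψ r hr
  refine ⟨p, ?_⟩
  rw [redFun_apply, sub_eq_iff_eq_add'.2 h, map_X_smul, hp, map_mul]

theorem add_smul_mul_add_smul_sub {R B : Type*} [CommRing R] [Ring B] [Algebra R B] (t α β : R)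
    (x y : B) : (algebraMap R B α + t • x) * (algebraMap R B β + t • y) - algebraMap R B (α * β) =
      t • (α • y + β • x + t • (x * y)) := by
  simp only [map_mul, Algebra.algebraMap_eq_smul_one, add_mul, mul_add, smul_add, smul_mul_assoc,
    mul_smul_comm, one_mul, mul_one]
  rw [smul_comm t α, smul_comm t β]
  abel

theorem X_mul_cancel {p q : k[X]} (h : algebraMap k[X] (RatFunc k) (Polynomial.X * p) =
    algebraMap k[X] (RatFunc k) (Polynomial.X * q)) : p = q :=
  mul_left_cancel₀ Polynomial.X_ne_zero (IsFractionRing.injective k[X] (RatFunc k) h)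

attribute [local instance] LieRing.ofAssociativeRing in
/-- All linear forms on the free Lie algebra come from tangent vectors of the specialization that
are induced by functionals on `H(ħ)`. -/
theorem IsSpecialization.exists_tangentLift [CharZero k] (hs : 0 < s)
    (hσ : IsSpecialization (order k s ν) P σ)
    (l : FL k s ν →ₗ[k] k) :
    ∃ ψ ℓ, IsTangentLift σ ψ ℓ ∧ ∀ x, ℓ (σ (tau k s ν x)) = l x := by
  -- extend `l` to the free associative algebra, and then to a functional on `H(ħ)`
  obtain ⟨g, hg⟩ := LinearMap.exists_leftInverse_of_injective
    (freeLieToAssoc k (Idx s ν)).toLinearMap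
    (LinearMap.ker_eq_bot.2 (freeLieToAssoc_injective (k := k) (s := s) (ν := ν) hs))
  have hgl : ∀ x, (l ∘ₗ g) (freeLieToAssoc k (Idx s ν) x) = l x := fun x =>
    congr_arg l (LinearMap.congr_fun hg x)
  have hψ := fun r hr => extendFunctional_reesAlg (s := s) (ν := ν) (l ∘ₗ g) (r := r) hr
  have hψl : ∀ x, extendFunctional (l ∘ₗ g) (lieIncl k s ν x) = algebraMap k (RatFunc k) (l x) := by
    intro x
    rw [← scaledIncl_freeLieToAssoc, extendFunctional_scaledIncl, hgl]
  generalize extendFunctional (s := s) (ν := ν) (l ∘ₗ g) = ψ at hψ hψl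
  choose q hq using fun a : order k s ν => exists_redFun_eq hψ a.2
  -- the functional `a ↦ q a (0)` on the order
  let L : order k s ν →ₗ[k] k :=
    { toFun := fun a => (q a).eval 0
      map_add' := fun a b => by
        rw [← Polynomial.eval_add]
        congr 1
        apply X_mul_cancel
        rw [← hq, mul_add, map_add, ← hq, ← hq, ← map_add]
        rfl
      map_smul' := fun c a => by
        rw [RingHom.id_apply, ← Polynomial.eval_smul]
        congr 1
        apply X_mul_cancel
        rw [← hq, mul_smul_comm, Polynomial.smul_eq_C_mul, map_mul, ← hq]
        have : ((c • a : order k s ν) : HK k s ν) = (algebraMap k (RatFunc k) c) • (a : HK k s ν) :=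
          (algebraMap_smul (RatFunc k) c (a : HK k s ν)).symm
        rw [this, map_smul, smul_eq_mul, IsScalarTower.algebraMap_apply k k[X] (RatFunc k)]
        rfl }
  have hL : ∀ (a : order k s ν) (p : k[X]), redFun ψ (a : HK k s ν) =
      algebraMap k[X] (RatFunc k) (Polynomial.X * p) → L a = p.eval 0 := fun a p h =>
    congr_arg (Polynomial.eval 0) (X_mul_cancel ((hq a).symm.trans h))
  -- it is divisible by `ħ` on multiples of `ħ`, and descends to the specialization
  have hLker : ∀ a b, σ a = σ b → L a = L b := by
    intro a b h
    rw [← sub_eq_zero, ← map_sub] at h ⊢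
    obtain ⟨c, hc⟩ := (hσ.ker _).1 h
    rw [hc, hL _ (Polynomial.X * q c), Polynomial.eval_mul, Polynomial.eval_X, zero_mul]
    rw [map_mul, ← hq]
    exact map_X_smul _ _
  obtain ⟨g', hg'⟩ := LinearMap.exists_rightInverse_of_surjective σ.toLinearMap
    (LinearMap.range_eq_top.2 hσ.surjective)
  have hℓ : ∀ a, (L ∘ₗ g') (σ a) = L a := fun a => hLker _ _ (LinearMap.congr_fun hg' (σ a))
  -- the Leibniz rule: for `a = α + ħ r` and `b = β + ħ r'`, the product is
  -- `α β + ħ (α r' + β r + ħ r r')`, whose last term does not contribute at `ħ = 0`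
  refine ⟨ψ, L ∘ₗ g', ⟨⟨fun f f' => ?_⟩, hψ, fun a => ⟨q a, hq a, (hℓ a).symm⟩⟩, fun x => ?_⟩
  · obtain ⟨a, rfl⟩ := hσ.surjective f
    obtain ⟨b, rfl⟩ := hσ.surjective f'
    rw [← map_mul, hℓ, hℓ, hℓ]
    obtain ⟨r, hr, ha⟩ := order_eq_counit_add a.2
    obtain ⟨r', hr', hb⟩ := order_eq_counit_add b.2
    obtain ⟨α, hα⟩ := counit_order a.2
    obtain ⟨β, hβ⟩ := counit_order b.2
    obtain ⟨p₁, h₁⟩ := hψ r hr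
    obtain ⟨p₂, h₂⟩ := hψ r' hr'
    obtain ⟨p₃, h₃⟩ := hψ _ (mul_mem hr hr')
    rw [hL a p₁ (by rw [redFun_apply, sub_eq_iff_eq_add'.2 ha, map_X_smul, h₁, map_mul]),
      hL b p₂ (by rw [redFun_apply, sub_eq_iff_eq_add'.2 hb, map_X_smul, h₂, map_mul]),
      hσ.counit a α hα, hσ.counit b β hβ,
      hL (a * b) (α * p₂ + p₁ * β + Polynomial.X * p₃)]
    · simp
    · have hab : ((a * b : order k s ν) : HK k s ν) - algebraMap (RatFunc k) _
          (Coalgebra.counit ((a * b : order k s ν) : HK k s ν)) =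
          (Polynomial.X : k[X]) • (α • r' + β • r + (Polynomial.X : k[X]) • (r * r')) := by
        rw [hα, ← IsScalarTower.algebraMap_apply] at ha
        rw [hβ, ← IsScalarTower.algebraMap_apply] at hb
        rw [Subalgebra.coe_mul, Bialgebra.counit_mul, hα, hβ, ha, hb, ← map_mul (algebraMap k[X] _),
          ← IsScalarTower.algebraMap_apply, add_smul_mul_add_smul_sub]
      have hsm : ∀ (p : k[X]) (y : HK k s ν), ψ (p • y) = algebraMap k[X] (RatFunc k) p * ψ y := by
        intro p y
        rw [← algebraMap_smul (RatFunc k) p y, map_smul, smul_eq_mul]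
      rw [redFun_apply, hab, hsm, map_add, map_add, hsm, hsm, hsm, h₁, h₂, h₃]
      simp only [map_add, map_mul]
      ring
  · rw [hℓ, hL _ (Polynomial.C (l x)), Polynomial.eval_C]
    rw [redFun_apply, coe_tau, counit_hlie, map_zero, sub_zero, hlie_apply, ← X_smul_eq,
      map_X_smul, hψl, map_mul, IsScalarTower.algebraMap_apply k k[X] (RatFunc k)]
    rfl

/-- The convolution powers of `ψ` are divisible by the corresponding powers of `ħ` on the order,
and reduce to the powers of the left invariant vector field of `ℓ` at the unit element. -/
theorem IsTangentLift.convPow (hσ : IsSpecialization (order k s ν) P σ)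
    {ψ : HK k s ν →ₗ[RatFunc k] RatFunc k} {ℓ : F →ₗ[k] k} (h : IsTangentLift σ ψ ℓ) (n : ℕ)
    (a : order k s ν) : ∃ p : k[X],
      convPow ψ n (a : HK k s ν) = algebraMap k[X] (RatFunc k) (Polynomial.X ^ n * p) ∧
      p.eval 0 = Coalgebra.counit ((leftField ℓ ^ n) (σ a)) := by
  induction n generalizing a with
  | zero =>
    obtain ⟨p, hp⟩ := counit_order a.2
    exact ⟨p, by rw [pow_zero, one_mul]; exact hp, (hσ.counit a p hp).symm⟩
  | succ n ih =>
    obtain ⟨l, hl⟩ := exists_comul_eq a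
    have hl' := hσ.comul a l hl
    have hD : leftField ℓ (σ a) = TensorProduct.rid k F (ℓ.lTensor F
        (l.map fun p => σ p.1 ⊗ₜ[k] σ p.2).sum) := by rw [← hl']; rfl
    rw [pow_succ (leftField ℓ), Module.End.mul_apply, hD]
    simp only [FormalDiff.convPow, LinearMap.comp_apply]
    rw [hl]
    clear hl hl' hD
    induction l with
    | nil => exact ⟨0, by simp, by simp⟩
    | cons q l ihl =>
      obtain ⟨p, hp, hp'⟩ := ihl
      obtain ⟨p₁, h₁, h₁'⟩ := ih q.1
      obtain ⟨p₂, h₂, h₂'⟩ := h.lift q.2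
      refine ⟨p₁ * p₂ + p, ?_, ?_⟩
      · rw [List.map_cons, List.sum_cons, map_add, map_add, hp, TensorProduct.map_tmul,
          LinearMap.mul'_apply, h₁, h₂, ← map_mul, ← map_add]
        congr 1
        ring
      · rw [List.map_cons, List.sum_cons, map_add, map_add, map_add, map_add, ← hp',
          Polynomial.eval_add, Polynomial.eval_mul, h₁', h₂', LinearMap.lTensor_tmul,
          TensorProduct.rid_tmul, map_smul, map_smul, smul_eq_mul, mul_comm]

/-- A nonzero polynomial in the coordinates given by a basis of the free Lie algebra is detected
by the powers of some left invariant vector field: take a tangent vector at which the component of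
lowest degree does not vanish. -/
theorem IsSpecialization.exists_leftField_ne_zero [CharZero k] (hs : 0 < s)
    (hσ : IsSpecialization (order k s ν) P σ) {ι : Type*} (b : Module.Basis ι k (FL k s ν))
    {p : MvPolynomial ι k} (hp : p ≠ 0) : ∃ ψ ℓ n, IsTangentLift σ ψ ℓ ∧
      (Coalgebra.counit ((leftField ℓ ^ n)
        (MvPolynomial.aeval (fun i => σ (tau k s ν (b i))) p)) : k) ≠ 0 := by
  classical
  have hex : ∃ d, MvPolynomial.homogeneousComponent d p ≠ 0 := by
    by_contra! h
    apply hp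
    rw [← MvPolynomial.sum_homogeneousComponent p]
    exact Finset.sum_eq_zero fun i _ => h i
  have hd := Nat.find_spec hex
  have hmin : ∀ j < Nat.find hex, MvPolynomial.homogeneousComponent j p = 0 := fun j hj =>
    not_not.1 (Nat.find_min hex hj)
  obtain ⟨c, hc⟩ : ∃ c : ι → k,
      MvPolynomial.eval c (MvPolynomial.homogeneousComponent (Nat.find hex) p) ≠ 0 := by
    by_contra! h
    have : Infinite k := CharZero.infinite k
    exact hd (MvPolynomial.funext fun c => by rw [h, map_zero])
  obtain ⟨ψ, ℓ, h, hl⟩ := hσ.exists_tangentLift hs (b.constr k c)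
  refine ⟨ψ, ℓ, _, h, exists_leftField_pow_ne_zero (fun i => hσ.counit_tau _) h.tangent hmin ?_⟩
  simp_rw [hl, Module.Basis.constr_basis]
  exact hc

/-- The Poincaré-Birkhoff-Witt theorem at `ħ = 0`: the specialization is a polynomial algebra. -/
theorem IsSpecialization.bijective_aeval [CharZero k] (hs : 0 < s)
    (hσ : IsSpecialization (order k s ν) P σ) {ι : Type*} (b : Module.Basis ι k (FL k s ν)) :
    Function.Bijective (MvPolynomial.aeval (fun i => σ (tau k s ν (b i))) :
      MvPolynomial ι k →ₐ[k] F) := by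
  constructor
  · rw [injective_iff_map_eq_zero]
    intro p hp
    by_contra h
    obtain ⟨ψ, ℓ, n, -, hn⟩ := hσ.exists_leftField_ne_zero hs b h
    rw [hp] at hn
    simp at hn
  · rw [← AlgHom.range_eq_top, ← Algebra.adjoin_range_eq_range_aeval, eq_top_iff, ← hσ.adjoin_tau]
    refine Algebra.adjoin_le ?_
    rintro _ ⟨x, rfl⟩
    rw [SetLike.mem_coe]
    dsimp only
    rw [← b.linearCombination_repr x, Finsupp.linearCombination_apply, Finsupp.sum, map_sum,
      map_sum]
    refine sum_mem fun i _ => ?_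
    rw [map_smul, map_smul]
    exact Subalgebra.smul_mem _ (Algebra.subset_adjoin (Set.mem_range_self i)) _

/-- A function vanishes if all powers of left invariant vector fields annihilate it at the unit
element. -/
theorem IsSpecialization.eq_zero_of_leftField [CharZero k] (hs : 0 < s)
    (hσ : IsSpecialization (order k s ν) P σ) {f : F} (h : ∀ ψ ℓ, IsTangentLift σ ψ ℓ → ∀ n,
      (Coalgebra.counit ((leftField ℓ ^ n) f) : k) = 0) : f = 0 := by
  obtain ⟨p, rfl⟩ := (hσ.bijective_aeval hs (Module.Basis.ofVectorSpace k (FL k s ν))).2 f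
  by_contra hf
  obtain ⟨ψ, ℓ, n, h', hn⟩ := hσ.exists_leftField_ne_zero hs
    (Module.Basis.ofVectorSpace k (FL k s ν)) (p := p) (by rintro rfl; exact hf (map_zero _))
  exact hn (h ψ ℓ h' n)

/-! ### Drinfeld's algebra is the order -/

/-- The iterated coproducts preserve the order. -/
theorem iterComul_mem_tensorOrder {a : HK k s ν} (ha : a ∈ order k s ν) (n : ℕ) :
    iterComul (RatFunc k) (HK k s ν) n a ∈
      tensorOrder (Subalgebra.toSubmodule (order k s ν)) n := by
  induction n generalizing a with
  | zero =>
    obtain ⟨r, hr⟩ := counit_order ha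
    simp only [iterComul, LinearMap.comp_apply, LinearEquiv.coe_coe]
    rw [TensorPower.algebraMap₀_eq_smul_one, hr, algebraMap_smul]
    exact Submodule.smul_mem _ _ (Submodule.subset_span ⟨_, fun i => i.elim0, TensorPower.gOne_def⟩)
  | succ n ih =>
    obtain ⟨l, hl⟩ := exists_comul_eq (⟨a, ha⟩ : order k s ν)
    simp only [iterComul, LinearMap.comp_apply, LinearEquiv.coe_coe]
    rw [hl, map_list_sum, map_list_sum]
    refine list_sum_mem fun t ht => ?_
    simp only [List.map_map, List.mem_map, Function.comp_apply] at ht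
    obtain ⟨q, -, rfl⟩ := ht
    rw [TensorProduct.map_tmul]
    have h := ih q.1.2
    generalize iterComul (RatFunc k) (HK k s ν) n (q.1 : HK k s ν) = t at h ⊢
    induction h using Submodule.span_induction with
    | zero => rw [TensorProduct.zero_tmul, map_zero]; exact zero_mem _
    | add x y _ _ hx hy => rw [TensorProduct.add_tmul, map_add]; exact add_mem hx hy
    | smul r x _ hx =>
      rw [← algebraMap_smul (RatFunc k) r x, ← TensorProduct.smul_tmul', map_smul, algebraMap_smul]
      exact Submodule.smul_mem _ _ hx
    | mem x hx =>
      obtain ⟨v, hv, rfl⟩ := hx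
      rw [LinearEquiv.coe_coe, PiTensorProduct.subsingletonEquiv_symm_apply',
        ← TensorPower.gMul_def,
        TensorPower.tprod_mul_tprod]
      refine Submodule.subset_span ⟨_, fun i => ?_, rfl⟩
      refine Fin.addCases (fun i => ?_) (fun i => ?_) i
      · rw [Fin.append_left]; exact hv i
      · rw [Fin.append_right]; exact q.2.2

/-- Each factor `id - u ∘ ε` maps the order to `ħ H_ħ^∨`, so `δ_n` is divisible by `ħ^n` on the
order. -/
theorem delta_order {a : HK k s ν} (ha : a ∈ order k s ν) (n : ℕ) :
    ∃ ξ ∈ tensorOrder (rees k s ν) n,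
      delta (RatFunc k) (HK k s ν) n a = ((Polynomial.X : k[X]) ^ n) • ξ := by
  have h := iterComul_mem_tensorOrder ha n
  rw [delta, LinearMap.comp_apply]
  generalize iterComul (RatFunc k) (HK k s ν) n a = t at h ⊢
  induction h using Submodule.span_induction with
  | zero => exact ⟨0, zero_mem _, by rw [map_zero, smul_zero]⟩
  | add x y _ _ hx hy =>
    obtain ⟨ξ, hξ, h⟩ := hx
    obtain ⟨ξ', hξ', h'⟩ := hy
    exact ⟨ξ + ξ', add_mem hξ hξ', by rw [map_add, h, h', smul_add]⟩
  | smul r x _ hx =>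
    obtain ⟨ξ, hξ, h⟩ := hx
    exact ⟨r • ξ, Submodule.smul_mem _ _ hξ, by
      rw [← algebraMap_smul (RatFunc k) r x, map_smul, h, algebraMap_smul, smul_comm]⟩
  | mem x hx =>
    obtain ⟨v, hv, rfl⟩ := hx
    choose r hr h using fun i => order_eq_counit_add (hv i)
    refine ⟨PiTensorProduct.tprod (RatFunc k) r, Submodule.subset_span ⟨r, fun i => ?_, rfl⟩, ?_⟩
    · rw [rees_eq]; exact hr i
    · rw [PiTensorProduct.map_tprod, ← algebraMap_smul (RatFunc k) ((Polynomial.X : k[X]) ^ n),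
        map_pow, RatFunc.algebraMap_X]
      have : ∀ i, (LinearMap.id - Algebra.linearMap (RatFunc k) (HK k s ν) ∘ₗ Coalgebra.counit :
          HK k s ν →ₗ[RatFunc k] HK k s ν) (v i) = hbar k • r i := fun i => by
        rw [← X_smul_eq, ← sub_eq_iff_eq_add'.2 (h i)]
        rfl
      simp_rw [this]
      rw [MultilinearMap.map_smul_univ]
      simp

theorem powFun_mem_range {ψ : HK k s ν →ₗ[RatFunc k] RatFunc k}
    (hψ : ∀ r ∈ reesAlg k s ν, ∃ p : k[X], ψ r = algebraMap k[X] (RatFunc k) p) {n : ℕ}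
    {ξ : ⨂[RatFunc k]^n (HK k s ν)} (hξ : ξ ∈ tensorOrder (rees k s ν) n) :
    ∃ p : k[X], powFun ψ n ξ = algebraMap k[X] (RatFunc k) p := by
  induction hξ using Submodule.span_induction with
  | zero => exact ⟨0, by simp⟩
  | add x y _ _ hx hy =>
    obtain ⟨p, hp⟩ := hx
    obtain ⟨q, hq⟩ := hy
    exact ⟨p + q, by rw [map_add, hp, hq, map_add]⟩
  | smul r x _ hx =>
    obtain ⟨p, hp⟩ := hx
    exact ⟨r * p, by rw [← algebraMap_smul (RatFunc k) r x, map_smul, hp, smul_eq_mul, map_mul]⟩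
  | mem x hx =>
    obtain ⟨v, hv, rfl⟩ := hx
    rw [rees_eq] at hv
    choose p hp using fun i => hψ _ (hv i)
    exact ⟨∏ i, p i, by rw [powFun_tprod, map_prod]; simp_rw [hp]⟩

/-- If `ħ η` lies in the order for some `η` in Drinfeld's algebra, then so does `η`: all powers of
left invariant vector fields kill the class of `ħ η` at the unit element. -/
theorem IsSpecialization.mem_order_of_X_smul_mem [CharZero k] (hs : 0 < s)
    (hσ : IsSpecialization (order k s ν) P σ) {η : HK k s ν} (hη : η ∈ drinfeld k s ν)
    (h : (Polynomial.X : k[X]) • η ∈ order k s ν) : η ∈ order k s ν := by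
  have h0 : σ ⟨_, h⟩ = 0 := by
    refine hσ.eq_zero_of_leftField hs fun ψ ℓ hψ n => ?_
    obtain ⟨p, hp, hp'⟩ := hψ.convPow hσ n ⟨_, h⟩
    obtain ⟨ξ, hξ, hξ'⟩ := hη.2 n
    obtain ⟨q, hq⟩ := powFun_mem_range hψ.rees hξ
    rw [← hp']
    -- the convolution power of `ψ` at `ħ η` is `ħ^n p`, and it is `ħ` times `ħ^n q`, as `δ_n(η)` is
    -- divisible by `ħ^n`
    have : p = Polynomial.X * q := by
      refine mul_left_cancel₀ (pow_ne_zero n Polynomial.X_ne_zero)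
        (IsFractionRing.injective k[X] (RatFunc k) ?_)
      rw [← hp]
      dsimp only
      rw [map_X_smul, ← powFun_delta, hξ',
        ← algebraMap_smul (RatFunc k) ((Polynomial.X : k[X]) ^ n),
        map_smul, hq, smul_eq_mul, ← map_mul, ← map_mul]
      congr 1
      ring
    rw [this, Polynomial.eval_mul, Polynomial.eval_X, zero_mul]
  obtain ⟨c, hc⟩ := (hσ.ker _).1 h0
  have : η = c := by
    have h1 : (Polynomial.X : k[X]) • η = (Polynomial.X : k[X]) • (c : HK k s ν) :=
      congr_arg Subtype.val hc
    exact X_smul_cancel h1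
  rw [this]
  exact c.2

/-- Drinfeld's algebra is the order. An element `η` of it has a multiple `ħ^m η` in the order, and
the powers of `ħ` are removed one by one. -/
theorem IsSpecialization.toSubmodule_order [CharZero k] (hs : 0 < s)
    (hσ : IsSpecialization (order k s ν) P σ) :
    Subalgebra.toSubmodule (order k s ν) = drinfeld k s ν := by
  refine le_antisymm (fun a ha => ?_) fun η hη => ?_
  · refine ⟨?_, fun n => delta_order ha n⟩
    rw [rees_eq]
    exact order_le_reesAlg ha
  · have hη' := hη.1
    rw [rees_eq] at hη'
    obtain ⟨m, hm⟩ := exists_X_pow_smul_mem_order hη'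
    induction m with
    | zero => rwa [pow_zero, one_smul] at hm
    | succ m ih =>
      refine ih (hσ.mem_order_of_X_smul_mem hs ((drinfeld k s ν).smul_mem _ hη) ?_)
      rwa [← mul_smul, ← pow_succ']

end special

/-! ### Words in almost commuting generators -/

section words
variable {R B : Type*} [CommRing R] [Ring B] [Algebra R B] {ι : Type*} (g : ι → B)

/-- The span of the words of length less than `n` in the `g i`. -/
def wordSpan (R : Type*) {B : Type*} [CommRing R] [Ring B] [Algebra R B] {ι : Type*} (g : ι → B)
    (n : ℕ) : Submodule R B :=
  Submodule.span R {y | ∃ l : List ι, l.length < n ∧ y = (l.map g).prod}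

/-- The product of the `g i`, with the multiplicities `d i`, in some order. -/
noncomputable def orderedMonomial (d : ι →₀ ℕ) : B := ((Finsupp.toMultiset d).toList.map g).prod

variable {g}

theorem prod_mem_wordSpan {l : List ι} {n : ℕ} (h : l.length < n) :
    (l.map g).prod ∈ wordSpan R g n := Submodule.subset_span ⟨l, h, rfl⟩

theorem mul_mem_wordSpan (i : ι) {n : ℕ} {y : B} (hy : y ∈ wordSpan R g n) :
    g i * y ∈ wordSpan R g (n + 1) := by
  induction hy using Submodule.span_induction with
  | zero => rw [mul_zero]; exact zero_mem _
  | add x y _ _ hx hy => rw [mul_add]; exact add_mem hx hy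
  | smul r x _ hx => rw [mul_smul_comm]; exact Submodule.smul_mem _ r hx
  | mem x hx =>
    obtain ⟨l, hl, rfl⟩ := hx
    rw [← List.prod_cons, ← List.map_cons]
    exact prod_mem_wordSpan (by simpa using hl)

/-- If the commutators of the `g i` are linear in the `g i`, then the product of a word depends on
the order of its letters only up to shorter words. -/
theorem perm_sub_mem_wordSpan
    (hg : ∀ i j, g i * g j - g j * g i ∈ Submodule.span R (Set.range g)) {l l' : List ι}
    (h : l.Perm l') : (l.map g).prod - (l'.map g).prod ∈ wordSpan R g l.length := by
  induction h with
  | nil => rw [sub_self]; exact zero_mem _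
  | cons x h ih =>
    rw [List.map_cons, List.map_cons, List.prod_cons, List.prod_cons, ← mul_sub]
    exact mul_mem_wordSpan x ih
  | trans h h' ih ih' =>
    rw [← sub_add_sub_cancel]
    refine add_mem ih ?_
    rwa [h.length_eq]
  | swap x y l =>
    simp only [List.map_cons, List.prod_cons]
    rw [← mul_assoc, ← mul_assoc, ← sub_mul]
    have h := hg y x
    generalize g y * g x - g x * g y = z at h
    induction h using Submodule.span_induction with
    | zero => rw [zero_mul]; exact zero_mem _
    | add x y _ _ hx hy => rw [add_mul]; exact add_mem hx hy
    | smul r x _ hx => rw [smul_mul_assoc]; exact Submodule.smul_mem _ r hx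
    | mem x hx =>
      obtain ⟨i, rfl⟩ := hx
      rw [← List.prod_cons, ← List.map_cons]
      exact prod_mem_wordSpan (by simp)

theorem wordSpan_le_span_orderedMonomial
    (hg : ∀ i j, g i * g j - g j * g i ∈ Submodule.span R (Set.range g)) (n : ℕ) :
    wordSpan R g n ≤ Submodule.span R (Set.range (orderedMonomial g)) := by
  classical
  induction n with
  | zero =>
    refine Submodule.span_le.2 ?_
    rintro _ ⟨l, hl, rfl⟩
    exact absurd hl (Nat.not_lt_zero _)
  | succ n ih =>
    refine Submodule.span_le.2 ?_
    rintro _ ⟨l, hl, rfl⟩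
    have hp : l.Perm (l : Multiset ι).toList := by
      rw [← Multiset.coe_eq_coe, Multiset.coe_toList]
    have h := perm_sub_mem_wordSpan hg hp
    have hle : wordSpan R g l.length ≤ wordSpan R g n := Submodule.span_mono fun y hy => by
      obtain ⟨l', hl', rfl⟩ := hy
      exact ⟨l', by omega, rfl⟩
    rw [SetLike.mem_coe, ← sub_add_cancel (l.map g).prod ((l : Multiset ι).toList.map g).prod]
    refine add_mem (ih (hle h)) (Submodule.subset_span ⟨Multiset.toFinsupp (l : Multiset ι), ?_⟩)
    rw [orderedMonomial, Multiset.toFinsupp_toMultiset]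

/-- The easy half of the Poincaré-Birkhoff-Witt theorem. -/
theorem span_orderedMonomial
    (hg : ∀ i j, g i * g j - g j * g i ∈ Submodule.span R (Set.range g))
    (hB : Algebra.adjoin R (Set.range g) = ⊤) :
    Submodule.span R (Set.range (orderedMonomial g)) = ⊤ := by
  rw [eq_top_iff, ← Algebra.top_toSubmodule, ← hB, Algebra.adjoin_eq_span, Submodule.span_le]
  intro y hy
  obtain ⟨l, hl, rfl⟩ := Submonoid.exists_list_of_mem_closure hy
  obtain ⟨l, rfl⟩ : ∃ l' : List ι, l'.map g = l := by
    have : l ∈ Set.range (List.map g) := by rw [Set.range_list_map]; exact hl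
    exact this
  exact wordSpan_le_span_orderedMonomial hg _ (prod_mem_wordSpan (Nat.lt_succ_self _))

/-- A morphism is injective if the images of the ordered monomials, which span its source, are
linearly independent. -/
theorem injective_of_orderedMonomial {C : Type*} [Ring C] [Algebra R C] (f : B →ₐ[R] C)
    (hg : ∀ i j, g i * g j - g j * g i ∈ Submodule.span R (Set.range g))
    (hB : Algebra.adjoin R (Set.range g) = ⊤)
    (hf : LinearIndependent R (orderedMonomial fun i => f (g i))) : Function.Injective f := by
  rw [injective_iff_map_eq_zero]
  intro x hx
  have hx' : x ∈ Submodule.span R (Set.range (orderedMonomial g)) := by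
    rw [span_orderedMonomial hg hB]; trivial
  obtain ⟨c, rfl⟩ := Finsupp.mem_span_range_iff_exists_finsupp.1 hx'
  have hc : Finsupp.linearCombination R (orderedMonomial fun i => f (g i)) c = 0 := by
    rw [← hx, Finsupp.linearCombination_apply, Finsupp.sum, Finsupp.sum, map_sum]
    refine Finset.sum_congr rfl fun d _ => ?_
    rw [map_smul, orderedMonomial, orderedMonomial, map_list_prod, List.map_map]
    rfl
  rw [linearIndependent_iff.1 hf c hc, Finsupp.sum_zero_index]

/-- The criterion `injective_of_orderedMonomial` for a quotient of a free algebra in which the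
commutators of the generators are linear. -/
theorem injective_of_quotient {C : Type*} [Ring C] [Algebra R C] (m : FreeAlgebra R ι →ₐ[R] B)
    (hm : Function.Surjective m)
    (hrel : ∀ i j, ∃ y ∈ Submodule.span R (Set.range (FreeAlgebra.ι R)),
      m (FreeAlgebra.ι R i * FreeAlgebra.ι R j - FreeAlgebra.ι R j * FreeAlgebra.ι R i) = m y)
    (f : B →ₐ[R] C)
    (hf : LinearIndependent R (orderedMonomial fun i => f (m (FreeAlgebra.ι R i)))) :
    Function.Injective f := by
  have hr : Set.range (fun i => m (FreeAlgebra.ι R i)) = m '' Set.range (FreeAlgebra.ι R) := by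
    rw [← Set.range_comp]; rfl
  refine injective_of_orderedMonomial (g := fun i => m (FreeAlgebra.ι R i)) f (fun i j => ?_) ?_ hf
  · obtain ⟨y, hy, h⟩ := hrel i j
    rw [← map_mul, ← map_mul, ← map_sub, h, hr]
    have := Submodule.mem_map_of_mem (f := m.toLinearMap) hy
    rwa [Submodule.map_span] at this
  · rw [hr, ← AlgHom.map_adjoin, FreeAlgebra.adjoin_range_ι, Algebra.map_top,
      AlgHom.range_eq_top]
    exact hm

end words

/-! ### The presentation of the order -/

section presentation
variable {k : Type u} [Field k] {s : ℕ} {ν : ℕ∞} {F : Type v} [CommRing F] [HopfAlgebra k F]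
  {P : PoissonBracket k F} {σ : order k s ν →ₐ[k] F}

theorem map_orderedMonomial {B C : Type*} [Ring B] [CommRing C] {ι : Type*} (f : B →+* C)
    (g : ι → B) (d : ι →₀ ℕ) :
    f (orderedMonomial g d) = d.prod fun i n => f (g i) ^ n := by
  rw [orderedMonomial, map_list_prod, List.map_map, ← Multiset.prod_coe, ← Multiset.map_coe,
    Multiset.coe_toList, Finsupp.toMultiset_map, Finsupp.prod_toMultiset,
    Finsupp.prod_mapDomain_index (fun _ => pow_zero _) (fun _ _ _ => pow_add _ _ _)]
  rfl

/-- The ordered monomials in a basis are linearly independent over `k[ħ]`: by the case `ħ = 0` all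
coefficients of a relation are divisible by `ħ`, and `ħ` can be cancelled. -/
theorem IsSpecialization.linearIndependent_orderedMonomial [CharZero k] (hs : 0 < s)
    (hσ : IsSpecialization (order k s ν) P σ) {ι : Type*} (b : Module.Basis ι k (FL k s ν)) :
    LinearIndependent k[X] (orderedMonomial fun i => tau k s ν (b i)) := by
  classical
  rw [linearIndependent_iff]
  have key : ∀ c : (ι →₀ ℕ) →₀ k[X],
      Finsupp.linearCombination k[X] (orderedMonomial fun i => tau k s ν (b i)) c = 0 →
      ∀ d, (c d).eval 0 = 0 := by
    intro c hc d
    have h : MvPolynomial.aeval (fun i => σ (tau k s ν (b i)))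
        (∑ d ∈ c.support, MvPolynomial.monomial d ((c d).eval 0)) = 0 := by
      rw [← map_zero σ, ← hc, Finsupp.linearCombination_apply, Finsupp.sum, map_sum, map_sum]
      refine Finset.sum_congr rfl fun d _ => ?_
      rw [hσ.smul, MvPolynomial.aeval_monomial, ← Algebra.smul_def]
      congr 1
      exact (map_orderedMonomial (σ : order k s ν →+* F) _ d).symm
    rw [← map_zero (MvPolynomial.aeval (R := k) fun i => σ (tau k s ν (b i)))] at h
    have h' := congr_arg (MvPolynomial.coeff d) ((hσ.bijective_aeval hs b).1 h)
    rw [MvPolynomial.coeff_sum, MvPolynomial.coeff_zero] at h'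
    simp only [MvPolynomial.coeff_monomial] at h'
    rw [Finset.sum_ite_eq'] at h'
    by_cases hd : d ∈ c.support
    · rwa [if_pos hd] at h'
    · rw [Finsupp.notMem_support_iff.1 hd, Polynomial.eval_zero]
  -- hence the coefficients of a relation are divisible by all powers of `ħ`
  have hdvd : ∀ n, ∀ c : (ι →₀ ℕ) →₀ k[X],
      Finsupp.linearCombination k[X] (orderedMonomial fun i => tau k s ν (b i)) c = 0 →
      ∀ d, Polynomial.X ^ n ∣ c d := by
    intro n
    induction n with
    | zero => intro c _ d; rw [pow_zero]; exact one_dvd _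
    | succ n ih =>
      intro c hc d
      have hX : c = (Polynomial.X : k[X]) • c.mapRange Polynomial.divX Polynomial.divX_zero := by
        ext1 d
        rw [Finsupp.smul_apply, Finsupp.mapRange_apply, smul_eq_mul]
        conv_lhs => rw [← Polynomial.divX_mul_X_add (c d), Polynomial.coeff_zero_eq_eval_zero,
          key c hc d, map_zero, add_zero, mul_comm]
      rw [hX, map_smul] at hc
      have hc' := IsQuantization.torsionFree (k := k) (A := order k s ν)
      have h0 := ih _ ((smul_eq_zero_iff_right (Polynomial.X_ne_zero (R := k))).1 hc) d
      rw [hX, Finsupp.smul_apply, smul_eq_mul, pow_succ']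
      exact mul_dvd_mul_left _ h0
  intro c hc
  ext1 d
  refine Polynomial.ext fun n => ?_
  exact Polynomial.X_pow_dvd_iff.1 (hdvd (n + 1) c hc d) n (Nat.lt_succ_self n)

variable {ι : Type w} (b : Module.Basis ι k (FL k s ν))

theorem adjoin_tau_basis : Algebra.adjoin k[X] (Set.range fun i => tau k s ν (b i)) = ⊤ := by
  rw [eq_top_iff, ← adjoin_tau]
  refine Algebra.adjoin_le ?_
  rintro _ ⟨x, rfl⟩
  rw [SetLike.mem_coe, ← b.linearCombination_repr x, Finsupp.linearCombination_apply, Finsupp.sum,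
    map_sum]
  refine sum_mem fun i _ => ?_
  rw [map_smul, ← algebraMap_smul k[X] (b.repr x i)]
  exact Subalgebra.smul_mem _ (Algebra.subset_adjoin (Set.mem_range_self i)) _

/-- The map from the algebra presented by generators and relations to the order. -/
noncomputable def presMap : RingQuot (PresRel b) →ₐ[k[X]] order k s ν :=
  RingQuot.liftAlgHom k[X] ⟨FreeAlgebra.lift k[X] fun i => tau k s ν (b i), by
    rintro _ _ ⟨i, j⟩
    rw [map_sub, map_mul, map_mul, FreeAlgebra.lift_ι_apply, FreeAlgebra.lift_ι_apply, tau_lie,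
      map_smul, Finsupp.sum, map_sum]
    congr 1
    conv_lhs => rw [← b.linearCombination_repr ⁅b i, b j⁆, Finsupp.linearCombination_apply,
      Finsupp.sum, map_sum]
    refine Finset.sum_congr rfl fun l _ => ?_
    rw [map_smul]
    rw [← algebraMap_smul k[X] _ (FreeAlgebra.ι k[X] l), map_smul, FreeAlgebra.lift_ι_apply,
      algebraMap_smul]⟩

theorem presMap_mk (i : ι) :
    presMap b (RingQuot.mkAlgHom k[X] (PresRel b) (FreeAlgebra.ι k[X] i)) = tau k s ν (b i) := by
  rw [presMap, RingQuot.liftAlgHom_mkAlgHom_apply, FreeAlgebra.lift_ι_apply]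

/-- Injectivity follows from the linear independence of the ordered monomials in the order. -/
theorem IsSpecialization.bijective_presMap [CharZero k] (hs : 0 < s)
    (hσ : IsSpecialization (order k s ν) P σ) : Function.Bijective (presMap b) := by
  constructor
  · refine injective_of_quotient (B := RingQuot (PresRel b)) (C := order k s ν)
      (RingQuot.mkAlgHom k[X] (PresRel b))
      (RingQuot.mkAlgHom_surjective _ _) (fun i j => ?_) (presMap b) ?_
    · refine ⟨_, ?_, RingQuot.mkAlgHom_rel k[X] (PresRel.comm (b := b) i j)⟩
      rw [Finsupp.sum]
      refine Submodule.smul_mem _ _ (sum_mem fun l _ => ?_)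
      rw [← algebraMap_smul k[X] ((b.repr ⁅b i, b j⁆) l)]
      exact Submodule.smul_mem _ _ (Submodule.subset_span ⟨l, rfl⟩)
    · simp_rw [presMap_mk]
      exact hσ.linearIndependent_orderedMonomial hs b
  · rw [← AlgHom.range_eq_top, eq_top_iff, ← adjoin_tau_basis b]
    refine Algebra.adjoin_le ?_
    rintro _ ⟨i, rfl⟩
    exact ⟨_, presMap_mk b i⟩

end presentation

/-! ### Families with the coproduct of formal diffeomorphisms -/

section coprod
variable {R : Type u} [CommRing R]

theorem map_coprod {S A B : Type*} [CommRing S] [Ring A] [Ring B] [Algebra R A] [Algebra S B]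
    (f : A →+* B) (θ : A ⊗[R] A →+ B ⊗[S] B) (hθ : ∀ x y, θ (x ⊗ₜ y) = f x ⊗ₜ f y)
    {s : ℕ} {ν : ℕ∞} (a : Idx s ν → A) (n : ℕ) :
    θ (coprod R s (extend a) n) = coprod S s (extend fun i => f (a i)) n := by
  rw [coprod, coprod, map_add, map_add, map_sum, hθ, hθ, map_one, map_extend]
  simp only [hθ, map_extend, map_Qpoly]

/-- The formulas for the antipode follow from the one for the coproduct. -/
theorem isDiffHopf_of_comul {A : Type v} [Ring A] [HopfAlgebra R A] {s : ℕ} {ν : ℕ∞}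
    {x : Idx s ν → A}
    (h : ∀ i, Coalgebra.comul (R := R) (x i) = coprod R s (extend x) i.n)
    (h0 : ∀ i, (Coalgebra.counit (x i) : R) = 0) : IsDiffHopf R x where
  comul := h
  counit := h0
  antipode i := by
    have h1 := HopfAlgebra.mul_antipode_lTensor_comul_apply (R := R) (x i)
    rw [h, h0, map_zero, coprod, map_add, map_add, map_add, map_add, map_sum, map_sum] at h1
    simp only [LinearMap.lTensor_tmul, LinearMap.mul'_apply, HopfAlgebra.antipode_one, mul_one,
      one_mul, extend_self] at h1
    rw [eq_sub_iff_add_eq, eq_neg_iff_add_eq_zero, ← h1]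
    abel
  antipode' i := by
    have h1 := HopfAlgebra.mul_antipode_rTensor_comul_apply (R := R) (x i)
    rw [h, h0, map_zero, coprod, map_add, map_add, map_add, map_add, map_sum, map_sum] at h1
    simp only [LinearMap.rTensor_tmul, LinearMap.mul'_apply, HopfAlgebra.antipode_one, mul_one,
      one_mul, extend_self] at h1
    rw [eq_sub_iff_add_eq, eq_neg_iff_add_eq_zero, ← h1]
    abel

end coprod

/-! ### The embedding of the Hopf algebra `H` -/

section embedding
variable {k : Type u} [Field k] {s : ℕ} {ν : ℕ∞}

/-- The morphism from `H` to the order with `a_n ↦ ħ x_n`. -/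
noncomputable def orderIncl (k : Type u) [Field k] (s : ℕ) (ν : ℕ∞) :
    NCH k s ν →ₐ[k] order k s ν :=
  FreeAlgebra.lift k fun i => tau k s ν (FreeLieAlgebra.of k i)

theorem orderIncl_gen (i : Idx s ν) :
    orderIncl k s ν (gen k s ν i) = tau k s ν (FreeLieAlgebra.of k i) :=
  FreeAlgebra.lift_ι_apply _ _

theorem coe_orderIncl (x : NCH k s ν) : (orderIncl k s ν x : HK k s ν) = incl k s ν x := by
  have : ((order k s ν).val.restrictScalars k).comp (orderIncl k s ν) = incl k s ν := by
    refine FreeAlgebra.hom_ext (funext fun i => ?_)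
    change (orderIncl k s ν (gen k s ν i) : HK k s ν) = incl k s ν (gen k s ν i)
    rw [orderIncl_gen, incl_gen, coe_tau, hlie_of]
  exact DFunLike.congr_fun this x

theorem incl_injective : Function.Injective (incl k s ν) := by
  let f : HK k s ν →ₐ[RatFunc k] RatFunc k ⊗[k] FreeAlgebra k (Idx s ν) :=
    FreeAlgebra.lift (RatFunc k) fun i => 1 ⊗ₜ FreeAlgebra.ι k i
  have : (f.restrictScalars k).comp (incl k s ν) = Algebra.TensorProduct.includeRight := by
    refine FreeAlgebra.hom_ext (funext fun i => ?_)
    change f (incl k s ν (gen k s ν i)) = _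
    rw [incl_gen]
    exact FreeAlgebra.lift_ι_apply _ _
  have hinj : Function.Injective (Algebra.TensorProduct.includeRight :
      FreeAlgebra k (Idx s ν) →ₐ[k] RatFunc k ⊗[k] FreeAlgebra k (Idx s ν)) :=
    Algebra.TensorProduct.includeRight_injective (algebraMap k (RatFunc k)).injective
  rw [← this] at hinj
  exact Function.Injective.of_comp hinj

/-- The map `incl ⊗ incl`. -/
noncomputable def inclTensor (k : Type u) [Field k] (s : ℕ) (ν : ℕ∞) :
    NCH k s ν ⊗[k] NCH k s ν →ₐ[k] HK k s ν ⊗[RatFunc k] HK k s ν :=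
  Algebra.TensorProduct.lift
    (((Algebra.TensorProduct.includeLeft : HK k s ν →ₐ[RatFunc k] _).restrictScalars k).comp
      (incl k s ν))
    (((Algebra.TensorProduct.includeRight : HK k s ν →ₐ[RatFunc k] _).restrictScalars k).comp
      (incl k s ν))
    fun x y => by
      change (incl k s ν x ⊗ₜ 1) * (1 ⊗ₜ incl k s ν y) = (1 ⊗ₜ incl k s ν y) * (incl k s ν x ⊗ₜ 1)
      simp

theorem inclTensor_tmul (x y : NCH k s ν) :
    inclTensor k s ν (x ⊗ₜ y) = incl k s ν x ⊗ₜ incl k s ν y := by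
  refine (Algebra.TensorProduct.lift_tmul _ _ _ _ _).trans ?_
  change (incl k s ν x ⊗ₜ 1) * (1 ⊗ₜ incl k s ν y) = _
  simp

theorem comul_incl (x : NCH k s ν) : Coalgebra.comul (R := RatFunc k) (incl k s ν x) =
    inclTensor k s ν (Coalgebra.comul (R := k) x) := by
  have : ((ncComul (RatFunc k) s ν).restrictScalars k).comp (incl k s ν) =
      (inclTensor k s ν).comp (ncComul k s ν) := by
    refine FreeAlgebra.hom_ext (funext fun i => ?_)
    change ncComul (RatFunc k) s ν (incl k s ν (gen k s ν i)) =
      inclTensor k s ν (ncComul k s ν (gen k s ν i))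
    rw [incl_gen]
    refine (comul_gen (RatFunc k) s ν i).trans ?_
    refine Eq.trans ?_ (congr_arg (inclTensor k s ν) (comul_gen k s ν i)).symm
    refine Eq.trans ?_ (map_coprod (incl k s ν : NCH k s ν →+* HK k s ν)
      (inclTensor k s ν).toLinearMap.toAddMonoidHom inclTensor_tmul (gen k s ν) i.n).symm
    congr 2
    funext i
    exact (incl_gen i).symm
  exact DFunLike.congr_fun this x

theorem counit_incl (x : NCH k s ν) : (Coalgebra.counit (incl k s ν x) : RatFunc k) =
    algebraMap k (RatFunc k) (Coalgebra.counit x) := by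
  have : ((ncCounit (RatFunc k) s ν).restrictScalars k).comp (incl k s ν) =
      (Algebra.ofId k (RatFunc k)).comp (ncCounit k s ν) := by
    refine FreeAlgebra.hom_ext (funext fun i => ?_)
    change ncCounit (RatFunc k) s ν (incl k s ν (gen k s ν i)) =
      algebraMap k (RatFunc k) (ncCounit k s ν (gen k s ν i))
    rw [incl_gen]
    refine (counit_gen i).trans ?_
    refine Eq.trans ?_ (congr_arg _ (counit_gen i)).symm
    rw [map_zero]
  exact DFunLike.congr_fun this x

theorem antipode_incl (x : NCH k s ν) : HopfAlgebra.antipode (RatFunc k) (incl k s ν x) =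
    incl k s ν (HopfAlgebra.antipode k x) := by
  change ncAntipode (RatFunc k) s ν (incl k s ν x) = incl k s ν (ncAntipode k s ν x)
  induction x using FreeAlgebra.induction with
  | grade0 c =>
    have h1 : ncAntipode k s ν (algebraMap k _ c) = algebraMap k _ c := by
      rw [Algebra.algebraMap_eq_smul_one, map_smul, ncAntipode_one]
    rw [h1, AlgHom.commutes, IsScalarTower.algebraMap_apply k (RatFunc k) (HK k s ν),
      Algebra.algebraMap_eq_smul_one, map_smul, ncAntipode_one]
  | grade1 i =>
    have h := ncAntipode_gen (R := k) i i.n i.pos le_rfl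
    have h' := ncAntipode_gen (R := RatFunc k) i i.n i.pos le_rfl
    rw [extend_self] at h h'
    have hi := incl_gen (k := k) i
    rw [show FreeAlgebra.ι k i = gen k s ν i from rfl, h, hi, h']
    refine Eq.trans ?_ (map_antipodeGen (incl k s ν : NCH k s ν →+* HK k s ν) s _ i.n).symm
    congr 1
    funext n
    rw [map_extend]
    congr 1
    funext i
    exact (incl_gen i).symm
  | mul x y hx hy => rw [map_mul, ncAntipode_mul, hx, hy, ncAntipode_mul, map_mul]
  | add x y hx hy => simp only [map_add, hx, hy]

theorem incl_mem_weightPart {w : ℕ} {x : NCH k s ν} (hx : x ∈ weightPart k s ν w) :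
    incl k s ν x ∈ weightPart (RatFunc k) s ν w := by
  refine Submodule.span_induction ?_ ?_ ?_ ?_ hx
  · rintro _ ⟨l, hl, rfl⟩
    refine Submodule.subset_span ⟨l, hl, ?_⟩
    rw [map_list_prod, List.map_map]
    congr 1
    exact List.map_congr_left fun i _ => incl_gen i
  · rw [map_zero]; exact zero_mem _
  · intro x y _ _ hx hy; rw [map_add]; exact add_mem hx hy
  · intro c x _ hx
    rw [map_smul, ← algebraMap_smul (RatFunc k) c]
    exact Submodule.smul_mem _ _ hx

theorem isHopfEmbedding_orderIncl : IsHopfEmbedding (order k s ν) (orderIncl k s ν) where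
  injective x y h := incl_injective (by rw [← coe_orderIncl, ← coe_orderIncl, h])
  graded w x hx := by rw [coe_orderIncl]; exact incl_mem_weightPart hx
  counit x := by rw [coe_orderIncl, counit_incl]
  comul x l hl := by
    simp only [coe_orderIncl]
    rw [comul_incl, hl, map_list_sum, List.map_map]
    congr 1
    exact List.map_congr_left fun p _ => inclTensor_tmul _ _
  antipode x := by rw [coe_orderIncl, coe_orderIncl, antipode_incl]

end embedding

/-! ### Generators and weights of the specialization -/

section generators
variable {k : Type u} [Field k] {s : ℕ} {ν : ℕ∞} {F : Type v} [CommRing F] [HopfAlgebra k F]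
  {P : PoissonBracket k F} {σ : order k s ν →ₐ[k] F}

theorem exists_list_sum_tmul {R A : Type*} [CommRing R] [Ring A] [Algebra R A] (t : A ⊗[R] A) :
    ∃ l : List (A × A), t = (l.map fun p => p.1 ⊗ₜ[R] p.2).sum := by
  induction t with
  | zero => exact ⟨[], rfl⟩
  | tmul x y => exact ⟨[(x, y)], by simp⟩
  | add x y hx hy =>
    obtain ⟨l, hl⟩ := hx
    obtain ⟨l', hl'⟩ := hy
    exact ⟨l ++ l', by rw [hl, hl', List.map_append, List.sum_append]⟩

/-- The morphism from `H` to the specialization transports the formula for the coproduct of `a_n`.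
-/
theorem IsSpecialization.comul_generator (hσ : IsSpecialization (order k s ν) P σ) (i : Idx s ν) :
    Coalgebra.comul (R := k) (σ (tau k s ν (FreeLieAlgebra.of k i))) =
      coprod k s (extend fun i => σ (tau k s ν (FreeLieAlgebra.of k i))) i.n := by
  obtain ⟨l, hl⟩ := exists_list_sum_tmul (Coalgebra.comul (R := k) (gen k s ν i))
  have h := hσ.comul (orderIncl k s ν (gen k s ν i))
    (l.map fun p => (orderIncl k s ν p.1, orderIncl k s ν p.2)) (by
      rw [isHopfEmbedding_orderIncl.comul _ l hl, List.map_map]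
      rfl)
  rw [orderIncl_gen, List.map_map] at h
  rw [h]
  let ρ : NCH k s ν →ₐ[k] F := σ.comp (orderIncl k s ν)
  have h' := map_coprod (S := k) (ρ : NCH k s ν →+* F)
    (Algebra.TensorProduct.map ρ ρ).toLinearMap.toAddMonoidHom (fun x y => rfl) (gen k s ν) i.n
  rw [← comul_gen, hl] at h'
  have hρ : (fun i => (ρ : NCH k s ν →+* F) (gen k s ν i)) =
      fun i => σ (tau k s ν (FreeLieAlgebra.of k i)) :=
    funext fun i => congr_arg σ (orderIncl_gen i)
  rw [hρ] at h'
  rw [← h']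
  refine Eq.trans ?_ (map_list_sum (Algebra.TensorProduct.map ρ ρ) _).symm
  rw [List.map_map]
  rfl

theorem IsSpecialization.isDiffHopf (hσ : IsSpecialization (order k s ν) P σ) :
    IsDiffHopf k fun i : Idx s ν => σ (tau k s ν (FreeLieAlgebra.of k i)) :=
  isDiffHopf_of_comul hσ.comul_generator fun _ => hσ.counit_tau _

/-- A family of submodules that spans the module, with projections, is a grading. -/
theorem isInternal_of_proj {R M : Type*} [CommRing R] [AddCommGroup M] [Module R M]
    {W : ℕ → Submodule R M} (p : ℕ → M →ₗ[R] M) (hp : ∀ i, ∀ x ∈ W i, p i x = x)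
    (hp' : ∀ i j, i ≠ j → ∀ x ∈ W i, p j x = 0) (h : ∀ x, x ∈ ⨆ i, W i) :
    DirectSum.IsInternal W := by
  refine DirectSum.isInternal_submodule_of_iSupIndep_of_iSup_eq_top ?_ (eq_top_iff.2 fun x _ => h x)
  rw [iSupIndep_def]
  intro i
  rw [Submodule.disjoint_def]
  intro x hx hx'
  have hle : ⨆ j, ⨆ (_ : j ≠ i), W j ≤ LinearMap.ker (p i) :=
    iSup₂_le fun j hj x hx => hp' j i hj x hx
  rw [← hp i x hx]
  exact hle hx'

/-- The part of weight `w` of the specialization. -/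
noncomputable def specWeight (σ : order k s ν →ₐ[k] F) (w : ℕ) : Submodule k F :=
  (((weightPart (RatFunc k) s ν w).restrictScalars k).comap
    ((order k s ν).val.toLinearMap.restrictScalars k)).map σ.toLinearMap

theorem mem_specWeight {w : ℕ} {f : F} : f ∈ specWeight σ w ↔
    ∃ y : order k s ν, (y : HK k s ν) ∈ weightPart (RatFunc k) s ν w ∧ σ y = f := Iff.rfl

theorem mem_orderGr_iff {w : ℕ} {y : HK k s ν} (hy : y ∈ order k s ν) :
    y ∈ orderGr k s ν w ↔ y ∈ weightPart (RatFunc k) s ν w := by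
  rw [← orderPart_order]
  exact ⟨fun h => h.2, fun h => ⟨hy, h⟩⟩

theorem tau_mem_specWeight {m : ℕ} {x : FL k s ν} (hx : IsLieMonomial k m x) :
    σ (tau k s ν x) ∈ specWeight σ m :=
  ⟨_, orderGr_le_weightPart m _ (hlie_mem_orderGr hx), rfl⟩

theorem map_orderGr_mem_specWeight {w : ℕ} {x : order k s ν} (hx : (x : HK k s ν) ∈
    orderGr k s ν w) :
    σ x ∈ specWeight σ w :=
  ⟨x, orderGr_le_weightPart w _ hx, rfl⟩

/-- The specialization has a projection to the part of weight `w`, since the order has one and the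
latter commutes with `ħ`. -/
theorem IsSpecialization.exists_specProj (hσ : IsSpecialization (order k s ν) P σ) (w : ℕ) :
    ∃ p : F →ₗ[k] F, ∀ i, ∀ f ∈ specWeight σ i, p f = if i = w then f else 0 := by
  let π : order k s ν →ₗ[k] order k s ν :=
    { toFun := fun a => ⟨weightProj k s ν w a, orderGr_le_order w _ (weightProj_mem_orderGr a.2 w)⟩
      map_add' := fun a b => Subtype.ext (map_add (weightProj k s ν w) (a : HK k s ν) b)
      map_smul' := fun c a => Subtype.ext
        (((weightProj k s ν w).restrictScalars k).map_smul c (a : HK k s ν)) }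
  have hX : ∀ a b, σ a = σ b → σ (π a) = σ (π b) := by
    intro a b h
    rw [← sub_eq_zero, ← map_sub] at h
    rw [← sub_eq_zero, ← map_sub, ← map_sub]
    obtain ⟨c, hc⟩ := (hσ.ker _).1 h
    rw [hc]
    refine (hσ.ker _).2 ⟨π c, Subtype.ext ?_⟩
    exact ((weightProj k s ν w).restrictScalars k[X]).map_smul _ _
  obtain ⟨g, hg⟩ := LinearMap.exists_rightInverse_of_surjective σ.toLinearMap
    (LinearMap.range_eq_top.2 hσ.surjective)
  refine ⟨σ.toLinearMap ∘ₗ π ∘ₗ g, ?_⟩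
  rintro i _ ⟨y, hy, rfl⟩
  have h1 : (σ.toLinearMap ∘ₗ π ∘ₗ g) (σ y) = σ (π y) :=
    hX _ _ (LinearMap.congr_fun hg (σ y))
  refine h1.trans ?_
  have h2 : π y = if i = w then y else 0 := by
    refine Subtype.ext ((weightProj_of_mem hy w).trans ?_)
    split_ifs <;> rfl
  rw [h2]
  split_ifs
  · rfl
  · rw [map_zero]

theorem counit_weightPart {R : Type*} [CommRing R] {w : ℕ} (hw : w ≠ 0) {x : NCH R s ν}
    (hx : x ∈ weightPart R s ν w) : (Coalgebra.counit x : R) = 0 := by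
  refine Submodule.span_induction ?_ ?_ ?_ ?_ hx
  · rintro _ ⟨l, hl, rfl⟩
    rcases l with _ | ⟨i, l⟩
    · exact absurd hl.symm hw
    · have h := counit_gen (R := R) i
      rw [List.map_cons, List.prod_cons, Bialgebra.counit_mul, h, zero_mul]
  · rw [map_zero]
  · intro x y _ _ hx hy; rw [map_add, hx, hy, add_zero]
  · intro c x _ hx
    rw [map_smul, hx, smul_zero]

/-- Elements of `tensorGr` are sums of pure tensors, without coefficients. -/
theorem exists_list_of_mem_tensorGr {w : ℕ} {t : HK k s ν ⊗[RatFunc k] HK k s ν}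
    (ht : t ∈ tensorGr (orderGr k s ν) w) : ∃ l : List (order k s ν × order k s ν),
      t = (l.map fun p => (p.1 : HK k s ν) ⊗ₜ[RatFunc k] (p.2 : HK k s ν)).sum ∧
      ∀ p ∈ l, ∃ i j, i + j = w ∧ (p.1 : HK k s ν) ∈ orderGr k s ν i ∧
        (p.2 : HK k s ν) ∈ orderGr k s ν j := by
  induction ht using Submodule.span_induction with
  | zero => exact ⟨[], rfl, by simp⟩
  | add x y _ _ hx hy =>
    obtain ⟨l, rfl, h⟩ := hx
    obtain ⟨l', rfl, h'⟩ := hy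
    refine ⟨l ++ l', by rw [List.map_append, List.sum_append], fun p hp => ?_⟩
    rcases List.mem_append.1 hp with hp | hp
    · exact h p hp
    · exact h' p hp
  | smul r x _ hx =>
    obtain ⟨l, rfl, h⟩ := hx
    refine ⟨l.map fun p => (r • p.1, p.2), ?_, fun p hp => ?_⟩
    · rw [List.smul_sum, List.map_map, List.map_map]
      rfl
    · obtain ⟨q, hq, rfl⟩ := List.mem_map.1 hp
      obtain ⟨i, j, hij, hi, hj⟩ := h q hq
      exact ⟨i, j, hij, Submodule.smul_mem _ r hi, hj⟩
  | mem x hx =>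
    obtain ⟨i, j, hij, y, hy, z, hz, rfl⟩ := hx
    refine ⟨[(⟨y, orderGr_le_order i y hy⟩, ⟨z, orderGr_le_order j z hz⟩)], by simp, ?_⟩
    intro p hp
    rw [List.mem_singleton] at hp
    subst hp
    exact ⟨i, j, hij, hy, hz⟩

theorem IsSpecialization.isHopfGrading (hσ : IsSpecialization (order k s ν) P σ) :
    IsHopfGrading (specWeight σ) where
  mul :=
    { one_mem := ⟨1, one_mem_weightPart, map_one σ⟩
      mul_mem := by
        rintro i j _ _ ⟨y, hy, rfl⟩ ⟨z, hz, rfl⟩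
        exact ⟨y * z, mul_mem_weightPart hy hz, map_mul σ y z⟩ }
  internal := by
    choose p hp using hσ.exists_specProj
    refine isInternal_of_proj p (fun i f hf => ?_) (fun i j hij f hf => ?_) fun f => ?_
    · rw [hp i i f hf, if_pos rfl]
    · rw [hp j i f hf, if_neg hij]
    · obtain ⟨a, rfl⟩ := hσ.surjective f
      obtain ⟨a, ha⟩ := a
      induction ha using order_induction with
      | mem w x hx =>
        exact Submodule.mem_iSup_of_mem w
          (map_orderGr_mem_specWeight (x := ⟨x, orderGr_le_order w x hx⟩) hx)
      | add x y hx hy h h' =>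
        have := add_mem h h'
        rwa [← map_add] at this
  comul := by
    rintro w _ ⟨y, hy, rfl⟩
    obtain ⟨l, hl, h⟩ := exists_list_of_mem_tensorGr
      (comul_mem_orderGr w (y : HK k s ν) ((mem_orderGr_iff y.2).2 hy))
    rw [AlgHom.toLinearMap_apply, hσ.comul y l hl]
    refine list_sum_mem fun t ht => ?_
    obtain ⟨q, hq, rfl⟩ := List.mem_map.1 ht
    obtain ⟨i, j, hij, hi, hj⟩ := h q hq
    exact Submodule.subset_span ⟨i, j, hij, _, map_orderGr_mem_specWeight hi, _,
      map_orderGr_mem_specWeight hj, rfl⟩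
  counit := by
    rintro w hw _ ⟨y, hy, rfl⟩
    have h : (Coalgebra.counit (y : HK k s ν) : RatFunc k) = 0 := counit_weightPart hw hy
    rw [AlgHom.toLinearMap_apply, hσ.counit y 0 (by rw [h, map_zero]), Polynomial.eval_zero]
  antipode := by
    rintro w _ ⟨y, hy, rfl⟩
    have h := antipode_mem_orderGr w (y : HK k s ν) ((mem_orderGr_iff y.2).2 hy)
    rw [AlgHom.toLinearMap_apply, hσ.antipode y ⟨_, orderGr_le_order w _ h⟩ rfl]
    exact map_orderGr_mem_specWeight h

/-- The grading of the specialization by the degree of polynomials in the elements `ħ x`. -/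
theorem IsSpecialization.exists_degree_grading [CharZero k] (hs : 0 < s)
    (hσ : IsSpecialization (order k s ν) P σ) : ∃ D : ℕ → Submodule k F,
      SetLike.GradedMonoid D ∧ DirectSum.IsInternal D ∧ ∀ x, σ (tau k s ν x) ∈ D 1 := by
  let b := Module.Basis.ofVectorSpace k (FL k s ν)
  let e := AlgEquiv.ofBijective _ (hσ.bijective_aeval hs b)
  have he : ∀ i, e (MvPolynomial.X i) = σ (tau k s ν (b i)) := fun i => MvPolynomial.aeval_X _ _
  refine ⟨fun n => (MvPolynomial.homogeneousSubmodule _ k n).map e.toLinearMap,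
    { one_mem := ⟨1, MvPolynomial.isHomogeneous_one _ _, map_one e⟩
      mul_mem := ?_ }, ?_, ?_⟩
  · rintro i j _ _ ⟨y, hy, rfl⟩ ⟨z, hz, rfl⟩
    exact ⟨y * z, MvPolynomial.IsHomogeneous.mul hy hz, map_mul e y z⟩
  · have hp : ∀ i j, ∀ y ∈ MvPolynomial.homogeneousSubmodule _ k i,
        (e.toLinearMap ∘ₗ MvPolynomial.homogeneousComponent j ∘ₗ e.symm.toLinearMap) (e y) =
          if j = i then e y else 0 := by
      intro i j y hy
      rw [LinearMap.comp_apply, LinearMap.comp_apply, AlgEquiv.toLinearMap_apply,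
        AlgEquiv.toLinearMap_apply, AlgEquiv.symm_apply_apply,
        MvPolynomial.homogeneousComponent_of_mem hy]
      split_ifs
      · rfl
      · rw [map_zero]
    refine isInternal_of_proj (fun j => e.toLinearMap ∘ₗ MvPolynomial.homogeneousComponent j ∘ₗ
      e.symm.toLinearMap) ?_ ?_ fun f => ?_
    · rintro i _ ⟨y, hy, rfl⟩
      exact (hp i i y hy).trans (if_pos rfl)
    · rintro i j hij _ ⟨y, hy, rfl⟩
      exact (hp i j y hy).trans (if_neg hij.symm)
    · obtain ⟨p, rfl⟩ := e.surjective f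
      rw [← MvPolynomial.sum_homogeneousComponent p, map_sum]
      exact sum_mem fun j _ => Submodule.mem_iSup_of_mem j
        ⟨_, MvPolynomial.homogeneousComponent_mem j p, rfl⟩
  · intro x
    rw [← b.linearCombination_repr x, Finsupp.linearCombination_apply, Finsupp.sum, map_sum,
      map_sum]
    refine sum_mem fun i _ => ?_
    rw [map_smul, map_smul, ← he]
    exact Submodule.smul_mem _ _ ⟨_, MvPolynomial.isHomogeneous_X _ _, rfl⟩

end generators

/-! ### The specialization is a free Poisson algebra -/

section poisson
variable {k : Type u} [Field k]

theorem PoissonBracket.br_swap {B : Type*} [CommRing B] [Algebra k B] (P : PoissonBracket k B)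
    (a b : B) : P.br a b = - P.br b a := by
  have h := P.self (a + b)
  rw [map_add, map_add, LinearMap.add_apply, LinearMap.add_apply, P.self, P.self, zero_add,
    add_zero] at h
  exact eq_neg_of_add_eq_zero_right h

theorem PoissonBracket.br_one {B : Type*} [CommRing B] [Algebra k B] (P : PoissonBracket k B)
    (a : B) : P.br a 1 = 0 := by
  have h := P.leibniz a 1 1
  simpa using h

/-- The Lie ring given by a Poisson bracket. -/
abbrev PoissonBracket.lieRing {B : Type*} [CommRing B] [Algebra k B] (P : PoissonBracket k B) :
    LieRing B :=
  { (inferInstance : AddCommGroup B) with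
    bracket := fun a b => P.br a b
    add_lie := fun x y z => by
      change P.br (x + y) z = P.br x z + P.br y z
      rw [map_add, LinearMap.add_apply]
    lie_add := fun x y z => map_add (P.br x) y z
    lie_self := P.self
    leibniz_lie := fun x y z => by
      change P.br x (P.br y z) = P.br (P.br x y) z + P.br y (P.br x z)
      have h := P.jacobi x y z
      rw [P.br_swap z x, map_neg, P.br_swap z] at h
      linear_combination h }

/-- The Lie algebra given by a Poisson bracket. -/
abbrev PoissonBracket.lieAlgebra {B : Type*} [CommRing B] [Algebra k B] (P : PoissonBracket k B) :
    letI := P.lieRing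
    LieAlgebra k B :=
  letI := P.lieRing
  { (Algebra.toModule : Module k B) with
    lie_smul := fun t x y => map_smul (P.br x) t y }

/-- The universal property of the free Lie algebra, for the Lie algebra given by a Poisson
bracket. -/
theorem PoissonBracket.exists_lieMap {B : Type*} [CommRing B] [Algebra k B]
    (P : PoissonBracket k B) {I : Type*} (f : I → B) : ∃ l : FreeLieAlgebra k I →ₗ[k] B,
      (∀ x y, l ⁅x, y⁆ = P.br (l x) (l y)) ∧ ∀ i, l (FreeLieAlgebra.of k i) = f i := by
  let := P.lieRing
  let := P.lieAlgebra
  let l : FreeLieAlgebra k I →ₗ⁅k⁆ B := FreeLieAlgebra.lift k f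
  exact ⟨{ toFun := l, map_add' := map_add l, map_smul' := map_smul l }, l.map_lie,
    fun i => FreeLieAlgebra.lift_of_apply f i⟩

/-- By the Leibniz rule, compatibility with the brackets can be tested on generators of the
algebra. -/
theorem PoissonBracket.map_br_of_adjoin {A B : Type*} [CommRing A] [Algebra k A] [CommRing B]
    [Algebra k B] (P : PoissonBracket k A) (P' : PoissonBracket k B) (φ : A →ₐ[k] B) {S : Set A}
    (hS : Algebra.adjoin k S = ⊤) (h : ∀ x ∈ S, ∀ y ∈ S, φ (P.br x y) = P'.br (φ x) (φ y))
    (a b : A) : φ (P.br a b) = P'.br (φ a) (φ b) := by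
  have key : ∀ a, (∀ y ∈ S, φ (P.br a y) = P'.br (φ a) (φ y)) → ∀ b,
      φ (P.br a b) = P'.br (φ a) (φ b) := by
    intro a ha b
    have hb : b ∈ Algebra.adjoin k S := by rw [hS]; trivial
    induction hb using Algebra.adjoin_induction with
    | mem x hx => exact ha x hx
    | algebraMap r =>
      rw [AlgHom.commutes, Algebra.algebraMap_eq_smul_one, Algebra.algebraMap_eq_smul_one, map_smul,
        map_smul, map_smul, P.br_one, P'.br_one, smul_zero, map_zero, smul_zero]
    | add x y _ _ hx hy => simp only [map_add, hx, hy]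
    | mul x y _ _ hx hy => rw [P.leibniz, map_add, map_mul, map_mul, hx, hy, map_mul, P'.leibniz]
  refine key a (fun y hy => ?_) b
  rw [P.br_swap, map_neg, key y (h y hy), ← P'.br_swap]

variable {s : ℕ} {ν : ℕ∞} {F : Type v} [CommRing F] [HopfAlgebra k F]
  {P : PoissonBracket k F} {σ : order k s ν →ₐ[k] F}

theorem IsSpecialization.br_tau (hσ : IsSpecialization (order k s ν) P σ) (x y : FL k s ν) :
    P.br (σ (tau k s ν x)) (σ (tau k s ν y)) = σ (tau k s ν ⁅x, y⁆) :=
  hσ.bracket _ _ _ (tau_lie x y)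

theorem IsSpecialization.counit_br (hσ : IsSpecialization (order k s ν) P σ) (f g : F) :
    (Coalgebra.counit (P.br f g) : k) = 0 := by
  obtain ⟨a, rfl⟩ := hσ.surjective f
  obtain ⟨b, rfl⟩ := hσ.surjective g
  obtain ⟨c, hc, h⟩ := order_comm a.2 b.2
  rw [hσ.bracket a b ⟨c, hc⟩ (Subtype.ext h), hσ.counit _ 0, Polynomial.eval_zero]
  have h' := congr_arg (Coalgebra.counit (R := RatFunc k)) h
  rw [map_sub, Bialgebra.counit_mul, Bialgebra.counit_mul, mul_comm, sub_self, map_X_smul] at h'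
  rw [map_zero]
  refine (mul_eq_zero.1 h'.symm).resolve_left ?_
  rw [RatFunc.algebraMap_X]
  exact RatFunc.X_ne_zero

/-- A morphism of Poisson algebras out of the specialization is determined on the elements `ħ x`
by its values on the generators. -/
theorem IsSpecialization.poissonHom_tau (hσ : IsSpecialization (order k s ν) P σ)
    {B : Type*} [CommRing B] [Algebra k B] {P' : PoissonBracket k B} {φ : F →ₐ[k] B}
    (hφ : ∀ a b, φ (P.br a b) = P'.br (φ a) (φ b)) {l : FL k s ν →ₗ[k] B}
    (hl : ∀ x y, l ⁅x, y⁆ = P'.br (l x) (l y))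
    (h : ∀ i : Idx s ν, φ (σ (tau k s ν (FreeLieAlgebra.of k i))) = l (FreeLieAlgebra.of k i))
    (x : FL k s ν) : φ (σ (tau k s ν x)) = l x := by
  induction x using freeLie_induction with
  | of i => exact h i
  | zero => simp only [map_zero]
  | add x y hx hy => simp only [map_add, hx, hy]
  | smul c x hx => simp only [map_smul, hx]
  | lie x y hx hy => rw [← hσ.br_tau, hφ, hx, hy, hl]

theorem IsSpecialization.algHom_ext (hσ : IsSpecialization (order k s ν) P σ)
    {B : Type*} [Semiring B] [Algebra k B] {φ ψ : F →ₐ[k] B}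
    (h : ∀ x, φ (σ (tau k s ν x)) = ψ (σ (tau k s ν x))) : φ = ψ :=
  AlgHom.ext_of_adjoin_eq_top hσ.adjoin_tau (by rintro _ ⟨x, rfl⟩; exact h x)

theorem IsSpecialization.poissonHom_ext (hσ : IsSpecialization (order k s ν) P σ)
    {B : Type*} [CommRing B] [Algebra k B] {P' : PoissonBracket k B} {φ ψ : F →ₐ[k] B}
    (hφ : ∀ a b, φ (P.br a b) = P'.br (φ a) (φ b)) (hψ : ∀ a b, ψ (P.br a b) = P'.br (ψ a) (ψ b))
    (h : ∀ i : Idx s ν, φ (σ (tau k s ν (FreeLieAlgebra.of k i))) =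
      ψ (σ (tau k s ν (FreeLieAlgebra.of k i)))) : φ = ψ := by
  obtain ⟨l, hl, hl'⟩ := P'.exists_lieMap fun i : Idx s ν =>
    φ (σ (tau k s ν (FreeLieAlgebra.of k i)))
  refine hσ.algHom_ext fun x => ?_
  rw [hσ.poissonHom_tau hφ hl (fun i => (hl' i).symm), hσ.poissonHom_tau hψ hl
    (fun i => by rw [hl' i, h])]

/-- A linear map from `L` extends to an algebra morphism on the specialization, which is
polynomial on a basis of `L`; it respects the brackets if its restriction to `L` does. -/
theorem IsSpecialization.exists_poissonHom [CharZero k] (hs : 0 < s)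
    (hσ : IsSpecialization (order k s ν) P σ) {B : Type*} [CommRing B] [Algebra k B]
    (P' : PoissonBracket k B) (f : Idx s ν → B) : ∃ φ : F →ₐ[k] B,
      (∀ a b, φ (P.br a b) = P'.br (φ a) (φ b)) ∧
      ∀ i, φ (σ (tau k s ν (FreeLieAlgebra.of k i))) = f i := by
  obtain ⟨l, hl, hl'⟩ := P'.exists_lieMap f
  let b := Module.Basis.ofVectorSpace k (FL k s ν)
  let e := AlgEquiv.ofBijective _ (hσ.bijective_aeval hs b)
  have he : ∀ i, e (MvPolynomial.X i) = σ (tau k s ν (b i)) := fun i => MvPolynomial.aeval_X _ _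
  let φ : F →ₐ[k] B := (MvPolynomial.aeval fun i => l (b i)).comp e.symm.toAlgHom
  have hφ : ∀ x, φ (σ (tau k s ν x)) = l x := by
    intro x
    have : φ.toLinearMap ∘ₗ σ.toLinearMap ∘ₗ tau k s ν = l := b.ext fun i => by
      change MvPolynomial.aeval (fun i => l (b i)) (e.symm (σ (tau k s ν (b i)))) = l (b i)
      rw [← he, AlgEquiv.symm_apply_apply, MvPolynomial.aeval_X]
    exact LinearMap.congr_fun this x
  refine ⟨φ, P.map_br_of_adjoin P' φ hσ.adjoin_tau ?_, fun i => by rw [hφ, hl']⟩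
  rintro _ ⟨x, rfl⟩ _ ⟨y, rfl⟩
  rw [hσ.br_tau, hφ, hφ, hφ, hl]

theorem IsSpecialization.freelyGeneratedBy [CharZero k] (hs : 0 < s)
    (hσ : IsSpecialization (order k s ν) P σ) :
    PoissonBracket.FreelyGeneratedBy.{u, v, w, 0} P
      (fun i : Idx s ν => σ (tau k s ν (FreeLieAlgebra.of k i))) := by
  intro B _ _ P' f
  obtain ⟨φ, hφ, hf⟩ := hσ.exists_poissonHom hs P' f
  exact ⟨φ, ⟨hφ, hf⟩, fun ψ hψ => hσ.poissonHom_ext hψ.1 hφ fun i => by rw [hψ.2, hf]⟩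

end poisson

/-! ### The embedding of `F[G]` and the projection to it -/

section projection
variable {k : Type u} [Field k] {s : ℕ} {ν : ℕ∞}

theorem fg_algHom_ext {B : Type*} [CommRing B] [Algebra k B] {φ ψ : FG k s ν →ₐ[k] B}
    (h : ∀ i, φ (coord k s ν i) = ψ (coord k s ν i)) : φ = ψ :=
  MvPolynomial.algHom_ext (σ := Idx s ν) (R := k) (f := φ) (g := ψ) h

/-- The algebra morphism from `F[G]` with given values on the coordinates. -/
noncomputable def fgLift {B : Type*} [CommRing B] [Algebra k B] (f : Idx s ν → B) :
    FG k s ν →ₐ[k] B :=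
  (MvPolynomial.aeval f : MvPolynomial (Idx s ν) k →ₐ[k] B)

theorem fgLift_coord {B : Type*} [CommRing B] [Algebra k B] (f : Idx s ν → B) (i : Idx s ν) :
    fgLift (k := k) f (coord k s ν i) = f i := MvPolynomial.aeval_X _ _

theorem counit_coord (i : Idx s ν) : (Coalgebra.counit (coord k s ν i) : k) = 0 :=
  MvPolynomial.aeval_X _ _

variable {F : Type v} [CommRing F] [HopfAlgebra k F]
  {P : PoissonBracket k F} {σ : order k s ν →ₐ[k] F}

/-- The morphism `μ` with `a_n ↦ ħ x_n mod ħ`. -/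
noncomputable def IsSpecialization.embed (hσ : IsSpecialization (order k s ν) P σ) :
    FG k s ν →ₐc[k] F :=
  BialgHom.ofAlgHom (fgLift fun i => σ (tau k s ν (FreeLieAlgebra.of k i)))
    (fg_algHom_ext fun i => by
      change (Coalgebra.counit (fgLift _ (coord k s ν i)) : k) = Coalgebra.counit (coord k s ν i)
      rw [fgLift_coord, hσ.counit_tau, counit_coord])
    (fg_algHom_ext fun i => by
      change Algebra.TensorProduct.map (fgLift _) (fgLift _)
        (Coalgebra.comul (R := k) (coord k s ν i)) =
          Coalgebra.comul (R := k) (fgLift _ (coord k s ν i))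
      rw [fgLift_coord, comul_coord, hσ.comul_generator]
      refine (map_coprod (S := k) (B := F)
        (fgLift (k := k) fun i => σ (tau k s ν (FreeLieAlgebra.of k i)) : FG k s ν →+* F)
        (Algebra.TensorProduct.map (fgLift _) (fgLift _)).toLinearMap.toAddMonoidHom
        (fun x y => rfl) (coord k s ν) i.n).trans ?_
      congr 2
      funext i
      exact fgLift_coord _ i)

theorem IsSpecialization.embed_coord (hσ : IsSpecialization (order k s ν) P σ) (i : Idx s ν) :
    hσ.embed (coord k s ν i) = σ (tau k s ν (FreeLieAlgebra.of k i)) :=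
  fgLift_coord _ i

/-- The zero Poisson bracket. -/
def zeroBracket (k : Type*) (B : Type*) [CommRing k] [CommRing B] [Algebra k B] :
    PoissonBracket k B where
  br := 0
  self _ := rfl
  jacobi _ _ _ := by simp
  leibniz _ _ _ := by simp

/-- The projection `π` to `F[G]`: the morphism from the free Poisson algebra to `F[G]` with the
zero bracket is compatible with the coproducts, as `F ⊗ F → F[G] ⊗ F[G]` kills the brackets. -/
theorem IsSpecialization.exists_proj [CharZero k] (hs : 0 < s)
    (hσ : IsSpecialization (order k s ν) P σ) (hP : P.IsPoissonHopf) :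
    ∃ π : F →ₐc[k] FG k s ν, (∀ f g, π (P.br f g) = 0) ∧
      ∀ i, π (σ (tau k s ν (FreeLieAlgebra.of k i))) = coord k s ν i := by
  obtain ⟨φ, hφ, hc⟩ := hσ.exists_poissonHom hs (zeroBracket k (FG k s ν)) (coord k s ν)
  have hφ0 : ∀ a b, φ (P.br a b) = 0 := hφ
  refine ⟨BialgHom.ofAlgHom φ ?_ ?_, hφ0, hc⟩
  · refine hσ.poissonHom_ext (P' := zeroBracket k k) (fun a b => ?_) (fun a b => ?_) fun i => ?_
    · change (Coalgebra.counit (φ (P.br a b)) : k) = 0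
      rw [hφ0, map_zero]
    · exact hσ.counit_br a b
    · change (Coalgebra.counit (φ (σ (tau k s ν (FreeLieAlgebra.of k i)))) : k) =
        Coalgebra.counit (σ (tau k s ν (FreeLieAlgebra.of k i)))
      rw [hc, hσ.counit_tau, counit_coord]
  · have hbr : ∀ t t' : F ⊗[k] F, Algebra.TensorProduct.map φ φ (P.tensor t t') = 0 := by
      intro t t'
      induction t with
      | zero => simp
      | add x y hx hy => rw [map_add, LinearMap.add_apply, map_add, hx, hy, add_zero]
      | tmul a b =>
        induction t' with
        | zero => simp
        | add x y hx hy => rw [map_add, map_add, hx, hy, add_zero]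
        | tmul c d => simp [PoissonBracket.tensor, hφ0]
    refine hσ.poissonHom_ext (P' := zeroBracket k (FG k s ν ⊗[k] FG k s ν)) (fun a b => ?_)
      (fun a b => ?_) fun i => ?_
    · change Algebra.TensorProduct.map φ φ (Coalgebra.comul (R := k) (P.br a b)) = 0
      rw [hP, hbr]
    · change Coalgebra.comul (R := k) (φ (P.br a b)) = 0
      rw [hφ0, map_zero]
    · change Algebra.TensorProduct.map φ φ
        (Coalgebra.comul (R := k) (σ (tau k s ν (FreeLieAlgebra.of k i)))) =
        Coalgebra.comul (R := k) (φ (σ (tau k s ν (FreeLieAlgebra.of k i))))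
      rw [hc, comul_coord, hσ.comul_generator]
      refine (map_coprod (S := k) (φ : F →+* FG k s ν)
        (Algebra.TensorProduct.map φ φ).toLinearMap.toAddMonoidHom
        (fun x y => rfl) _ i.n).trans ?_
      congr 2
      funext i
      exact hc i

theorem IsSpecialization.proj_embed (hσ : IsSpecialization (order k s ν) P σ)
    {π : F →ₐc[k] FG k s ν} (h : ∀ i, π (σ (tau k s ν (FreeLieAlgebra.of k i))) = coord k s ν i)
    (f : FG k s ν) : π (hσ.embed f) = f := by
  have : (π : F →ₐ[k] FG k s ν).comp (hσ.embed : FG k s ν →ₐ[k] F) = AlgHom.id k _ :=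
    fg_algHom_ext fun i => (congr_arg π (hσ.embed_coord i)).trans (h i)
  exact DFunLike.congr_fun this f

theorem IsSpecialization.freelyGeneratedByAlg [CharZero k] (hs : 0 < s)
    (hσ : IsSpecialization (order k s ν) P σ) :
    PoissonBracket.FreelyGeneratedByAlg.{u, v, w, u} P (hσ.embed : FG k s ν →ₐ[k] F) := by
  intro B _ _ P' g
  obtain ⟨φ, hφ, hf⟩ := hσ.exists_poissonHom hs P' fun i => g (coord k s ν i)
  refine ⟨φ, ⟨hφ, fg_algHom_ext fun i => ?_⟩, fun ψ hψ => hσ.poissonHom_ext hψ.1 hφ fun i => ?_⟩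
  · exact (congr_arg φ (hσ.embed_coord i)).trans (hf i)
  · rw [hf, ← hψ.2]
    exact congr_arg ψ (hσ.embed_coord i).symm

theorem IsSpecialization.embed_mem_specWeight (hσ : IsSpecialization (order k s ν) P σ) {m : ℕ}
    {f : FG k s ν} (hf : f ∈ fgWeight k s ν m) : hσ.embed f ∈ specWeight σ m := by
  have := hσ.isHopfGrading.mul
  obtain ⟨p, rfl⟩ : ∃ p : MvPolynomial (Idx s ν) k, p = f := ⟨f, rfl⟩
  have hf' : MvPolynomial.IsWeightedHomogeneous (fun i : Idx s ν => s * i.n) p m := hf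
  have h : hσ.embed p = MvPolynomial.aeval
      (fun i => σ (tau k s ν (FreeLieAlgebra.of k i))) p := rfl
  rw [h, MvPolynomial.aeval_def, MvPolynomial.eval₂_eq]
  refine sum_mem fun d hd => ?_
  rw [← Algebra.smul_def]
  refine Submodule.smul_mem _ _ ?_
  rw [← hf' (MvPolynomial.mem_support_iff.1 hd), Finsupp.weight_apply, Finsupp.sum]
  exact SetLike.prod_pow_mem_graded _ _ _ _ fun i _ => tau_mem_specWeight (.of i)

theorem one_mem_fgWeight : (1 : FG k s ν) ∈ fgWeight k s ν 0 :=
  MvPolynomial.isWeightedHomogeneous_one k fun i : Idx s ν => s * i.n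

theorem mul_mem_fgWeight {i j : ℕ} {f g : FG k s ν} (hf : f ∈ fgWeight k s ν i)
    (hg : g ∈ fgWeight k s ν j) : f * g ∈ fgWeight k s ν (i + j) :=
  MvPolynomial.IsWeightedHomogeneous.mul (w := fun i : Idx s ν => s * i.n) hf hg

theorem coord_mem_fgWeight (i : Idx s ν) : coord k s ν i ∈ fgWeight k s ν (s * i.n) :=
  MvPolynomial.isWeightedHomogeneous_X k (fun i : Idx s ν => s * i.n) i

/-- The projection `π` annihilates all brackets, and maps the generators to the coordinates. -/
theorem IsSpecialization.proj_mem_fgWeight (hσ : IsSpecialization (order k s ν) P σ)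
    {π : F →ₐc[k] FG k s ν} (hbr : ∀ f g, π (P.br f g) = 0)
    (h : ∀ i, π (σ (tau k s ν (FreeLieAlgebra.of k i))) = coord k s ν i) {m : ℕ} {f : F}
    (hf : f ∈ specWeight σ m) : π f ∈ fgWeight k s ν m := by
  obtain ⟨y, hy, rfl⟩ := hf
  obtain ⟨y, hy'⟩ := y
  replace hy := (mem_orderGr_iff hy').2 hy
  have key : ∃ hy' : y ∈ order k s ν, π (σ ⟨y, hy'⟩) ∈ fgWeight k s ν m := by
    refine orderGr_induction (p := fun m y => ∃ hy' : y ∈ order k s ν,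
      π (σ ⟨y, hy'⟩) ∈ fgWeight k s ν m) ?_ ?_ ?_ ?_ ?_ m y hy
    · intro w
      refine ⟨zero_mem _, ?_⟩
      have : π (σ 0) = 0 := by rw [map_zero, map_zero]
      exact this ▸ zero_mem _
    · refine ⟨one_mem _, ?_⟩
      have : π (σ 1) = 1 := by rw [map_one, map_one]
      exact this ▸ one_mem_fgWeight
    · rintro w x y ⟨hx, hx'⟩ ⟨hy, hy'⟩
      refine ⟨add_mem hx hy, ?_⟩
      have := add_mem hx' hy'
      rwa [← map_add, ← map_add] at this
    · rintro w c x ⟨hx, hx'⟩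
      refine ⟨Subalgebra.smul_mem _ hx c, ?_⟩
      have h1 : σ ⟨c • x, Subalgebra.smul_mem _ hx c⟩ = c.eval 0 • σ ⟨x, hx⟩ := hσ.smul c ⟨x, hx⟩
      rw [h1, map_smul]
      exact Submodule.smul_mem _ _ hx'
    · rintro p x w y hx - ⟨hy, hy'⟩
      refine ⟨mul_mem (hlie_mem_order x) hy, ?_⟩
      have h1 : π (σ ⟨hlie k s ν x * y, mul_mem (hlie_mem_order x) hy⟩) =
          π (σ (tau k s ν x)) * π (σ ⟨y, hy⟩) := by
        rw [← map_mul, ← map_mul]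
        rfl
      rw [h1]
      refine mul_mem_fgWeight ?_ hy'
      induction hx with
      | of i => rw [h]; exact coord_mem_fgWeight i
      | lie hx hy _ _ => rw [← hσ.br_tau, hbr]; exact zero_mem _
  exact key.2

end projection

/-! ### Split epimorphisms of groups -/

/-- A split epimorphism of groups is a semidirect product, with the action by conjugation through
the section. -/
theorem isSemidirect_of_leftInverse {G K : Type*} [Group G] [Group K] (p : G →* K) (q : K →* G)
    (h : ∀ g, p (q g) = g) : IsSemidirect p q := by
  let φ : K →* MulAut p.ker := (MulAut.conjNormal (H := p.ker)).comp q
  have hφ : ∀ g : K, p.ker.subtype.comp (φ g).toMonoidHom =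
      (MulAut.conj (q g)).toMonoidHom.comp p.ker.subtype := fun g => by
    ext n
    simp [φ]
  refine ⟨φ, MulEquiv.ofBijective (SemidirectProduct.lift p.ker.subtype q hφ) ⟨?_, fun x => ?_⟩,
    fun n g => rfl⟩
  · rw [injective_iff_map_eq_one]
    rintro ⟨n, g⟩ hng
    have h1 : (n : G) * q g = 1 := hng
    have hg : g = 1 := by
      have := congr_arg p h1
      rwa [map_mul, n.2, one_mul, h, map_one] at this
    subst hg
    rw [map_one, mul_one] at h1
    exact SemidirectProduct.ext (Subtype.ext h1) rfl
  · refine ⟨⟨⟨x * (q (p x))⁻¹, ?_⟩, p x⟩, ?_⟩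
    · rw [MonoidHom.mem_ker, map_mul, map_inv, h, mul_inv_cancel]
    · exact inv_mul_cancel_right x (q (p x))

/-! ### The cotangent Lie bialgebra of a Poisson Hopf algebra -/

section cotangent
variable {k : Type u} [Field k] {F : Type v} [CommRing F] [HopfAlgebra k F]
  {L : Type w} [LieRing L] [LieAlgebra k L]

/-- The linear map `d` takes functions on a Poisson group to their differentials at the unit
element; the differentials are identified with the elements of `L`, and `t` provides a function
with given differential. These functions generate the algebra of all functions. -/
structure IsDifferential (P : PoissonBracket k F) (d : F →ₗ[k] L) (t : L →ₗ[k] F) : Prop where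
  mul : ∀ f g, d (f * g) = (Coalgebra.counit f : k) • d g + (Coalgebra.counit g : k) • d f
  br : ∀ f g, d (P.br f g) = ⁅d f, d g⁆
  counit_br : ∀ f g, (Coalgebra.counit (P.br f g) : k) = 0
  right_inv : ∀ x, d (t x) = x
  counit : ∀ x, (Coalgebra.counit (t x) : k) = 0
  adjoin : Algebra.adjoin k (Set.range t) = ⊤

variable {P : PoissonBracket k F} {d : F →ₗ[k] L} {t : L →ₗ[k] F}

theorem map_one_of_derivation {M : Type*} [AddCommGroup M] [Module k M] {D : F →ₗ[k] M}
    (hD : ∀ f g, D (f * g) = (Coalgebra.counit f : k) • D g + (Coalgebra.counit g : k) • D f) :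
    D 1 = 0 := by
  have h := hD 1 1
  simpa using h

/-- Derivations at the unit element are determined by their values on generators. -/
theorem IsDifferential.derivation_ext (hd : IsDifferential P d t) {M : Type*} [AddCommGroup M]
    [Module k M] {D D' : F →ₗ[k] M}
    (hD : ∀ f g, D (f * g) = (Coalgebra.counit f : k) • D g + (Coalgebra.counit g : k) • D f)
    (hD' : ∀ f g, D' (f * g) = (Coalgebra.counit f : k) • D' g + (Coalgebra.counit g : k) • D' f)
    (h : ∀ x, D (t x) = D' (t x)) : D = D' := by
  ext f
  have hf : f ∈ Algebra.adjoin k (Set.range t) := by rw [hd.adjoin]; trivial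
  induction hf using Algebra.adjoin_induction with
  | mem x hx =>
    obtain ⟨x, rfl⟩ := hx
    exact h x
  | algebraMap r =>
    rw [Algebra.algebraMap_eq_smul_one, map_smul, map_smul, map_one_of_derivation hD,
      map_one_of_derivation hD']
  | add x y _ _ hx hy => rw [map_add, map_add, hx, hy]
  | mul x y _ _ hx hy => rw [hD, hD', hx, hy]

/-- The linear map `f ↦ (d ⊗ d)(Δ f)`. -/
noncomputable def secondOrder (d : F →ₗ[k] L) : F →ₗ[k] L ⊗[k] L :=
  TensorProduct.map d d ∘ₗ Coalgebra.comul

/-- The linear map `f ↦ (d ⊗ d)(Δ f - Δᵒᵖ f)`. -/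
noncomputable def skewPart (d : F →ₗ[k] L) : F →ₗ[k] L ⊗[k] L :=
  secondOrder d - (TensorProduct.comm k L L).toLinearMap ∘ₗ secondOrder d

/-- The contraction `id ⊗ ε`. -/
noncomputable def contractRight (k F : Type*) [Field k] [CommRing F] [HopfAlgebra k F] :
    F ⊗[k] F →ₗ[k] F :=
  (TensorProduct.rid k F).toLinearMap ∘ₗ (Coalgebra.counit (R := k) (A := F)).lTensor F

/-- The contraction `ε ⊗ id`. -/
noncomputable def contractLeft (k F : Type*) [Field k] [CommRing F] [HopfAlgebra k F] :
    F ⊗[k] F →ₗ[k] F :=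
  (TensorProduct.lid k F).toLinearMap ∘ₗ (Coalgebra.counit (R := k) (A := F)).rTensor F

theorem contractRight_comul (f : F) : contractRight k F (Coalgebra.comul f) = f := by
  rw [contractRight, LinearMap.comp_apply, Coalgebra.lTensor_counit_comul]
  simp

theorem contractLeft_comul (f : F) : contractLeft k F (Coalgebra.comul f) = f := by
  rw [contractLeft, LinearMap.comp_apply, Coalgebra.rTensor_counit_comul]
  simp

theorem contractRight_tmul (a b : F) :
    contractRight k F (a ⊗ₜ b) = (Coalgebra.counit b : k) • a := by
  simp [contractRight]

theorem contractLeft_tmul (a b : F) :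
    contractLeft k F (a ⊗ₜ b) = (Coalgebra.counit a : k) • b := by
  simp [contractLeft]

/-- The differential of a product in second order; the counit is applied to one of the factors of
the tensors by contraction. -/
theorem IsDifferential.map_mul (hd : IsDifferential P d t) (u v : F ⊗[k] F) :
    TensorProduct.map d d (u * v) =
      (Coalgebra.counit (contractRight k F u) : k) • TensorProduct.map d d v +
      (Coalgebra.counit (contractRight k F v) : k) • TensorProduct.map d d u +
      (d (contractRight k F v) ⊗ₜ d (contractLeft k F u) +
        d (contractRight k F u) ⊗ₜ d (contractLeft k F v)) := by
  induction u with
  | zero => simp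
  | add x y hx hy =>
    rw [add_mul]
    simp only [map_add, hx, hy, add_smul, smul_add, TensorProduct.add_tmul, TensorProduct.tmul_add]
    abel
  | tmul a b =>
    induction v with
    | zero => simp
    | add x y hx hy =>
      rw [mul_add]
      simp only [map_add, hx, hy, add_smul, smul_add, TensorProduct.add_tmul,
        TensorProduct.tmul_add]
      abel
    | tmul c e =>
      simp only [Algebra.TensorProduct.tmul_mul_tmul, TensorProduct.map_tmul, hd.mul,
        contractRight_tmul, contractLeft_tmul, map_smul, TensorProduct.add_tmul,
        TensorProduct.tmul_add, TensorProduct.smul_tmul', TensorProduct.tmul_smul, smul_smul,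
        smul_eq_mul, smul_add]
      rw [mul_comm (Coalgebra.counit b) (Coalgebra.counit a),
        mul_comm (Coalgebra.counit e) (Coalgebra.counit c),
        mul_comm (Coalgebra.counit b) (Coalgebra.counit c),
        mul_comm (Coalgebra.counit e) (Coalgebra.counit a)]
      abel

theorem IsDifferential.secondOrder_mul (hd : IsDifferential P d t) (f g : F) :
    secondOrder d (f * g) = (Coalgebra.counit f : k) • secondOrder d g +
      (Coalgebra.counit g : k) • secondOrder d f + (d g ⊗ₜ d f + d f ⊗ₜ d g) := by
  have h := hd.map_mul (Coalgebra.comul f) (Coalgebra.comul g)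
  rw [contractRight_comul, contractLeft_comul, contractRight_comul, contractLeft_comul,
    ← Bialgebra.comul_mul] at h
  exact h

/-- The mixed terms in `IsDifferential.secondOrder_mul` are symmetric, so the skew part is a
derivation at the unit element. -/
theorem IsDifferential.skewPart_mul (hd : IsDifferential P d t) (f g : F) :
    skewPart d (f * g) = (Coalgebra.counit f : k) • skewPart d g +
      (Coalgebra.counit g : k) • skewPart d f := by
  simp only [skewPart, LinearMap.sub_apply, LinearMap.comp_apply, hd.secondOrder_mul, map_add,
    map_smul, LinearEquiv.coe_coe, TensorProduct.comm_tmul, smul_sub]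
  abel

/-- The cobracket on the differentials. -/
noncomputable def cobracket (d : F →ₗ[k] L) (t : L →ₗ[k] F) : L →ₗ[k] L ⊗[k] L :=
  skewPart d ∘ₗ t

/-- The skew part of the coproduct in second order depends on the differential only. -/
theorem IsDifferential.cobracket_apply (hd : IsDifferential P d t) (f : F) :
    cobracket d t (d f) = skewPart d f := by
  have : cobracket d t ∘ₗ d = skewPart d := by
    refine hd.derivation_ext (fun f g => ?_) hd.skewPart_mul fun x => ?_
    · rw [LinearMap.comp_apply, hd.mul, map_add, map_smul, map_smul]
      rfl
    · rw [LinearMap.comp_apply, hd.right_inv]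
      rfl
  exact LinearMap.congr_fun this f

theorem cobracket_skew (d : F →ₗ[k] L) (t : L →ₗ[k] F) (x : L) :
    TensorProduct.comm k L L (cobracket d t x) = - cobracket d t x := by
  have h : ∀ y : L ⊗[k] L, TensorProduct.comm k L L (TensorProduct.comm k L L y) = y :=
    (TensorProduct.comm k L L).symm_apply_apply
  simp only [cobracket, skewPart, LinearMap.comp_apply, LinearMap.sub_apply, LinearEquiv.coe_coe,
    map_sub, h, neg_sub]

/-- The cyclic permutation `a ⊗ b ⊗ c ↦ b ⊗ c ⊗ a`. -/
noncomputable def cyc (k M : Type*) [Field k] [AddCommGroup M] [Module k M] :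
    M ⊗[k] (M ⊗[k] M) →ₗ[k] M ⊗[k] (M ⊗[k] M) :=
  (TensorProduct.assoc k M M M).toLinearMap ∘ₗ (TensorProduct.comm k M (M ⊗[k] M)).toLinearMap

/-- The transposition `a ⊗ b ⊗ c ↦ b ⊗ a ⊗ c`. -/
noncomputable def swap₁₂ (k M : Type*) [Field k] [AddCommGroup M] [Module k M] :
    M ⊗[k] (M ⊗[k] M) →ₗ[k] M ⊗[k] (M ⊗[k] M) :=
  (TensorProduct.assoc k M M M).toLinearMap ∘ₗ
    (TensorProduct.comm k M M).toLinearMap.rTensor M ∘ₗ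
      (TensorProduct.assoc k M M M).symm.toLinearMap

theorem cyc_cyc_cyc {M : Type*} [AddCommGroup M] [Module k M] (y : M ⊗[k] (M ⊗[k] M)) :
    cyc k M (cyc k M (cyc k M y)) = y := by
  have : cyc k M ∘ₗ cyc k M ∘ₗ cyc k M = LinearMap.id := by
    ext a b c
    simp [cyc]
  exact LinearMap.congr_fun this y

theorem swap_cyc {M : Type*} [AddCommGroup M] [Module k M] (y : M ⊗[k] (M ⊗[k] M)) :
    swap₁₂ k M (cyc k M y) = cyc k M (cyc k M (swap₁₂ k M y)) := by
  have : swap₁₂ k M ∘ₗ cyc k M = cyc k M ∘ₗ cyc k M ∘ₗ swap₁₂ k M := by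
    ext a b c
    simp [cyc, swap₁₂]
  exact LinearMap.congr_fun this y

theorem cyc_map {M N : Type*} [AddCommGroup M] [Module k M] [AddCommGroup N] [Module k N]
    (f : M →ₗ[k] N) (y : M ⊗[k] (M ⊗[k] M)) :
    cyc k N (TensorProduct.map f (TensorProduct.map f f) y) =
      TensorProduct.map f (TensorProduct.map f f) (cyc k M y) := by
  have : cyc k N ∘ₗ TensorProduct.map f (TensorProduct.map f f) =
      TensorProduct.map f (TensorProduct.map f f) ∘ₗ cyc k M := by
    ext a b c
    simp [cyc]
  exact LinearMap.congr_fun this y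

/-- The co-Jacobi identity follows from the coassociativity of the coproduct. -/
theorem IsDifferential.coJacobi (hd : IsDifferential P d t) (x : L) :
    let y := TensorProduct.assoc k L L L
      (TensorProduct.map (cobracket d t) LinearMap.id (cobracket d t x))
    y + cyc k L y + cyc k L (cyc k L y) = 0 := by
  intro y
  let B : F ⊗[k] F →ₗ[k] F ⊗[k] (F ⊗[k] F) := (TensorProduct.assoc k F F F).toLinearMap ∘ₗ
    (Coalgebra.comul (R := k) (A := F)).rTensor F
  -- applying the cobracket to the first factor of `(d ⊗ d) u` antisymmetrizes `B u` in the first two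
  -- factors
  have hB : ∀ u : F ⊗[k] F, TensorProduct.assoc k L L L
      (TensorProduct.map (cobracket d t) LinearMap.id (TensorProduct.map d d u)) =
      TensorProduct.map d (TensorProduct.map d d) (B u - swap₁₂ k F (B u)) := by
    intro u
    induction u with
    | zero => simp
    | add a b ha hb => simp only [map_add, ha, hb, map_sub]; abel
    | tmul a b =>
      rw [TensorProduct.map_tmul, TensorProduct.map_tmul, hd.cobracket_apply]
      simp only [skewPart, secondOrder, LinearMap.sub_apply, LinearMap.comp_apply, swap₁₂, B,
        LinearMap.rTensor_tmul, LinearEquiv.coe_coe, LinearEquiv.symm_apply_apply]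
      generalize Coalgebra.comul (R := k) a = v
      induction v with
      | zero => simp
      | add a b ha hb =>
        simp only [map_add, TensorProduct.add_tmul, TensorProduct.sub_tmul, map_sub] at ha hb ⊢
        rw [add_sub_add_comm, ha, hb]
        abel
      | tmul a c => simp [TensorProduct.sub_tmul]
  have hB' : ∀ u : F ⊗[k] F, B (TensorProduct.comm k F F u) =
      cyc k F ((Coalgebra.comul (R := k) (A := F)).lTensor F u) := by
    intro u
    induction u with
    | zero => simp
    | add a b ha hb => simp only [map_add, ha, hb]
    | tmul a b => simp [B, cyc]
  have hcomm : ∀ u : F ⊗[k] F, TensorProduct.comm k L L (TensorProduct.map d d u) =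
      TensorProduct.map d d (TensorProduct.comm k F F u) := by
    intro u
    induction u with
    | zero => simp
    | add a b ha hb => simp only [map_add, ha, hb]
    | tmul a b => simp
  -- by coassociativity `(Δ ⊗ id)(Δᵒᵖ (t x))` is the cyclic permutation of `z`; the cobracket applied
  -- twice is thus an alternating sum of permutations of `z`, and its cyclic sum cancels
  set z := B (Coalgebra.comul (R := k) (t x)) with hz
  have hy : y = TensorProduct.map d (TensorProduct.map d d)
      (z - swap₁₂ k F z - (cyc k F z - swap₁₂ k F (cyc k F z))) := by
    have h1 : B (TensorProduct.comm k F F (Coalgebra.comul (R := k) (t x))) = cyc k F z := by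
      rw [hB', ← Coalgebra.coassoc_apply]
      rfl
    have h2 : cobracket d t x = TensorProduct.map d d (Coalgebra.comul (R := k) (t x)) -
        TensorProduct.map d d (TensorProduct.comm k F F (Coalgebra.comul (R := k) (t x))) := by
      rw [← hcomm]
      rfl
    change TensorProduct.assoc k L L L
      (TensorProduct.map (cobracket d t) LinearMap.id (cobracket d t x)) = _
    rw [h2, map_sub, map_sub, hB, hB, h1, ← map_sub]
  rw [hy, cyc_map, cyc_map, ← map_add, ← map_add]
  rw [← map_zero (TensorProduct.map d (TensorProduct.map d d))]
  congr 1
  simp only [map_sub, swap_cyc, cyc_cyc_cyc]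
  abel

/-- The action of `x` on the first factor of `L ⊗ L`. -/
noncomputable def adLeft (x : L) : L ⊗[k] L →ₗ[k] L ⊗[k] L :=
  (LieModule.toEnd k L L x).rTensor L

/-- The action of `x` on the second factor of `L ⊗ L`. -/
noncomputable def adRight (x : L) : L ⊗[k] L →ₗ[k] L ⊗[k] L :=
  (LieModule.toEnd k L L x).lTensor L

theorem adLeft_add_adRight (x : L) (y : L ⊗[k] L) : adLeft x y + adRight x y = ⁅x, y⁆ := by
  induction y with
  | zero => simp
  | add a b ha hb => rw [map_add, map_add, lie_add, ← ha, ← hb]; abel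
  | tmul a b =>
    rw [TensorProduct.LieModule.lie_tmul_right]
    rfl

theorem comm_lie (x : L) (y : L ⊗[k] L) :
    TensorProduct.comm k L L ⁅x, y⁆ = ⁅x, TensorProduct.comm k L L y⁆ := by
  induction y with
  | zero => simp
  | add a b ha hb => rw [lie_add, map_add, ha, hb, map_add, lie_add]
  | tmul a b =>
    rw [TensorProduct.comm_tmul, TensorProduct.LieModule.lie_tmul_right,
      TensorProduct.LieModule.lie_tmul_right, map_add, TensorProduct.comm_tmul,
      TensorProduct.comm_tmul, add_comm]

/-- The differential in second order of the bracket on `F ⊗ F`. -/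
theorem IsDifferential.map_tensor (hd : IsDifferential P d t) (u v : F ⊗[k] F) :
    TensorProduct.map d d (P.tensor u v) =
      adLeft (d (contractRight k F u)) (TensorProduct.map d d v) +
      adRight (d (contractLeft k F u)) (TensorProduct.map d d v) -
      (adLeft (d (contractRight k F v)) (TensorProduct.map d d u) +
      adRight (d (contractLeft k F v)) (TensorProduct.map d d u)) := by
  have hl : ∀ x y : L, ∀ z : L ⊗[k] L, adLeft (k := k) (x + y) z = adLeft x z + adLeft y z := by
    intro x y z; simp [adLeft, LinearMap.rTensor_add]
  have hr : ∀ x y : L, ∀ z : L ⊗[k] L, adRight (k := k) (x + y) z = adRight x z + adRight y z := by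
    intro x y z; simp [adRight, LinearMap.lTensor_add]
  induction u with
  | zero => simp [adLeft, adRight]
  | add x y hx hy =>
    simp only [map_add, LinearMap.add_apply, hx, hy, hl, hr]
    abel
  | tmul a b =>
    induction v with
    | zero => simp [adLeft, adRight]
    | add x y hx hy =>
      simp only [map_add, hx, hy, hl, hr]
      abel
    | tmul c e =>
      simp only [PoissonBracket.tensor, LinearMap.add_apply, TensorProduct.map₂_apply_tmul,
        LinearMap.mul_apply', map_add, TensorProduct.map_tmul, hd.mul, hd.br, contractRight_tmul,
        contractLeft_tmul, map_smul, adLeft, adRight, LinearMap.rTensor_tmul,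
          LinearMap.lTensor_tmul,
        LieModule.toEnd_apply_apply, LinearMap.smul_apply, TensorProduct.add_tmul,
        TensorProduct.tmul_add, TensorProduct.smul_tmul', TensorProduct.tmul_smul]
      rw [← lie_skew (d c) (d a), ← lie_skew (d e) (d b)]
      simp only [TensorProduct.neg_tmul, TensorProduct.tmul_neg, smul_neg]
      abel

theorem IsDifferential.secondOrder_br (hd : IsDifferential P d t) (hP : P.IsPoissonHopf) (f g : F) :
    secondOrder d (P.br f g) = ⁅d f, secondOrder d g⁆ - ⁅d g, secondOrder d f⁆ := by
  have h := hd.map_tensor (Coalgebra.comul f) (Coalgebra.comul g)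
  rw [contractRight_comul, contractLeft_comul, contractRight_comul, contractLeft_comul,
    adLeft_add_adRight, adLeft_add_adRight, ← hP] at h
  exact h

/-- The cocycle identity follows from the compatibility of the coproduct with the Poisson bracket.
-/
theorem IsDifferential.skewPart_br (hd : IsDifferential P d t) (hP : P.IsPoissonHopf) (f g : F) :
    skewPart d (P.br f g) = ⁅d f, skewPart d g⁆ - ⁅d g, skewPart d f⁆ := by
  simp only [skewPart, LinearMap.sub_apply, LinearMap.comp_apply, hd.secondOrder_br hP,
    LinearEquiv.coe_coe, map_sub, comm_lie, lie_sub]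
  abel

theorem IsDifferential.isLieCobracket (hd : IsDifferential P d t) (hP : P.IsPoissonHopf) :
    IsLieCobracket (cobracket d t) where
  skew := cobracket_skew d t
  coJacobi := hd.coJacobi
  cocycle x y := by
    have h := hd.skewPart_br hP (t x) (t y)
    rw [← hd.cobracket_apply, hd.br, hd.right_inv, hd.right_inv] at h
    exact h

/-- Modulo the square of the augmentation ideal, a function without constant term is determined by
its differential. -/
theorem IsDifferential.sub_mem_sq (hd : IsDifferential P d t) (f : F) :
    f - algebraMap k F (Coalgebra.counit f) - t (d f) ∈
      RingHom.ker (Bialgebra.counitAlgHom k F) ^ 2 := by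
  have hf : f ∈ Algebra.adjoin k (Set.range t) := by rw [hd.adjoin]; trivial
  induction hf using Algebra.adjoin_induction with
  | mem x hx =>
    obtain ⟨x, rfl⟩ := hx
    rw [hd.counit, map_zero, sub_zero, hd.right_inv, sub_self]
    exact zero_mem _
  | algebraMap r =>
    rw [Bialgebra.counit_algebraMap, sub_self, Algebra.algebraMap_eq_smul_one, map_smul,
      map_one_of_derivation hd.mul, smul_zero, map_zero, sub_zero]
    exact zero_mem _
  | add x y _ _ hx hy =>
    have := add_mem hx hy
    simp only [map_add]
    convert this using 1
    ring
  | mul x y _ _ hx hy =>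
    have hm : ∀ f : F, f - algebraMap k F (Coalgebra.counit f) ∈
        RingHom.ker (Bialgebra.counitAlgHom k F) := fun f => by
      rw [RingHom.mem_ker]
      simp
    have h1 := Ideal.mul_mem_mul (hm x) (hm y)
    rw [← pow_two] at h1
    have h2 := add_mem (add_mem h1 (Ideal.mul_mem_left _ (algebraMap k F (Coalgebra.counit x)) hy))
      (Ideal.mul_mem_left _ (algebraMap k F (Coalgebra.counit y)) hx)
    convert h2 using 1
    rw [hd.mul, map_add, map_smul, map_smul, Bialgebra.counit_mul, _root_.map_mul, Algebra.smul_def,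
      Algebra.smul_def]
    ring

theorem IsDifferential.map_sq (hd : IsDifferential P d t) {f : F}
    (hf : f ∈ RingHom.ker (Bialgebra.counitAlgHom k F) ^ 2) : d f = 0 := by
  rw [pow_two] at hf
  refine Submodule.mul_induction_on hf (fun a ha b hb => ?_) fun x y hx hy => ?_
  · have ha' : (Coalgebra.counit a : k) = 0 := ha
    have hb' : (Coalgebra.counit b : k) = 0 := hb
    rw [hd.mul, ha', hb', zero_smul, zero_smul, add_zero]
  · rw [map_add, hx, hy, add_zero]

theorem IsDifferential.cotangentClass_eq (hd : IsDifferential P d t) (f : F) :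
    cotangentClass k F f = cotangentClass k F (t (d f)) := by
  refine (Ideal.toCotangent_eq _).2 ?_
  have := hd.sub_mem_sq f
  simp only [hd.counit, map_zero, sub_zero]
  exact this

theorem IsDifferential.cotangentClass_injective (hd : IsDifferential P d t) {f : F}
    (hf : cotangentClass k F f = 0) : d f = 0 := by
  have h := hd.map_sq ((Ideal.toCotangent_eq_zero _ _).1 hf)
  dsimp only at h
  rwa [map_sub, Algebra.algebraMap_eq_smul_one, map_smul, map_one_of_derivation hd.mul, smul_zero,
    sub_zero] at h

theorem IsDifferential.bijective (hd : IsDifferential P d t) :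
    Function.Bijective (cotangentClass k F ∘ₗ t) := by
  constructor
  · rw [← LinearMap.ker_eq_bot, LinearMap.ker_eq_bot']
    intro x hx
    rw [← hd.right_inv x]
    exact hd.cotangentClass_injective hx
  · intro c
    obtain ⟨⟨f, hf⟩, rfl⟩ := Ideal.toCotangent_surjective _ c
    refine ⟨d f, ?_⟩
    rw [LinearMap.comp_apply, ← hd.cotangentClass_eq]
    have hf' : (Coalgebra.counit f : k) = 0 := hf
    refine (Ideal.toCotangent_eq _).2 ?_
    simp [hf']

/-- The isomorphism from `L` to the cotangent space. -/
noncomputable def IsDifferential.equiv (hd : IsDifferential P d t) :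
    L ≃ₗ[k] (RingHom.ker (Bialgebra.counitAlgHom k F)).Cotangent :=
  LinearEquiv.ofBijective _ hd.bijective

theorem IsDifferential.equiv_apply (hd : IsDifferential P d t) (x : L) :
    hd.equiv x = cotangentClass k F (t x) := rfl

theorem IsDifferential.eq_of_equiv_eq (hd : IsDifferential P d t) {x : L} {f : F}
    (h : hd.equiv x = cotangentClass k F f) : x = d f := by
  apply hd.equiv.injective
  rw [h, hd.cotangentClass_eq, hd.equiv_apply]

theorem IsDifferential.isCotangentIso (hd : IsDifferential P d t) :
    IsCotangentIso P (cobracket d t) hd.equiv where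
  bracket x y f g _ _ hx hy := by
    refine ⟨hd.counit_br f g, ?_⟩
    rw [hd.eq_of_equiv_eq hx, hd.eq_of_equiv_eq hy, ← hd.br, hd.equiv_apply, ← hd.cotangentClass_eq]
  cobracket x f _ hx := by
    rw [hd.eq_of_equiv_eq hx, hd.cobracket_apply]
    have h : ∀ u : F ⊗[k] F, TensorProduct.map hd.equiv.toLinearMap hd.equiv.toLinearMap
        (TensorProduct.map d d u - TensorProduct.comm k L L (TensorProduct.map d d u)) =
        TensorProduct.map (cotangentClass k F) (cotangentClass k F)
          (u - TensorProduct.comm k F F u) := by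
      intro u
      induction u with
      | zero => simp
      | add a b ha hb => rw [map_sub, map_sub] at *; simp only [map_add, add_sub_add_comm, ha, hb]
      | tmul a b =>
        simp only [TensorProduct.map_tmul, TensorProduct.comm_tmul, map_sub, LinearEquiv.coe_coe,
          hd.equiv_apply, ← hd.cotangentClass_eq]
    exact h _

end cotangent

/-! ### The cotangent Lie bialgebra of the specialization -/

section square
variable {k : Type u} [Field k] {L : Type v} [LieRing L] [LieAlgebra k L] [Module kᵐᵒᵖ L]
  [IsCentralScalar k L]

/-- The Poisson bracket on the square zero extension `k ⊕ L` of `k` by a Lie algebra `L`. -/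
noncomputable def squareZeroBracket : PoissonBracket k (TrivSqZeroExt k L) where
  br := LinearMap.mk₂ k (fun a b => TrivSqZeroExt.inr ⁅a.snd, b.snd⁆)
    (fun a b c => by rw [TrivSqZeroExt.snd_add, add_lie, TrivSqZeroExt.inr_add])
    (fun r a b => by rw [TrivSqZeroExt.snd_smul, smul_lie, TrivSqZeroExt.inr_smul])
    (fun a b c => by rw [TrivSqZeroExt.snd_add, lie_add, TrivSqZeroExt.inr_add])
    (fun r a b => by rw [TrivSqZeroExt.snd_smul, lie_smul, TrivSqZeroExt.inr_smul])
  self a := by simp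
  jacobi a b c := by
    simp only [LinearMap.mk₂_apply, TrivSqZeroExt.snd_inr, ← TrivSqZeroExt.inr_add, lie_jacobi,
      TrivSqZeroExt.inr_zero]
  leibniz a b c := by
    ext
    · simp
    · simp [lie_add, lie_smul, add_comm]

theorem squareZeroBracket_apply (a b : TrivSqZeroExt k L) :
    (squareZeroBracket (k := k) (L := L)).br a b = TrivSqZeroExt.inr ⁅a.snd, b.snd⁆ := rfl

end square

section specCotangent
variable {k : Type u} [Field k] {s : ℕ} {ν : ℕ∞} {F : Type v} [CommRing F] [HopfAlgebra k F]
  {P : PoissonBracket k F} {σ : order k s ν →ₐ[k] F}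

/-- As the specialization is a free Poisson algebra, it maps to the square zero extension of `k`
by the free Lie algebra; the second component of this morphism is the differential at the unit
element. -/
theorem IsSpecialization.exists_isDifferential [CharZero k] (hs : 0 < s)
    (hσ : IsSpecialization (order k s ν) P σ) :
    ∃ d : F →ₗ[k] FL k s ν, IsDifferential P d (σ.toLinearMap ∘ₗ tau k s ν) := by
  obtain ⟨φ, hφ, hc⟩ := hσ.exists_poissonHom hs (squareZeroBracket (k := k) (L := FL k s ν))
    fun i => TrivSqZeroExt.inr (FreeLieAlgebra.of k i)
  have hτ : ∀ x, φ (σ (tau k s ν x)) = TrivSqZeroExt.inr x :=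
    hσ.poissonHom_tau hφ (l := TrivSqZeroExt.inrHom k (FL k s ν)) (fun x y => rfl) hc
  have hfst : ∀ f, (φ f).fst = Coalgebra.counit f := by
    have : (TrivSqZeroExt.fstHom k k (FL k s ν)).comp φ = Bialgebra.counitAlgHom k F :=
      hσ.algHom_ext fun x => by
        change (φ (σ (tau k s ν x))).fst = Coalgebra.counit (σ (tau k s ν x))
        rw [hτ, hσ.counit_tau, TrivSqZeroExt.fst_inr]
    exact DFunLike.congr_fun this
  refine ⟨TrivSqZeroExt.sndHom k (FL k s ν) ∘ₗ φ.toLinearMap, ?_, ?_, hσ.counit_br, ?_,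
    hσ.counit_tau, hσ.adjoin_tau⟩
  · intro f g
    change (φ (f * g)).snd = _ • (φ g).snd + _ • (φ f).snd
    rw [map_mul, TrivSqZeroExt.snd_mul, hfst, hfst, op_smul_eq_smul]
  · intro f g
    change (φ (P.br f g)).snd = ⁅(φ f).snd, (φ g).snd⁆
    rw [hφ, squareZeroBracket_apply, TrivSqZeroExt.snd_inr]
  · intro x
    change (φ (σ (tau k s ν x))).snd = x
    rw [hτ, TrivSqZeroExt.snd_inr]

variable {d : F →ₗ[k] FL k s ν}

theorem map_compSum_of_derivation {M : Type*} [AddCommGroup M] [Module k M] {D : F →ₗ[k] M}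
    (hD : ∀ f g, D (f * g) = (Coalgebra.counit f : k) • D g + (Coalgebra.counit g : k) • D f)
    {a : ℕ → F} (ha : ∀ n, (Coalgebra.counit (a n) : k) = 0) {m n : ℕ} (hn : 1 ≤ n) (hm : 1 ≤ m) :
    D (compSum a m n) = if m = 1 then D (a n) else 0 := by
  rcases m with _ | _ | m
  · omega
  · rw [if_pos rfl, compSum, Finset.Nat.antidiagonalTuple_one, Finset.filter_singleton, if_pos]
    · simp
    · intro i
      fin_cases i
      exact hn
  · rw [if_neg (by omega), compSum, map_sum]
    refine Finset.sum_eq_zero fun j _ => ?_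
    rw [List.ofFn_succ, List.prod_cons, hD, ha, zero_smul, zero_add, List.ofFn_succ, List.prod_cons,
      Bialgebra.counit_mul, ha, zero_mul, zero_smul]

/-- A derivation at the unit element annihilates products of two functions that vanish there, so
that only the linear part `(s l + 1) a_n` of `Q_n^l(a)` contributes. -/
theorem map_Qpoly_of_derivation {M : Type*} [AddCommGroup M] [Module k M] {D : F →ₗ[k] M}
    (hD : ∀ f g, D (f * g) = (Coalgebra.counit f : k) • D g + (Coalgebra.counit g : k) • D f)
    {a : ℕ → F} (ha : ∀ n, (Coalgebra.counit (a n) : k) = 0) (s l : ℕ) {n : ℕ} (hn : 1 ≤ n) :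
    D (Qpoly s a l n) = ((s * l + 1 : ℕ) : k) • D (a n) := by
  rw [Qpoly, map_sum, Finset.sum_eq_single_of_mem 1 (by simpa using hn)]
  · rw [Nat.choose_one_right, ← nsmul_eq_mul, map_nsmul, map_compSum_of_derivation hD ha hn le_rfl,
      if_pos rfl, Nat.cast_smul_eq_nsmul]
  · intro m hm hm1
    rw [← nsmul_eq_mul, map_nsmul, map_compSum_of_derivation hD ha hn (Finset.mem_Icc.1 hm).1,
      if_neg hm1, smul_zero]

theorem IsSpecialization.cobracket_of (hσ : IsSpecialization (order k s ν) P σ)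
    (hd : IsDifferential P d (σ.toLinearMap ∘ₗ tau k s ν)) (i : Idx s ν) :
    cobracket d (σ.toLinearMap ∘ₗ tau k s ν) (FreeLieAlgebra.of k i) =
      ∑ l ∈ Finset.Ico 1 i.n, ((s * l + 1 : ℕ) : k) •
        (freeGen k s ν l ⊗ₜ[k] freeGen k s ν (i.n - l) -
          freeGen k s ν (i.n - l) ⊗ₜ[k] freeGen k s ν l) := by
  set a : ℕ → F := extend fun i : Idx s ν => σ (tau k s ν (FreeLieAlgebra.of k i)) with ha
  have hε : ∀ n, (Coalgebra.counit (a n) : k) = 0 := by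
    intro n
    rw [ha, extend]
    split_ifs
    · exact hσ.counit_tau _
    · exact map_zero _
  have hda : ∀ n, d (a n) = freeGen k s ν n := by
    intro n
    rw [ha, extend, freeGen]
    split_ifs
    · exact hd.right_inv _
    · exact map_zero _
  have h2 : secondOrder d (σ (tau k s ν (FreeLieAlgebra.of k i))) =
      ∑ l ∈ Finset.Ico 1 i.n, ((s * l + 1 : ℕ) : k) •
        (freeGen k s ν l ⊗ₜ[k] freeGen k s ν (i.n - l)) := by
    rw [secondOrder, LinearMap.comp_apply, hσ.comul_generator, coprod, map_add, map_add, map_sum,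
      TensorProduct.map_tmul, TensorProduct.map_tmul, map_one_of_derivation hd.mul,
      TensorProduct.tmul_zero, TensorProduct.zero_tmul, zero_add, zero_add]
    refine Finset.sum_congr rfl fun l hl => ?_
    rw [Finset.mem_Ico] at hl
    rw [TensorProduct.map_tmul, map_Qpoly_of_derivation hd.mul hε s l (by omega), hda, hda,
      TensorProduct.tmul_smul]
  change secondOrder d (σ (tau k s ν (FreeLieAlgebra.of k i))) - TensorProduct.comm k _ _
    (secondOrder d (σ (tau k s ν (FreeLieAlgebra.of k i)))) = _
  rw [h2, map_sum, ← Finset.sum_sub_distrib]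
  refine Finset.sum_congr rfl fun l _ => ?_
  rw [map_smul, TensorProduct.comm_tmul, smul_sub]

/-- The differential respects the weights: a product `ħ x * y` of homogeneous elements has
differential `ε(y) x`, which is zero unless `y` has weight zero. -/
theorem IsSpecialization.differential_mem (hσ : IsSpecialization (order k s ν) P σ)
    (hd : IsDifferential P d (σ.toLinearMap ∘ₗ tau k s ν)) {m : ℕ} {f : F}
    (hf : f ∈ specWeight σ m) : d f ∈ Submodule.span k {x | IsLieMonomial k m x} := by
  obtain ⟨y, hy, rfl⟩ := hf
  obtain ⟨y, hy'⟩ := y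
  replace hy := (mem_orderGr_iff hy').2 hy
  have key : ∃ hy' :
    y ∈ order k s ν, d (σ ⟨y, hy'⟩) ∈ Submodule.span k {x | IsLieMonomial k m x} := by
    refine orderGr_induction (p := fun m y => ∃ hy' : y ∈ order k s ν,
      d (σ ⟨y, hy'⟩) ∈ Submodule.span k {x | IsLieMonomial k m x}) ?_ ?_ ?_ ?_ ?_ m y hy
    · intro w
      refine ⟨zero_mem _, ?_⟩
      have : d (σ 0) = 0 := by rw [map_zero, map_zero]
      exact this ▸ zero_mem _
    · refine ⟨one_mem _, ?_⟩
      have : d (σ 1) = 0 := by rw [map_one, map_one_of_derivation hd.mul]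
      exact this ▸ zero_mem _
    · rintro w x y ⟨hx, hx'⟩ ⟨hy, hy'⟩
      refine ⟨add_mem hx hy, ?_⟩
      have := add_mem hx' hy'
      rwa [← map_add, ← map_add] at this
    · rintro w c x ⟨hx, hx'⟩
      refine ⟨Subalgebra.smul_mem _ hx c, ?_⟩
      have h1 : σ ⟨c • x, Subalgebra.smul_mem _ hx c⟩ = c.eval 0 • σ ⟨x, hx⟩ := hσ.smul c ⟨x, hx⟩
      rw [h1, map_smul]
      exact Submodule.smul_mem _ _ hx'
    · rintro p x w y hx hyw ⟨hy, -⟩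
      refine ⟨mul_mem (hlie_mem_order x) hy, ?_⟩
      have h1 : d (σ ⟨hlie k s ν x * y, mul_mem (hlie_mem_order x) hy⟩) =
          (Coalgebra.counit (σ ⟨y, hy⟩) : k) • x := by
        have h2 := hd.mul (σ (tau k s ν x)) (σ ⟨y, hy⟩)
        rw [hσ.counit_tau, zero_smul, zero_add, ← map_mul] at h2
        exact h2.trans (congr_arg _ (hd.right_inv x))
      rw [h1]
      rcases Nat.eq_zero_or_pos w with rfl | hw
      · exact Submodule.smul_mem _ _ (Submodule.subset_span hx)
      · have h0 := hσ.isHopfGrading.counit w hw.ne' _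
          (map_orderGr_mem_specWeight (σ := σ) (x := ⟨y, hy⟩) hyw)
        rw [h0, zero_smul]
        exact zero_mem _
  exact key.2

/-- The coproduct and the differential respect the weights, hence so does the cobracket. -/
theorem IsSpecialization.cobracket_mem (hσ : IsSpecialization (order k s ν) P σ)
    (hd : IsDifferential P d (σ.toLinearMap ∘ₗ tau k s ν)) {m : ℕ} {x : FL k s ν}
    (hx : IsLieMonomial k m x) : cobracket d (σ.toLinearMap ∘ₗ tau k s ν) x ∈
      Submodule.span k {t | ∃ p q : ℕ, p + q = m ∧
        ∃ y z, IsLieMonomial k p y ∧ IsLieMonomial k q z ∧ t = y ⊗ₜ[k] z} := by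
  have htmul : ∀ p q, p + q = m → ∀ y ∈ Submodule.span k {x : FL k s ν | IsLieMonomial k p x},
      ∀ z ∈ Submodule.span k {x : FL k s ν | IsLieMonomial k q x}, y ⊗ₜ[k] z ∈
      Submodule.span k {t | ∃ p q : ℕ, p + q = m ∧
        ∃ y z, IsLieMonomial k p y ∧ IsLieMonomial k q z ∧ t = y ⊗ₜ[k] z} := by
    intro p q hpq y hy z hz
    have h := Submodule.apply_mem_map₂ (TensorProduct.mk k (FL k s ν) (FL k s ν)) hy hz
    rw [Submodule.map₂_span_span] at h
    refine Submodule.span_mono ?_ h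
    rintro _ ⟨y, hy, z, hz, rfl⟩
    exact ⟨p, q, hpq, y, z, hy, hz, rfl⟩
  have h := hσ.isHopfGrading.comul m _ (tau_mem_specWeight (σ := σ) hx)
  change TensorProduct.map d d (Coalgebra.comul (R := k) (σ (tau k s ν x))) -
    TensorProduct.comm k _ _ (TensorProduct.map d d (Coalgebra.comul (R := k)
      (σ (tau k s ν x)))) ∈ _
  generalize Coalgebra.comul (R := k) (σ (tau k s ν x)) = u at h ⊢
  induction h using Submodule.span_induction with
  | zero => simp only [map_zero, sub_zero]; exact zero_mem _
  | add y z _ _ hy hz =>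
    have := add_mem hy hz
    rwa [← add_sub_add_comm, ← map_add, ← map_add, ← map_add] at this
  | smul c y _ hy =>
    have := Submodule.smul_mem _ c hy
    rwa [smul_sub, ← map_smul, ← map_smul, ← map_smul] at this
  | mem y hy =>
    obtain ⟨i, j, hij, y, hy, z, hz, rfl⟩ := hy
    rw [TensorProduct.map_tmul, TensorProduct.comm_tmul]
    have h1 := hσ.differential_mem hd hy
    have h2 := hσ.differential_mem hd hz
    exact sub_mem (htmul i j hij _ h1 _ h2) (htmul j i (by omega) _ h2 _ h1)

/-! ### The dimension of the group -/

theorem IsSpecialization.isDomain [CharZero k] (hs : 0 < s)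
    (hσ : IsSpecialization (order k s ν) P σ) : IsDomain F :=
  (AlgEquiv.ofBijective _ (hσ.bijective_aeval hs
    (Module.Basis.ofVectorSpace k (FL k s ν)))).symm.toMulEquiv.isDomain _

/-- The specialization is a polynomial algebra in infinitely many variables. -/
theorem IsSpecialization.ringKrullDim_eq_top [CharZero k] (hs : 0 < s)
    (hσ : IsSpecialization (order k s ν) P σ) (hν : ((2 * s : ℕ) : ℕ∞) ≤ ν) :
    ringKrullDim F = ⊤ := by
  let b := Module.Basis.ofVectorSpace k (FL k s ν)
  have : Infinite (Module.Basis.ofVectorSpaceIndex k (FL k s ν)) := by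
    rw [← not_finite_iff_infinite]
    intro h
    exact not_finite_freeLie hs hν (Module.Finite.of_basis b)
  rw [← ringKrullDim_eq_of_ringEquiv (AlgEquiv.ofBijective _ (hσ.bijective_aeval hs b)).toRingEquiv]
  refine top_unique (le_trans (le_of_eq ?_) (ringKrullDim_add_enatCard_le_ringKrullDim_mvPolynomial
    (R := k) (Module.Basis.ofVectorSpaceIndex k (FL k s ν))))
  rw [ringKrullDim_eq_zero_of_field, zero_add, ENat.card_eq_top_of_infinite]
  rfl

end specCotangent

/-! ### Functors of points -/

theorem Points.map_leftInverse {k : Type u} [Field k] {H : Type v} {H' : Type w} [CommRing H]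
    [HopfAlgebra k H] [CommRing H'] [HopfAlgebra k H'] {μ : H' →ₐc[k] H} {π : H →ₐc[k] H'}
    (h : ∀ f, π (μ f) = f) (R : Type*) [CommRing R] [Algebra k R] (g : Points k H' R) :
    Points.map R μ (Points.map R π g) = g := by
  let g' : WithConv (H' →ₐ[k] R) := g
  exact WithConv.ofConv_injective (AlgHom.ext fun f => congrArg (fun x => g'.ofConv x) (h f))

end FormalDiff

theorem theorem3p1 (k : Type u) [Field k] [CharZero k] (s : ℕ) (hs : s = 1 ∨ s = 2)
    (ν : ℕ∞) (hν : 1 ≤ ν) :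
    ∃ (A : Subalgebra k[X] (HK k s ν)) (τ : FL k s ν →ₗ[k] A),
      -- the algebra `A` is Drinfeld's algebra, `τ x` is `ħ x`, and they generate `A`
      (Subalgebra.toSubmodule A = drinfeld k s ν ∧
        (∀ x, (τ x : HK k s ν) = hbar k • lieIncl k s ν x) ∧
        Algebra.adjoin k[X] (Set.range τ) = ⊤ ∧
        ∀ (ι : Type v) (b : Module.Basis ι k (FL k s ν)),
          ∃ e : RingQuot (PresRel b) ≃ₐ[k[X]] A,
            ∀ i, e (RingQuot.mkAlgHom k[X] (PresRel b) (FreeAlgebra.ι k[X] i)) =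
              τ (b i)) ∧
      -- the graded Hopf subalgebra structure, and the embedding of `H`
      (Subalgebra.toSubmodule A ≤ rees k s ν ∧
        IsGradedHopfOrder A ∧
        ∃ j : NCH k s ν →ₐ[k] A,
          (∀ i, j (gen k s ν i) = τ (FreeLieAlgebra.of k i)) ∧
          IsHopfEmbedding A j) ∧
      ∃ (F : Type u) (_ : CommRing F) (_ : HopfAlgebra k F) (P : PoissonBracket k F)
        (σ : A →ₐ[k] F),
        -- the specialization at `ħ = 0`, the group `G*`
        (IsSpecialization A P σ ∧
          P.IsPoissonHopf ∧
          ConnectedSpace (PrimeSpectrum F) ∧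
          (((2 * s : ℕ) : ℕ∞) ≤ ν → ringKrullDim F = ⊤) ∧
          -- the cotangent Lie bialgebra
          (∃ δ : FL k s ν →ₗ[k] FL k s ν ⊗[k] FL k s ν,
            IsLieCobracket δ ∧
            (∀ i : Idx s ν, δ (FreeLieAlgebra.of k i) =
              ∑ l ∈ Finset.Ico 1 i.n, ((s * l + 1 : ℕ) : k) •
                (freeGen k s ν l ⊗ₜ[k] freeGen k s ν (i.n - l) -
                  freeGen k s ν (i.n - l) ⊗ₜ[k] freeGen k s ν l)) ∧
            (∀ (m : ℕ) (x : FL k s ν), IsLieMonomial k m x →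
              δ x ∈ Submodule.span k {t | ∃ p q : ℕ, p + q = m ∧
                ∃ y z, IsLieMonomial k p y ∧ IsLieMonomial k q z ∧
                  t = y ⊗ₜ[k] z}) ∧
            ∃ Ψ : FL k s ν ≃ₗ[k]
                (RingHom.ker (Bialgebra.counitAlgHom k F)).Cotangent,
              (∀ x, Ψ x = cotangentClass k F (σ (τ x))) ∧
              IsCotangentIso P δ Ψ) ∧
          -- the free Poisson algebra, its Hopf structure, and its polynomial structure
          PoissonBracket.FreelyGeneratedBy.{u, u, w, 0} P
            (fun i : Idx s ν => σ (τ (FreeLieAlgebra.of k i))) ∧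
          IsDiffHopf k
            (fun i : Idx s ν => σ (τ (FreeLieAlgebra.of k i))) ∧
          (∀ (ι : Type v) (b : Module.Basis ι k (FL k s ν)),
            Function.Bijective
              (MvPolynomial.aeval (fun i => σ (τ (b i))) : MvPolynomial ι k →ₐ[k] F)) ∧
          -- the algebra grading by degree
          (∃ D : ℕ → Submodule k F, SetLike.GradedMonoid D ∧ DirectSum.IsInternal D ∧
            ∀ x, σ (τ x) ∈ D 1)) ∧
        -- the Hopf algebra grading by weight, inherited from `A`
        ∃ W : ℕ → Submodule k F,
          (IsHopfGrading W ∧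
            (∀ m f, f ∈ W m ↔ ∃ y : A,
              (y : HK k s ν) ∈ weightPart (RatFunc k) s ν m ∧ σ y = f) ∧
            ∀ (m : ℕ) (x : FL k s ν), IsLieMonomial k m x →
              σ (τ x) ∈ W m) ∧
          -- the embedding `μ` and the projection `π`
          ∃ (μ : FG k s ν →ₐc[k] F) (π : F →ₐc[k] FG k s ν),
            ((∀ i, μ (coord k s ν i) = σ (τ (FreeLieAlgebra.of k i))) ∧
              Function.Injective μ ∧
              (∀ (m : ℕ), ∀ f ∈ fgWeight k s ν m, μ f ∈ W m) ∧
              PoissonBracket.FreelyGeneratedByAlg.{u, u, w, u} P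
                (μ : FG k s ν →ₐ[k] F)) ∧
            ((∀ i, π (σ (τ (FreeLieAlgebra.of k i))) = coord k s ν i) ∧
              (∀ f g, π (P.br f g) = 0) ∧
              Function.Surjective π ∧
              ∀ (m : ℕ), ∀ f ∈ W m, π f ∈ fgWeight k s ν m) ∧
            (∀ f, π (μ f) = f) ∧
            -- the algebraic groups, as functors of points
            ∀ (R : Type w) [CommRing R] [Algebra k R],
              Function.Surjective (Points.map R μ) ∧
              Function.Injective (Points.map R π) ∧
              (∀ g, Points.map R μ (Points.map R π g) = g) ∧
              IsSemidirect (Points.map R μ) (Points.map R π) := by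
  have hs0 : 0 < s := by omega
  have hσ := isSpecialization_orderSpec (k := k) (s := s) (ν := ν)
  have hP := specPoisson_isPoissonHopf (k := k) (A := order k s ν)
  obtain ⟨d, hd⟩ := hσ.exists_isDifferential hs0
  obtain ⟨π, hbr, hπ⟩ := hσ.exists_proj hs0 hP
  have hdom := hσ.isDomain hs0
  have hpts := fun (R : Type w) [CommRing R] [Algebra k R] =>
    Points.map_leftInverse (hσ.proj_embed hπ) R
  refine ⟨order k s ν, tau k s ν, ⟨hσ.toSubmodule_order hs0, fun x => (coe_tau x).trans
    (hlie_apply x), adjoin_tau, fun ι b => ⟨AlgEquiv.ofBijective _ (hσ.bijective_presMap b hs0),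
    presMap_mk b⟩⟩, ⟨?_, isGradedHopfOrder_order, orderIncl k s ν, orderIncl_gen,
    isHopfEmbedding_orderIncl⟩, Specialization k (order k s ν), inferInstance, inferInstance,
    specPoisson k (order k s ν), orderSpec k s ν, ⟨hσ, hP, inferInstance,
    hσ.ringKrullDim_eq_top hs0, ⟨_, hd.isLieCobracket hP, hσ.cobracket_of hd,
    fun m x => hσ.cobracket_mem hd, hd.equiv, hd.equiv_apply, hd.isCotangentIso⟩,
    hσ.freelyGeneratedBy hs0, hσ.isDiffHopf, fun ι b => hσ.bijective_aeval hs0 b,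
    hσ.exists_degree_grading hs0⟩, specWeight (orderSpec k s ν), ⟨hσ.isHopfGrading,
    fun m f => mem_specWeight, fun m x => tau_mem_specWeight⟩, hσ.embed, π,
    ⟨hσ.embed_coord, Function.LeftInverse.injective (hσ.proj_embed hπ),
    fun m f => hσ.embed_mem_specWeight, hσ.freelyGeneratedByAlg hs0⟩, ⟨hπ, hbr,
    Function.LeftInverse.surjective (hσ.proj_embed hπ), fun m f => hσ.proj_mem_fgWeight hbr hπ⟩,
    hσ.proj_embed hπ, fun R _ _ => ⟨Function.RightInverse.surjective (hpts R),
    Function.LeftInverse.injective (hpts R), hpts R, isSemidirect_of_leftInverse _ _ (hpts R)⟩⟩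
  rw [rees_eq]
  exact order_le_reesAlg
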